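/- Let $X$ be a topological space and $\mathcal R$ a sheaf of commutative rings on $X$. An $\mathcal R$-stack is a stack of categories on $X$ whose categories of sections $\mathfrak A(U)$ are $\mathcal R(U)$-linear, with bilinear composition and compatibly with restriction. An $\mathcal R$-functor is a morphism of such stacks (or prestacks) that is linear on morphisms, and an $\mathcal R$-equivalence ($\approx_{\mathcal R}$) is an $\mathcal R$-functor which is an equivalence of categories over each open subset. An $\mathcal R$-algebroid stack is an $\mathcal R$-stack $\mathfrak A$ which is locally non-empty (every point has an open neighbourhood $U$ such that $\mathfrak A(U)$ has an object) and locally connected by isomorphisms (any two objects of $\mathfrak A(U)$ are locally isomorphic, for every open $U$). For an $\mathcal R$-algebra $\mathcal A$ (a sheaf of associative unital algebras) on an open set, let $\mathcal A^+$ be the $\mathcal R$-stack associated with the prestack assigning to $V$ the category with one object and with $\mathcal A(V)$ as its set of morphisms. *Gluing data* consist of: 1. an open covering $X=\bigcup_i U_i$, and for all $i,j$ an open covering $U_i\cap U_j=\bigcup_{\alpha} U_{ij}^\alpha$; 2. $\mathcal R$-algebras $\mathcal A_i$ on $U_i$; 3. isomorphisms of $\mathcal R$-algebras $f_{ij}^\alpha\colon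 \mathcal A_j\to\mathcal A_i$ on $U_{ij}^\alpha$; 4. invertible sections $a_{ijk}^{\alpha\beta\gamma}\in\mathcal A_i^\times(U_{ijk}^{\alpha\beta\gamma})$, where $U_{ijk}^{\alpha\beta\gamma}=U_{ij}^\alpha\cap U_{ik}^\beta\cap U_{jk}^\gamma$; such that, with $\operatorname{ad}(a)(x)=axa^{-1}$, $$ \begin{cases} f_{ij}^\alpha f_{jk}^\gamma=\operatorname{ad}(a_{ijk}^{\alpha\beta\gamma})\,f_{ik}^\beta & \text{as morphisms } \mathcal A_k\to\mathcal A_i \text{ on } U_{ijk}^{\alpha\beta\gamma},\\ a_{ijk}^{\alpha\beta\gamma}\,a_{ikl}^{\beta\delta\varphi}=f_{ij}^\alpha(a_{jkl}^{\gamma\epsilon\varphi})\,a_{ijl}^{\alpha\delta\epsilon} & \text{in } \mathcal A_i\bigl(U_{ijk}^{\alpha\beta\gamma}\cap U_{ijl}^{\alpha\delta\epsilon}\cap U_{ikl}^{\beta\delta\varphi}\cap U_{jkl}^{\gamma\epsilon\varphi}\bigr). \end{cases} $$ The data are *ordinary* if for each pair $i,j$ there is exactly one index $\alpha$ (so that $U_{ij}^\alpha=U_i\cap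 U_j$ and the upper indices can be dropped). An $\mathcal R$-stack $\mathfrak A$ is *described by* the gluing data if there are $\mathcal R$-equivalences $\Psi_i\colon\mathcal A_i^+\to\mathfrak A|_{U_i}$ and invertible transformations $g_{ij}^\alpha\colon\Psi_j\Rightarrow\Psi_i f_{ij}^\alpha$ on $U_{ij}^\alpha$ such that, on $U_{ijk}^{\alpha\beta\gamma}$, one has $g_{ij}^\alpha\circ g_{jk}^\gamma=\Psi_i(a_{ijk}^{\alpha\beta\gamma})\circ g_{ik}^\beta$ as transformations $\Psi_k\Rightarrow\Psi_i f_{ij}^\alpha f_{jk}^\gamma$. Then, up to equivalence, an $\mathcal R$-algebroid stack is given by gluing data. Precisely: (a) every $\mathcal R$-algebroid stack on $X$ is described by some gluing data; (b) all gluing data describe some $\mathcal R$-algebroid stack; (c) if an $\mathcal R$-stack $\mathfrak A$ is described by given gluing data, then an $\mathcal R$-stack $\mathfrak B$ is described by the same gluing data if and only if $\mathfrak A\approx_{\mathcal R}\mathfrak B$; (d) if $X$ is Hausdorff and paracompact, every $\mathcal R$-algebroid stack on $X$ is described by ordinary gluing data: an open covering $X=\bigcup_iU_i$, $\mathcal R$-algebras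 $\mathcal A_i$ on $U_i$, isomorphisms $f_{ij}\colon\mathcal A_j\to\mathcal A_i$ on $U_{ij}=U_i\cap U_j$, and $a_{ijk}\in\mathcal A_i^\times(U_i\cap U_j\cap U_k)$ with $f_{ij}f_{jk}=\operatorname{ad}(a_{ijk})f_{ik}$ and $a_{ijk}a_{ikl}=f_{ij}(a_{jkl})a_{ijl}$. -/

import Mathlib

open CategoryTheory Opposite TopologicalSpace

universe u v w v₁ u₁

namespace Algebroid

section Site

variable {C : Type u₁} [Category.{v₁} C]

/-- A sheaf of (unital, associative, not necessarily commutative) `R`-algebras on the site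
`(C, J)`: a sheaf of rings with a morphism from `R` with central image. -/
structure AlgebraSheaf (J : GrothendieckTopology C) (R : Cᵒᵖ ⥤ CommRingCat.{u}) where
  toSheaf : Sheaf J RingCat.{u}
  structureMap : R ⋙ forget₂ CommRingCat RingCat ⟶ toSheaf.obj
  central (V : Cᵒᵖ) (r : R.obj V) (x : toSheaf.obj.obj V) :
    (structureMap.app V).hom r * x = x * (structureMap.app V).hom r

/-- An isomorphism of sheaves of `R`-algebras. -/
structure AlgebraSheaf.Iso {J : GrothendieckTopology C} {R : Cᵒᵖ ⥤ CommRingCat.{u}}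
    (A B : AlgebraSheaf J R) where
  toIso : A.toSheaf ≅ B.toSheaf
  structureMap_comp : A.structureMap ≫ toIso.hom.hom = B.structureMap

/-- The restriction to `V` of an algebra on `U`, for `i : V ⟶ U`. -/
def AlgebraSheaf.restrict {J : GrothendieckTopology C} {R : Cᵒᵖ ⥤ CommRingCat.{u}} {U V : C}
    (A : AlgebraSheaf (J.over U) ((Over.forget U).op ⋙ R)) (i : V ⟶ U) :
    AlgebraSheaf (J.over V) ((Over.forget V).op ⋙ R) where
  toSheaf := (J.overMapPullback RingCat i).obj A.toSheaf
  structureMap := Functor.whiskerLeft (Over.map i).op A.structureMap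
  central V r x := A.central (op ((Over.map i).obj V.unop)) r x

/-- An `R`-linear pseudofunctor `V ↦ F(V)` to categories: each `F(V)` is an `R(V)`-linear
category, and the restriction functors are compatible with the linear structures. -/
structure LinearPrestack (R : Cᵒᵖ ⥤ CommRingCat.{u}) where
  toPseudofunctor : Pseudofunctor (LocallyDiscrete Cᵒᵖ) Cat.{v, w}
  preadditive (V : C) : Preadditive (toPseudofunctor.obj (.mk (op V)))
  linear (V : C) : Linear (R.obj (op V)) (toPseudofunctor.obj (.mk (op V)))
  map_add {V W : C} (i : W ⟶ V) {P Q : toPseudofunctor.obj (.mk (op V))} (s t : P ⟶ Q) :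
    (toPseudofunctor.map i.op.toLoc).toFunctor.map (s + t) =
      (toPseudofunctor.map i.op.toLoc).toFunctor.map s +
        (toPseudofunctor.map i.op.toLoc).toFunctor.map t
  map_smul {V W : C} (i : W ⟶ V) {P Q : toPseudofunctor.obj (.mk (op V))}
    (r : R.obj (op V)) (s : P ⟶ Q) :
    (toPseudofunctor.map i.op.toLoc).toFunctor.map (r • s) =
      (R.map i.op).hom r • (toPseudofunctor.map i.op.toLoc).toFunctor.map s

namespace LinearPrestack

variable {R : Cᵒᵖ ⥤ CommRingCat.{u}}

instance (F : LinearPrestack.{u, v, w} R) (V : C) :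
    Preadditive (F.toPseudofunctor.obj (.mk (op V))) := F.preadditive V

instance (F : LinearPrestack.{u, v, w} R) (V : C) :
    Linear (R.obj (op V)) (F.toPseudofunctor.obj (.mk (op V))) := F.linear V

/-- The category `F(V)`. -/
abbrev obj (F : LinearPrestack.{u, v, w} R) (V : C) : Type w :=
  F.toPseudofunctor.obj (.mk (op V))

/-- The restriction functor `F(V) ⥤ F(W)` for `i : W ⟶ V`. -/
abbrev res (F : LinearPrestack.{u, v, w} R) {V W : C} (i : W ⟶ V) : F.obj V ⥤ F.obj W :=
  (F.toPseudofunctor.map i.op.toLoc).toFunctor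

/-- `F` is an `R`-linear stack. -/
def IsStack (F : LinearPrestack.{u, v, w} R) (J : GrothendieckTopology C) : Prop :=
  F.toPseudofunctor.IsStack J

/-- The restriction of `F` to `U`. -/
def restrict (F : LinearPrestack.{u, v, w} R) (U : C) :
    LinearPrestack.{u, v, w} ((Over.forget U).op ⋙ R) where
  toPseudofunctor := (Over.forget U).op.toPseudofunctor.comp F.toPseudofunctor
  preadditive V := F.preadditive V.left
  linear V := F.linear V.left
  map_add i _ _ s t := F.map_add i.left s t
  map_smul i _ _ r s := F.map_smul i.left r s

end LinearPrestack

/-- An `R`-functor: a pseudonatural transformation whose components are linear on morphisms. -/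
structure LinearFunctor {R : Cᵒᵖ ⥤ CommRingCat.{u}} (F G : LinearPrestack.{u, v, w} R) where
  toTrans : F.toPseudofunctor.StrongTrans G.toPseudofunctor
  map_add {V : C} {P Q : F.obj V} (s t : P ⟶ Q) :
    (toTrans.app (.mk (op V))).toFunctor.map (s + t) =
      (toTrans.app (.mk (op V))).toFunctor.map s + (toTrans.app (.mk (op V))).toFunctor.map t
  map_smul {V : C} {P Q : F.obj V} (r : R.obj (op V)) (s : P ⟶ Q) :
    (toTrans.app (.mk (op V))).toFunctor.map (r • s) =
      r • (toTrans.app (.mk (op V))).toFunctor.map s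

namespace LinearFunctor

variable {R : Cᵒᵖ ⥤ CommRingCat.{u}} {F G : LinearPrestack.{u, v, w} R}

/-- The functor `F(V) ⥤ G(V)`. -/
abbrev app (η : LinearFunctor F G) (V : C) : F.obj V ⥤ G.obj V :=
  (η.toTrans.app (.mk (op V))).toFunctor

/-- The structural isomorphism `η(P|_W) ≅ η(P)|_W`. -/
def resIso (η : LinearFunctor F G) {V W : C} (i : W ⟶ V) (P : F.obj V) :
    (η.app W).obj ((F.res i).obj P) ≅ (G.res i).obj ((η.app V).obj P) :=
  (Cat.Hom.toNatIso (η.toTrans.naturality i.op.toLoc)).app P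

/-- `η : F ⟶ G` exhibits `G` as the stack associated with `F`, where `G` is a stack and the
presheaves of morphisms of `F` are sheaves: `η` is fully faithful and every object of `G` is
locally isomorphic to an object in the image of `η`. -/
structure ExhibitsAssociatedStack (η : LinearFunctor F G) (J : GrothendieckTopology C) :
    Prop where
  isStack : G.IsStack J
  full (V : C) : (η.app V).Full
  faithful (V : C) : (η.app V).Faithful
  locally_essSurj (V : C) (Q : G.obj V) : ∃ S ∈ J V, ∀ ⦃W : C⦄ (i : W ⟶ V), S i →
    ∃ P : F.obj W, Nonempty ((η.app W).obj P ≅ (G.res i).obj Q)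

end LinearFunctor

/-- `R`-equivalence: there is an `R`-functor all of whose components are equivalences. -/
def LinearPrestack.Equivalent {R : Cᵒᵖ ⥤ CommRingCat.{u}} (F G : LinearPrestack.{u, v, w} R) :
    Prop :=
  ∃ η : LinearFunctor F G, ∀ V : C, (η.app V).IsEquivalence

end Site

section Star

/-- The type of objects of the category with a single object whose set of morphisms is `A`. -/
structure Star (A : RingCat.{u}) : Type w where
  pt ::

namespace Star

/-- Composition is multiplication: `y ∘ x = y * x`. -/
instance (A : RingCat.{u}) : Category.{u} (Star.{u, w} A) where
  Hom _ _ := A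
  id _ := (1 : A)
  comp := fun (x y : A) => y * x
  id_comp x := mul_one (M := A) x
  comp_id x := one_mul (M := A) x
  assoc x y z := (mul_assoc (G := A) z y x).symm

instance (A : RingCat.{u}) : Preadditive (Star.{u, w} A) where
  homGroup _ _ := inferInstanceAs (AddCommGroup A)
  add_comp _ _ _ x x' y := mul_add (R := A) y x x'
  comp_add _ _ _ x y y' := add_mul (R := A) y y' x

/-- The linear structure given by a ring homomorphism with central image: `r • x = φ r * x`. -/
abbrev linear (A : RingCat.{u}) (k : CommRingCat.{u}) (φ : k →+* A)
    (hφ : ∀ (r : k) (x : A), φ r * x = x * φ r) : Linear k (Star.{u, w} A) where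
  homModule _ _ := Module.compHom A φ
  smul_comp := fun _ _ _ r (x : A) (y : A) => by
    change y * (φ r * x) = φ r * (y * x)
    rw [← mul_assoc, ← hφ, mul_assoc]
  comp_smul := fun _ _ _ (x : A) r (y : A) => by
    change φ r * y * x = φ r * (y * x)
    rw [mul_assoc]

/-- The functor induced by a ring homomorphism. -/
def map {A B : RingCat.{u}} (f : A ⟶ B) : Star.{u, w} A ⥤ Star.{u, w} B where
  obj _ := pt
  map x := f.hom x
  map_id _ := map_one f.hom
  map_comp := fun (x y : A) => map_mul f.hom y x

end Star

/-- The functor `V ↦ (category with one object and with A(V) as set of morphisms)`. -/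
def AlgebraSheaf.starFunctor {C : Type u₁} [Category.{v₁} C] {J : GrothendieckTopology C}
    {R : Cᵒᵖ ⥤ CommRingCat.{u}} (A : AlgebraSheaf J R) : Cᵒᵖ ⥤ Cat.{u, w} where
  obj V := Cat.of (Star.{u, w} (A.toSheaf.obj.obj V))
  map i := (Star.map (A.toSheaf.obj.map i)).toCatHom
  map_id V := by
    rw [A.toSheaf.obj.map_id]
    rfl
  map_comp i j := by
    rw [A.toSheaf.obj.map_comp]
    rfl

/-- The `R`-linear prestack `V ↦ (category with one object and with A(V) as set of morphisms)`. -/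
def AlgebraSheaf.star {C : Type u₁} [Category.{v₁} C] {J : GrothendieckTopology C}
    {R : Cᵒᵖ ⥤ CommRingCat.{u}} (A : AlgebraSheaf J R) : LinearPrestack.{u, u, w} R where
  toPseudofunctor := A.starFunctor.toPseudofunctor'
  preadditive V :=
    (inferInstance : Preadditive (Star.{u, w} (A.toSheaf.obj.obj (op V))))
  linear V :=
    (Star.linear (A.toSheaf.obj.obj (op V)) (R.obj (op V)) (A.structureMap.app (op V)).hom
      (A.central (op V)) : Linear (R.obj (op V)) (Star.{u, w} (A.toSheaf.obj.obj (op V))))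
  map_add {V W} i _ _ s t := by
    have h : ∀ (x y : A.toSheaf.obj.obj (op V)), (A.toSheaf.obj.map i.op).hom (x + y) =
        (A.toSheaf.obj.map i.op).hom x + (A.toSheaf.obj.map i.op).hom y :=
      fun x y => map_add (A.toSheaf.obj.map i.op).hom x y
    exact h s t
  map_smul {V W} i _ _ r s := by
    have h : ∀ (x : A.toSheaf.obj.obj (op V)),
        (A.toSheaf.obj.map i.op).hom ((A.structureMap.app (op V)).hom r * x) =
          (A.structureMap.app (op W)).hom ((R.map i.op).hom r) *
            (A.toSheaf.obj.map i.op).hom x := by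
      intro x
      rw [map_mul]
      congr 1
      exact (congrArg (fun g => g.hom r) (A.structureMap.naturality i.op)).symm
    exact h s

end Star

section Space

variable {X : TopCat.{u}} {R : TopCat.Sheaf CommRingCat.{u} X}

/-- `R`-linear prestacks on the space `X` (with small sets of morphisms). -/
abbrev Prestack (R : TopCat.Sheaf CommRingCat.{u} X) : Type (u + 2) :=
  LinearPrestack.{u, u, u + 1} R.obj

/-- An `R`-algebroid stack: an `R`-stack which is locally non-empty and locally connected by
isomorphisms. -/
structure IsAlgebroidStack (F : Prestack R) : Prop where
  isStack : F.IsStack (Opens.grothendieckTopology X)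
  locally_nonempty (x : X) : ∃ U : Opens X, x ∈ U ∧ Nonempty (F.obj U)
  locally_connected (U : Opens X) (P Q : F.obj U) (x : X) (hx : x ∈ U) :
    ∃ (V : Opens X) (h : V ≤ U), x ∈ V ∧
      Nonempty ((F.res (homOfLE h)).obj P ≅ (F.res (homOfLE h)).obj Q)

/-- Sheaves of `R`-algebras on the open subset `U`. -/
abbrev AlgebraOn (R : TopCat.Sheaf CommRingCat.{u} X) (U : Opens X) :=
  AlgebraSheaf ((Opens.grothendieckTopology X).over U) ((Over.forget U).op ⋙ R.obj)

namespace AlgebraOn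

variable {U U' O : Opens X}

/-- The ring of sections `A(V)`. -/
abbrev sections (A : AlgebraOn R U) (V : Opens X) (h : V ≤ U) : RingCat.{u} :=
  A.toSheaf.obj.obj (op (Over.mk (homOfLE h)))

/-- Restriction of sections from `V` to `W`. -/
def res (A : AlgebraOn R U) {V W : Opens X} (h : V ≤ U) (k : W ≤ V) :
    A.sections V h →+* A.sections W (k.trans h) :=
  (A.toSheaf.obj.map (Over.homMk (homOfLE k) : Over.mk (homOfLE (k.trans h)) ⟶
    Over.mk (homOfLE h)).op).hom

/-- The action on sections over `V ⊆ O` of an isomorphism `A|_O ≅ B|_O`. -/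
def isoApp {A : AlgebraOn R U} {B : AlgebraOn R U'} {h : O ≤ U} {h' : O ≤ U'}
    (f : (A.restrict (homOfLE h)).Iso (B.restrict (homOfLE h'))) (V : Opens X) (k : V ≤ O) :
    A.sections V (k.trans h) →+* B.sections V (k.trans h') :=
  (f.toIso.hom.hom.app (op (Over.mk (homOfLE k)))).hom

end AlgebraOn

/-- An open covering `U i` of `X`, with an open covering `O i j α` of each double intersection
`U i ∩ U j`. For an open covering in the ordinary sense (`IsOrdinary`) there is a single index `α`,
so that `O i j α = U i ∩ U j`. -/
structure Covering (X : TopCat.{u}) where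
  ι : Type u
  U : ι → Opens X
  iSup_U : ⨆ i, U i = ⊤
  κ : ι → ι → Type u
  O (i j : ι) : κ i j → Opens X
  iSup_O (i j : ι) : ⨆ α, O i j α = U i ⊓ U j

namespace Covering

/-- There is exactly one index `α` for each pair `i`, `j`. -/
def IsOrdinary (𝒰 : Covering X) : Prop := ∀ i j, Nonempty (Unique (𝒰.κ i j))

variable (𝒰 : Covering X) {i j k : 𝒰.ι}

theorem O_le (α : 𝒰.κ i j) : 𝒰.O i j α ≤ 𝒰.U i ⊓ 𝒰.U j :=
  (le_iSup (𝒰.O i j) α).trans (𝒰.iSup_O i j).le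

theorem O_le_left (α : 𝒰.κ i j) : 𝒰.O i j α ≤ 𝒰.U i := (𝒰.O_le α).trans inf_le_left

theorem O_le_right (α : 𝒰.κ i j) : 𝒰.O i j α ≤ 𝒰.U j := (𝒰.O_le α).trans inf_le_right

/-- The open subsets covering `U i ∩ U j ∩ U k`. -/
def T (α : 𝒰.κ i j) (β : 𝒰.κ i k) (γ : 𝒰.κ j k) : Opens X :=
  𝒰.O i j α ⊓ 𝒰.O i k β ⊓ 𝒰.O j k γ

theorem T_le₁ (α : 𝒰.κ i j) (β : 𝒰.κ i k) (γ : 𝒰.κ j k) : 𝒰.T α β γ ≤ 𝒰.O i j α :=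
  inf_le_left.trans inf_le_left

theorem T_le₂ (α : 𝒰.κ i j) (β : 𝒰.κ i k) (γ : 𝒰.κ j k) : 𝒰.T α β γ ≤ 𝒰.O i k β :=
  inf_le_left.trans inf_le_right

theorem T_le₃ (α : 𝒰.κ i j) (β : 𝒰.κ i k) (γ : 𝒰.κ j k) : 𝒰.T α β γ ≤ 𝒰.O j k γ :=
  inf_le_right

theorem T_le (α : 𝒰.κ i j) (β : 𝒰.κ i k) (γ : 𝒰.κ j k) : 𝒰.T α β γ ≤ 𝒰.U i :=
  (𝒰.T_le₁ α β γ).trans (𝒰.O_le_left α)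

end Covering

/-- Gluing data: algebras `A i` on `U i`, isomorphisms `f α : A j ≅ A i` on `O i j α`,
invertible sections `a α β γ` of `A i` on `O i j α ∩ O i k β ∩ O j k γ`, such that
`f_ij f_jk = ad(a_ijk) f_ik` and `a_ijk a_ikl = f_ij(a_jkl) a_ijl`. -/
structure GluingData (R : TopCat.Sheaf CommRingCat.{u} X) where
  cov : Covering X
  A (i : cov.ι) : AlgebraOn R (cov.U i)
  f {i j : cov.ι} (α : cov.κ i j) :
    ((A j).restrict (homOfLE (cov.O_le_right α))).Iso ((A i).restrict (homOfLE (cov.O_le_left α)))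
  a {i j k : cov.ι} (α : cov.κ i j) (β : cov.κ i k) (γ : cov.κ j k) :
    ((A i).sections (cov.T α β γ) (cov.T_le α β γ))ˣ
  /-- on every open `V ⊆ O i j α ∩ O i k β ∩ O j k γ`, and for every section `x` of `A k` on `V` -/
  f_f {i j k : cov.ι} (α : cov.κ i j) (β : cov.κ i k) (γ : cov.κ j k) (V : Opens X)
    (h : V ≤ cov.T α β γ)
    (x : (A k).sections V (h.trans ((cov.T_le₃ α β γ).trans (cov.O_le_right γ)))) :
    AlgebraOn.isoApp (f α) V (h.trans (cov.T_le₁ α β γ))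
        (AlgebraOn.isoApp (f γ) V (h.trans (cov.T_le₃ α β γ)) x) =
      (A i).res (cov.T_le α β γ) h (a α β γ).val *
        AlgebraOn.isoApp (f β) V (h.trans (cov.T_le₂ α β γ)) x *
          (A i).res (cov.T_le α β γ) h (a α β γ)⁻¹.val
  /-- on the intersection of the domains of the four sections (stated on every open `V` in it) -/
  cocycle {i j k l : cov.ι} (α : cov.κ i j) (β : cov.κ i k) (γ : cov.κ j k) (δ : cov.κ i l)
    (ε : cov.κ j l) (φ : cov.κ k l) (V : Opens X) (h₁ : V ≤ cov.T α β γ) (h₂ : V ≤ cov.T α δ ε)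
    (h₃ : V ≤ cov.T β δ φ) (h₄ : V ≤ cov.T γ ε φ) :
    (A i).res (cov.T_le α β γ) h₁ (a α β γ).val * (A i).res (cov.T_le β δ φ) h₃ (a β δ φ).val =
      AlgebraOn.isoApp (f α) V (h₁.trans (cov.T_le₁ α β γ))
          ((A j).res (cov.T_le γ ε φ) h₄ (a γ ε φ).val) *
        (A i).res (cov.T_le α δ ε) h₂ (a α δ ε).val

namespace LinearFunctor

variable {U : Opens X} {A : AlgebraOn R U} {F : Prestack R}

/-- The image over `V ⊆ U` of the object of `star A` under an `R`-functor `star A ⟶ F|_U`. -/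
def pt (Ψ : LinearFunctor A.star (F.restrict U)) (V : Opens X) (h : V ≤ U) : F.obj V :=
  (Ψ.app (Over.mk (homOfLE h))).obj Star.pt

/-- The image over `V ⊆ U` of a section of `A`, viewed as a morphism of `star A`. -/
def ptMap (Ψ : LinearFunctor A.star (F.restrict U)) (V : Opens X) (h : V ≤ U)
    (x : A.sections V h) : Ψ.pt V h ⟶ Ψ.pt V h :=
  (Ψ.app (Over.mk (homOfLE h))).map (X := Star.pt) (Y := Star.pt) x

/-- The compatibility of `pt` with restriction from `V` to `W`. -/
def ptRes (Ψ : LinearFunctor A.star (F.restrict U)) {V W : Opens X} (h : V ≤ U) (k : W ≤ V) :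
    Ψ.pt W (k.trans h) ≅ (F.res (homOfLE k)).obj (Ψ.pt V h) :=
  Ψ.resIso (Over.homMk (homOfLE k) : Over.mk (homOfLE (k.trans h)) ⟶ Over.mk (homOfLE h)) Star.pt

end LinearFunctor

/-- The `R`-prestack `F` is described by the gluing data `D`: for each `i` an equivalence of
`F|_{U i}` with the stack associated with `A i`, given by `Ψ i`; over each `O i j α` an invertible
transformation `g α : Ψ j ⇒ Ψ i ∘ f α`, i.e. an identification of `(Ψ i)⁻¹ ∘ Ψ j` with the
functor induced by `f α`; such that the resulting two transformations
`Ψ k ⇒ Ψ i ∘ f α ∘ f γ` agree, one being `g α ∘ g γ` and the other the composition of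
`g β : Ψ k ⇒ Ψ i ∘ f β` with the transformation `f β ⇒ f α ∘ f γ` given by `a α β γ`. -/
structure GluingData.Presentation (D : GluingData R) (F : Prestack R) where
  Ψ (i : D.cov.ι) : LinearFunctor (D.A i).star (F.restrict (D.cov.U i))
  associated (i : D.cov.ι) :
    (Ψ i).ExhibitsAssociatedStack ((Opens.grothendieckTopology X).over (D.cov.U i))
  g {i j : D.cov.ι} (α : D.cov.κ i j) (V : Opens X) (h : V ≤ D.cov.O i j α) :
    (Ψ j).pt V (h.trans (D.cov.O_le_right α)) ≅ (Ψ i).pt V (h.trans (D.cov.O_le_left α))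
  g_naturality {i j : D.cov.ι} (α : D.cov.κ i j) (V : Opens X) (h : V ≤ D.cov.O i j α)
    (x : (D.A j).sections V (h.trans (D.cov.O_le_right α))) :
    (Ψ j).ptMap V _ x ≫ (g α V h).hom =
      (g α V h).hom ≫ (Ψ i).ptMap V _ (AlgebraOn.isoApp (D.f α) V h x)
  g_res {i j : D.cov.ι} (α : D.cov.κ i j) (V W : Opens X) (h : V ≤ D.cov.O i j α) (k : W ≤ V) :
    (g α W (k.trans h)).hom ≫ ((Ψ i).ptRes (h.trans (D.cov.O_le_left α)) k).hom =
      ((Ψ j).ptRes (h.trans (D.cov.O_le_right α)) k).hom ≫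
        (F.res (homOfLE k)).map (g α V h).hom
  g_comp {i j k : D.cov.ι} (α : D.cov.κ i j) (β : D.cov.κ i k) (γ : D.cov.κ j k)
    (V : Opens X) (h : V ≤ D.cov.T α β γ) :
    (g γ V (h.trans (D.cov.T_le₃ α β γ))).hom ≫ (g α V (h.trans (D.cov.T_le₁ α β γ))).hom =
      (g β V (h.trans (D.cov.T_le₂ α β γ))).hom ≫
        (Ψ i).ptMap V _ ((D.A i).res (D.cov.T_le α β γ) h (D.a α β γ).val)

end Space

end Algebroid

/-!
An algebroid stack is determined by its local objects and their isomorphisms. The argument passes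
through two intermediate notions.

*Trivializations.* By full faithfulness, a presentation of a stack `F` by gluing data `D` amounts to
objects `P i` of `F(U i)` with `End (P i) ≅ A i` and isomorphisms `P j ≅ P i` on the `O i j α` which
are compatible with `f α` and `a α β γ`, such that every object over an open subset of `U i` is
locally isomorphic to `P i`. This is `GluingData.Trivialization`, and the two notions are compared
in `Trivialization.toPresentation` and `Presentation.toTrivialization`. A trivialization can be
transported along an equivalence (`Trivialization.map`).

*Twisted modules.* The stack described by `D` is realized concretely. A twisted module over `V` is a
family of sheaves of right `A i`-modules on `V ∩ U i`, with semilinear bijections `tr α` on the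
`V ∩ O i j α` whose compositions are twisted by the `a α β γ`, locally free of rank one
(`TwistedModule`). They form a stack `twistedStack D`, because sheaves can be glued
(`isStack_twistedStack`). For each `i` there is a free twisted module over `U i` with a generator at
the index `i` (`freeModule`); over a smaller open subset, morphisms out of it are determined by
the image of the generator, which is arbitrary (`IsGenerator.bijective`). Hence these modules are a
trivialization of `twistedStack D` with gluing data `D` (`twistedTrivialization`), so that every `D`
describes an algebroid stack.

*Uniqueness.* If `F` is a stack with a trivialization `T` by `D`, then `Q ↦ (Hom(P i, Q))_i` is a
functor from `F` to `twistedStack D` (`Trivialization.homFunctor`). It takes `P i` to a module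
generated by the identity, so it is bijective on morphisms out of `P i`, hence on all morphisms by
the sheaf property (`IsOpenSheaf.bijective_of_local`). It is locally essentially surjective, hence
an equivalence by descent (`LinearFunctor.essSurj_of_local`). Therefore two stacks with the same
gluing data are both equivalent to `twistedStack D`, and equivalent to each other
(`LinearFunctor.equivalent_of_equivalences`).

*Existence of gluing data.* In an algebroid stack, choose objects over the members of a covering and
isomorphisms `g α : P j ≅ P i` on the members of coverings of the double intersections. The
endomorphism algebras of the objects, conjugation by `g α`, and the automorphisms
`g α ∘ g γ ∘ (g β)⁻¹` are gluing data with an evident trivialization (`ObjectFamily.gluingData`,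
`ObjectFamily.trivialization`). On a paracompact Hausdorff space, the covering can be refined in
such a way that any two objects are isomorphic over the whole intersection
(`IsAlgebroidStack.exists_ordinary_objectFamily`): a locally finite shrinking `V j` of the covering
makes it possible to choose neighbourhoods `W x` of the points such that, whenever `W x` meets
`V j`, the object at `j` is isomorphic over `W x` to the object chosen at `x`.
-/

namespace Algebroid

/-! ### Restriction of objects and morphisms -/

section

variable {X : TopCat.{u}} {R : TopCat.Sheaf CommRingCat.{u} X}
open Pseudofunctor.LocallyDiscreteOpToCat

namespace LinearPrestack

/-- The restriction to `W` of an object over `V`. -/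
abbrev rs (F : Prestack R) {V W : Opens X} (h : W ≤ V) (P : F.obj V) : F.obj W :=
  (F.res (homOfLE h)).obj P

variable {F : Prestack R} {V V₁ V₂ V₃ W W' W'' : Opens X}

/-- Restriction to `W'` of a morphism over `W` between restrictions of objects `P` and `Q`. It is
conjugated by the composition isomorphisms of `F`, so that the result is again a morphism between
restrictions of `P` and `Q` themselves. -/
def rmap {P : F.obj V₁} {Q : F.obj V₂} {h₁ : W ≤ V₁} {h₂ : W ≤ V₂} (k : W' ≤ W)
    (φ : F.rs h₁ P ⟶ F.rs h₂ Q) : F.rs (k.trans h₁) P ⟶ F.rs (k.trans h₂) Q :=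
  pullHom (F := F.toPseudofunctor) φ (homOfLE k) (homOfLE (k.trans h₁)) (homOfLE (k.trans h₂))

variable {P : F.obj V₁} {Q : F.obj V₂} {T : F.obj V₃} {h₁ : W ≤ V₁} {h₂ : W ≤ V₂} {h₃ : W ≤ V₃}

@[simp]
lemma rmap_refl (φ : F.rs h₁ P ⟶ F.rs h₂ Q) : rmap le_rfl φ = φ :=
  pullHom_id (F := F.toPseudofunctor) φ

@[simp]
lemma rmap_rmap (k : W' ≤ W) (k' : W'' ≤ W') (φ : F.rs h₁ P ⟶ F.rs h₂ Q) :
    rmap k' (rmap k φ) = rmap (k'.trans k) φ :=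
  pullHom_pullHom (F := F.toPseudofunctor) φ (homOfLE k) _ _ (homOfLE k') _ _

@[simp]
lemma rmap_id (k : W' ≤ W) : rmap k (𝟙 (F.rs h₁ P)) = 𝟙 _ := by
  simp [rmap, pullHom]

@[simp]
lemma rmap_comp (k : W' ≤ W) (φ : F.rs h₁ P ⟶ F.rs h₂ Q) (ψ : F.rs h₂ Q ⟶ F.rs h₃ T) :
    rmap k (φ ≫ ψ) = rmap k φ ≫ rmap k ψ := by
  simp [rmap, pullHom]

lemma rmap_add (k : W' ≤ W) (φ ψ : F.rs h₁ P ⟶ F.rs h₂ Q) :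
    rmap k (φ + ψ) = rmap k φ + rmap k ψ := by
  simp [rmap, pullHom, F.map_add]

lemma rmap_smul (k : W' ≤ W) (r : R.obj.obj (op W)) (φ : F.rs h₁ P ⟶ F.rs h₂ Q) :
    rmap k (r • φ) = (R.obj.map (homOfLE k).op).hom r • rmap k φ := by
  simp [rmap, pullHom, F.map_smul]

/-- The isomorphism `(P|_V₂)|_W ≅ P|_W`. -/
def rcomp (P : F.obj V₁) (h : V₂ ≤ V₁) (k : W ≤ V₂) : F.rs k (F.rs h P) ≅ F.rs (k.trans h) P :=
  ((Cat.Hom.toNatIso (F.toPseudofunctor.mapComp' (homOfLE h).op.toLoc (homOfLE k).op.toLoc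
    (homOfLE (k.trans h)).op.toLoc (by rfl))).app P).symm

/-- The isomorphism between `P` and its restriction to the same open subset. -/
def rid (P : F.obj V₁) : F.rs le_rfl P ≅ P :=
  (Cat.Hom.toNatIso (F.toPseudofunctor.mapId (.mk (op V₁)))).app P

lemma rcomp_naturality {P Q : F.obj V₁} (φ : P ⟶ Q) (h : V₂ ≤ V₁) (k : W ≤ V₂) :
    (F.res (homOfLE k)).map ((F.res (homOfLE h)).map φ) ≫ (rcomp Q h k).hom =
      (rcomp P h k).hom ≫ (F.res (homOfLE (k.trans h))).map φ :=
  F.toPseudofunctor.mapComp'_inv_naturality _ _ _ rfl _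

lemma rmap_eq (k : W' ≤ W) (φ : F.rs h₁ P ⟶ F.rs h₂ Q) :
    rmap k φ = (rcomp P h₁ k).inv ≫ (F.res (homOfLE k)).map φ ≫ (rcomp Q h₂ k).hom := rfl

@[simp]
lemma rmap_res_map {P Q : F.obj V₁} (φ : P ⟶ Q) (h : W ≤ V₁) (k : W' ≤ W) :
    rmap k ((F.res (homOfLE h)).map φ) = (F.res (homOfLE (k.trans h))).map φ := by
  rw [rmap_eq, rcomp_naturality, Iso.inv_hom_id_assoc]

/-- This is the coherence condition on the composition isomorphisms of `F`. -/
lemma rmap_rcomp_hom (P : F.obj V₁) (h : V₂ ≤ V₁) (k : W ≤ V₂) (l : W' ≤ W) :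
    rmap l (rcomp P h k).hom = (rcomp P h (l.trans k)).hom := by
  rw [rmap_eq]
  have := F.toPseudofunctor.mapComp'_inv_whiskerRight_mapComp'₀₂₃_inv_app
    (homOfLE h).op.toLoc (homOfLE k).op.toLoc (homOfLE l).op.toLoc
    (homOfLE (k.trans h)).op.toLoc (homOfLE (l.trans k)).op.toLoc
    (homOfLE (l.trans (k.trans h))).op.toLoc rfl rfl rfl P
  rw [Iso.inv_comp_eq]
  exact this

/-- `rmap` for isomorphisms. -/
@[simps]
def rmapIso (k : W' ≤ W) (φ : F.rs h₁ P ≅ F.rs h₂ Q) :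
    F.rs (k.trans h₁) P ≅ F.rs (k.trans h₂) Q where
  hom := rmap k φ.hom
  inv := rmap k φ.inv
  hom_inv_id := by rw [← rmap_comp, φ.hom_inv_id, rmap_id]
  inv_hom_id := by rw [← rmap_comp, φ.inv_hom_id, rmap_id]

lemma rmap_rcomp_inv (P : F.obj V₁) (h : V₂ ≤ V₁) (k : W ≤ V₂) (l : W' ≤ W) :
    rmap l (rcomp P h k).inv = (rcomp P h (l.trans k)).inv := by
  have e : rmapIso l (rcomp P h k) = rcomp P h (l.trans k) := Iso.ext (rmap_rcomp_hom P h k l)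
  rw [← e]
  rfl

end LinearPrestack

end

/-! ### Sheaves and stacks in terms of points -/

section

variable {X : TopCat.{u}} {R : TopCat.Sheaf CommRingCat.{u} X}

/-- The sheaf condition for a presheaf of types on the open subsets of `U`, stated with points:
sections which agree locally are equal, and compatible sections over neighbourhoods of all points
can be glued. The open subsets of `U` are given as open subsets `W` with a proof of `W ≤ U`. -/
structure IsOpenSheaf {U : Opens X} (T : ∀ W : Opens X, W ≤ U → Type v)
    (res : ∀ {W W' : Opens X} (h : W ≤ U) (k : W' ≤ W), T W h → T W' (k.trans h)) : Prop where
  res_refl {W} (h : W ≤ U) (t : T W h) : res h le_rfl t = t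
  res_res {W W' W''} (h : W ≤ U) (k : W' ≤ W) (k' : W'' ≤ W') (t : T W h) :
    res (k.trans h) k' (res h k t) = res h (k'.trans k) t
  ext {W} (h : W ≤ U) (t t' : T W h)
    (hl : ∀ x ∈ W, ∃ (W' : Opens X) (k : W' ≤ W), x ∈ W' ∧ res h k t = res h k t') : t = t'
  glue {W} (h : W ≤ U) (B : W → Opens X) (mem : ∀ x, ↑x ∈ B x) (k : ∀ x, B x ≤ W)
    (s : ∀ x, T (B x) ((k x).trans h))
    (compat : ∀ (x y) (W' : Opens X) (l : W' ≤ B x) (l' : W' ≤ B y),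
      res _ l (s x) = res _ l' (s y)) : ∃ t, ∀ x, res h (k x) t = s x

namespace IsOpenSheaf
variable {U : Opens X} {T : ∀ W : Opens X, W ≤ U → Type v}
    {res : ∀ {W W' : Opens X} (h : W ≤ U) (k : W' ≤ W), T W h → T W' (k.trans h)}

/-- Gluing sections which are characterized by a property: if `P` is stable under restriction, has
at most one solution over each open subset, and has solutions locally, then there is a section whose
restrictions are the solutions of `P`. -/
theorem exists_of_description (hT : IsOpenSheaf T res) {W : Opens X} (h : W ≤ U)
    (P : ∀ (W' : Opens X) (k : W' ≤ W), T W' (k.trans h) → Prop)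
    (hu : ∀ W' k s s', P W' k s → P W' k s' → s = s')
    (hr : ∀ W' k s W'' (k' : W'' ≤ W'), P W' k s → P W'' (k'.trans k) (res _ k' s))
    (hl : ∀ x ∈ W, ∃ W' k s, x ∈ W' ∧ P W' k s) :
    ∃ t, ∀ W' k s, P W' k s → res h k t = s := by
  choose B k s mem hP using fun x : W => hl x.1 x.2
  obtain ⟨t, ht⟩ := hT.glue h B mem k s
    (fun x y W' l l' => hu _ _ _ _ (hr _ _ _ _ _ (hP x)) (hr _ _ _ _ _ (hP y)))
  refine ⟨t, fun W' k' s' h' => hT.ext _ _ _ fun x hx => ?_⟩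
  refine ⟨W' ⊓ B ⟨x, k' hx⟩, inf_le_left, ⟨hx, mem ⟨x, k' hx⟩⟩, ?_⟩
  rw [hT.res_res]
  refine Eq.trans ?_ (hu _ _ _ _ (hr _ _ _ (W' ⊓ B ⟨x, k' hx⟩) inf_le_right (hP ⟨x, k' hx⟩))
    (hr _ _ _ _ inf_le_left h'))
  rw [← ht, hT.res_res]

theorem of_isSheaf {G : (Over U)ᵒᵖ ⥤ Type v}
    (hG : Presheaf.IsSheaf ((Opens.grothendieckTopology X).over U) G) :
    IsOpenSheaf (U := U) (fun W h => G.obj (op (Over.mk (homOfLE h))))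
      (fun {W W'} h k => G.map (Over.homMk (homOfLE k) :
        Over.mk (homOfLE (k.trans h)) ⟶ Over.mk (homOfLE h)).op) where
  res_refl h t := by
    refine Eq.trans ?_ (ConcreteCategory.congr_hom (G.map_id _) t)
    rfl
  res_res h k k' t := by
    let f : Over.mk (homOfLE (k.trans h)) ⟶ Over.mk (homOfLE h) := Over.homMk (homOfLE k)
    let g : Over.mk (homOfLE (k'.trans (k.trans h))) ⟶ Over.mk (homOfLE (k.trans h)) :=
      Over.homMk (homOfLE k')
    exact (ConcreteCategory.congr_hom (G.map_comp f.op g.op) t).symm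
  ext {W} h t t' hl := by
    rw [isSheaf_iff_isSheaf_of_type] at hG
    let S : Sieve (Over.mk (homOfLE h)) :=
      { arrows := fun Y f => G.map f.op t = G.map f.op t'
        downward_closed := by
          intro Y Z f hf g
          simp only [op_comp, Functor.map_comp]
          simp [hf] }
    refine (hG.isSeparated S ?_).ext (fun Y f hf => hf)
    rw [GrothendieckTopology.mem_over_iff]
    intro x hx
    obtain ⟨W', k, hx', e⟩ := hl x hx
    refine ⟨W', homOfLE k, ?_, hx'⟩
    rw [Sieve.overEquiv_iff]
    exact e
  glue {W} h B mem k s compat := by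
    rw [isSheaf_iff_isSheaf_of_type] at hG
    let S : Presieve (Over.mk (homOfLE h)) :=
      Presieve.ofArrows (fun x => Over.mk (homOfLE ((k x).trans h)))
        (fun x => (Over.homMk (homOfLE (k x)) : Over.mk (homOfLE ((k x).trans h)) ⟶
          Over.mk (homOfLE h)))
    have hS : Sieve.generate S ∈ ((Opens.grothendieckTopology X).over U) _ := by
      rw [GrothendieckTopology.mem_over_iff]
      intro x hx
      refine ⟨B ⟨x, hx⟩, homOfLE (k _), ?_, mem ⟨x, hx⟩⟩
      rw [Sieve.overEquiv_iff]
      exact Sieve.le_generate _ _ _ (Presieve.ofArrows.mk _)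
    have := (Presieve.isSheafFor_iff_generate S).2 (hG _ hS)
    rw [Presieve.isSheafFor_arrows_iff] at this
    obtain ⟨t, ht, -⟩ := this s (by
      intro x y Z gi gj _
      exact compat x y Z.left (leOfHom gi.left) (leOfHom gj.left))
    exact ⟨t, ht⟩

theorem of_equiv {T' : ∀ W : Opens X, W ≤ U → Type w}
    {res' : ∀ {W W' : Opens X} (h : W ≤ U) (k : W' ≤ W), T' W h → T' W' (k.trans h)}
    (hT : IsOpenSheaf T res) (e : ∀ W h, T W h ≃ T' W h)
    (he : ∀ {W W'} (h : W ≤ U) (k : W' ≤ W) t, e _ _ (res h k t) = res' h k (e _ _ t)) :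
    IsOpenSheaf T' res' where
  res_refl h t := by
    obtain ⟨t, rfl⟩ := (e _ _).surjective t
    rw [← he, hT.res_refl]
  res_res h k k' t := by
    obtain ⟨t, rfl⟩ := (e _ _).surjective t
    simp only [← he, hT.res_res]
  ext h t t' hl := by
    obtain ⟨t, rfl⟩ := (e _ _).surjective t
    obtain ⟨t', rfl⟩ := (e _ _).surjective t'
    simp only [← he, EmbeddingLike.apply_eq_iff_eq] at hl
    rw [hT.ext h t t' hl]
  glue h B mem k s compat := by
    obtain ⟨t, ht⟩ := hT.glue h B mem k (fun x => (e _ _).symm (s x)) (fun x y W' l l' => by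
      apply (e _ _).injective
      rw [he, he]
      simpa using compat x y W' l l')
    exact ⟨e _ _ t, fun x => by rw [← he, ht]; simp⟩

end IsOpenSheaf

namespace LinearPrestack
variable {F : Prestack R}

theorem isOpenSheaf_hom (hF : F.IsStack (Opens.grothendieckTopology X)) {V₁ V₂ U : Opens X}
    (h₁ : U ≤ V₁) (h₂ : U ≤ V₂) (P : F.obj V₁) (Q : F.obj V₂) :
    IsOpenSheaf (U := U) (fun _ h => F.rs (h.trans h₁) P ⟶ F.rs (h.trans h₂) Q)
      (fun _ k φ => rmap k φ) := by
  have := hF.toIsPrestack.isSheaf (F.rs h₁ P) (F.rs h₂ Q)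
  refine (IsOpenSheaf.of_isSheaf this).of_equiv
    (fun W h => Iso.homCongr (rcomp P h₁ h) (rcomp Q h₂ h)) ?_
  intro W W' h k φ
  change _ = rmap k ((rcomp P h₁ h).inv ≫ φ ≫ (rcomp Q h₂ h).hom)
  change (rcomp P h₁ _).inv ≫ rmap k φ ≫ (rcomp Q h₂ _).hom = _
  simp only [rmap_comp, rmap_rcomp_inv, rmap_rcomp_hom]

/-- Objects of a stack can be glued along compatible morphisms. The morphisms `φ a b W` are given on
all open subsets `W` of `B a ∩ B b`; they are isomorphisms by `φ_self` and `φ_comp`. -/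
theorem exists_descent (hF : F.IsStack (Opens.grothendieckTopology X)) {I : Type v} {V : Opens X}
    (B : I → Opens X) (hB : ∀ a, B a ≤ V) (cov : ∀ x ∈ V, ∃ a, x ∈ B a) (P : ∀ a, F.obj (B a))
    (φ : ∀ (a b) (W : Opens X) (h : W ≤ B a) (h' : W ≤ B b), F.rs h (P a) ⟶ F.rs h' (P b))
    (φ_res : ∀ a b W h h' (W' : Opens X) (k : W' ≤ W),
      rmap k (φ a b W h h') = φ a b W' (k.trans h) (k.trans h'))
    (φ_self : ∀ a W h, φ a a W h h = 𝟙 _)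
    (φ_comp : ∀ a b c W h h' h'', φ a b W h h' ≫ φ b c W h' h'' = φ a c W h h'') :
    ∃ (Q : F.obj V) (e : ∀ a, F.rs (hB a) Q ≅ P a), ∀ a b W h h',
      (F.res (homOfLE h)).map (e a).hom ≫ φ a b W h h' =
        (rcomp Q (hB a) h).hom ≫ (rcomp Q (hB b) h').inv ≫ (F.res (homOfLE h')).map (e b).hom := by
  have : F.toPseudofunctor.IsStack (Opens.grothendieckTopology X) := hF
  have := Pseudofunctor.isEquivalence_toDescentData F.toPseudofunctor
    (J := Opens.grothendieckTopology X) (fun a => homOfLE (hB a)) (by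
    intro x hx
    obtain ⟨a, ha⟩ := cov x hx
    exact ⟨B a, homOfLE (hB a), Sieve.ofArrows_mk _ _ _, ha⟩)
  let D : F.toPseudofunctor.DescentData (fun a => homOfLE (hB a)) :=
    { obj := P
      hom := fun Y q a b f₁ f₂ _ _ => φ a b Y (leOfHom f₁) (leOfHom f₂)
      pullHom_hom := fun Y' Y g q q' _ a b f₁ f₂ _ _ gf₁ gf₂ _ _ =>
        φ_res a b Y (leOfHom f₁) (leOfHom f₂) Y' (leOfHom g)
      hom_self := fun Y q a g _ => φ_self a Y (leOfHom g)
      hom_comp := fun Y q a b c f₁ f₂ f₃ _ _ _ => φ_comp a b c Y _ _ _ }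
  let Q := (F.toPseudofunctor.toDescentData (fun a => homOfLE (hB a))).objPreimage D
  let i := (F.toPseudofunctor.toDescentData (fun a => homOfLE (hB a))).objObjPreimageIso D
  refine ⟨Q, fun a => ⟨i.hom.hom a, i.inv.hom a, ?_, ?_⟩, ?_⟩
  · exact congrArg (fun g => g.hom a) i.hom_inv_id
  · exact congrArg (fun g => g.hom a) i.inv_hom_id
  · intro a b W h h'
    have := i.hom.comm (homOfLE (h.trans (hB a))) (homOfLE h) (homOfLE h') rfl rfl
    refine this.trans ?_
    exact Category.assoc _ _ _

lemma rmap_eq_rmap_of_comm {V W₁ W₂ W : Opens X} {P Q : F.obj V} (h₁ : W₁ ≤ V) (h₂ : W₂ ≤ V)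
    (φ : F.rs h₁ P ⟶ F.rs h₁ Q) (ψ : F.rs h₂ P ⟶ F.rs h₂ Q) (k : W ≤ W₁) (k' : W ≤ W₂)
    (key : (F.res (homOfLE k)).map φ ≫ ((rcomp Q h₁ k).hom ≫ (rcomp Q h₂ k').inv) =
      ((rcomp P h₁ k).hom ≫ (rcomp P h₂ k').inv) ≫ (F.res (homOfLE k')).map ψ) :
    rmap k φ = rmap k' ψ := by
  rw [rmap_eq, rmap_eq, Iso.inv_comp_eq, ← cancel_mono (rcomp Q _ k').inv]
  simpa using key

/-- A prestack in which morphisms are determined locally and can be glued, and in which objects can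
be glued, is a stack. -/
theorem isStack_of
    (hom_ext : ∀ {V : Opens X} (P Q : F.obj V) (φ ψ : P ⟶ Q), (∀ x ∈ V, ∃ (W : Opens X)
      (h : W ≤ V), x ∈ W ∧ (F.res (homOfLE h)).map φ = (F.res (homOfLE h)).map ψ) → φ = ψ)
    (hom_glue : ∀ {I : Type u} {V : Opens X} (P Q : F.obj V) (B : I → Opens X) (hB : ∀ a, B a ≤ V)
      (_ : ∀ x ∈ V, ∃ a, x ∈ B a) (φ : ∀ a, F.rs (hB a) P ⟶ F.rs (hB a) Q)
      (_ : ∀ a b W (h : W ≤ B a) (h' : W ≤ B b), rmap h (φ a) = rmap h' (φ b)),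
      ∃ ψ : P ⟶ Q, ∀ a, (F.res (homOfLE (hB a))).map ψ = φ a)
    (descent : ∀ {I : Type u} {V : Opens X}
      (B : I → Opens X) (hB : ∀ a, B a ≤ V) (_ : ∀ x ∈ V, ∃ a, x ∈ B a) (P : ∀ a, F.obj (B a))
      (φ : ∀ (a b) (W : Opens X) (h : W ≤ B a) (h' : W ≤ B b), F.rs h (P a) ⟶ F.rs h' (P b))
      (_ : ∀ a b W h h' (W' : Opens X) (k : W' ≤ W),
        rmap k (φ a b W h h') = φ a b W' (k.trans h) (k.trans h'))
      (_ : ∀ a W h, φ a a W h h = 𝟙 _)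
      (_ : ∀ a b c W h h' h'', φ a b W h h' ≫ φ b c W h' h'' = φ a c W h h''),
      ∃ (Q : F.obj V) (e : ∀ a, F.rs (hB a) Q ≅ P a), ∀ a b W h h',
        (F.res (homOfLE h)).map (e a).hom ≫ φ a b W h h' = (rcomp Q (hB a) h).hom ≫
          (rcomp Q (hB b) h').inv ≫ (F.res (homOfLE h')).map (e b).hom) :
    F.IsStack (Opens.grothendieckTopology X) := by
  refine Pseudofunctor.IsStack.of_isStackFor fun V S hS => ⟨?_⟩
  have cov : ∀ x ∈ V, ∃ a : S.arrows.category, x ∈ a.obj.left := by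
    intro x hx
    obtain ⟨W, i, hi, hx⟩ := hS x hx
    exact ⟨⟨Over.mk i, hi⟩, hx⟩
  refine { faithful := ⟨?_⟩, full := ⟨?_⟩, essSurj := ⟨?_⟩ }
  · intro P Q φ ψ hφ
    refine hom_ext P Q φ ψ fun x hx => ?_
    obtain ⟨a, ha⟩ := cov x hx
    exact ⟨a.obj.left, leOfHom a.obj.hom, ha, congrArg (fun g => g.hom a) hφ⟩
  · intro P Q φ
    obtain ⟨ψ, hψ⟩ := hom_glue P Q (fun a : S.arrows.category => a.obj.left)
      (fun a => leOfHom a.obj.hom) cov (fun a => φ.hom a) (by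
        intro a b W h h'
        have key : (F.res (homOfLE h)).map (φ.hom a) ≫
            ((rcomp Q (leOfHom a.obj.hom) h).hom ≫ (rcomp Q (leOfHom b.obj.hom) h').inv) =
            ((rcomp P (leOfHom a.obj.hom) h).hom ≫ (rcomp P (leOfHom b.obj.hom) h').inv) ≫
              (F.res (homOfLE h')).map (φ.hom b) :=
          φ.comm (homOfLE (h.trans (leOfHom a.obj.hom))) (homOfLE h) (homOfLE h') rfl rfl
        exact rmap_eq_rmap_of_comm (leOfHom a.obj.hom) (leOfHom b.obj.hom) _ _ h h' key)
    refine ⟨ψ, ?_⟩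
    ext a
    exact hψ a
  · intro D
    obtain ⟨Q, e, he⟩ := descent (fun a : S.arrows.category => a.obj.left)
      (fun a => leOfHom a.obj.hom) cov D.obj (fun a b W h h' =>
        D.hom (homOfLE (h.trans (leOfHom a.obj.hom))) (homOfLE h) (homOfLE h') rfl rfl)
      (fun a b W h h' W' k => D.pullHom_hom (homOfLE k)
        (homOfLE (h.trans (leOfHom a.obj.hom)))
        (homOfLE ((k.trans h).trans (leOfHom a.obj.hom))) rfl
        (homOfLE h) (homOfLE h') rfl rfl (homOfLE (k.trans h)) (homOfLE (k.trans h')) rfl rfl)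
      (fun a W h => D.hom_self _ _ rfl)
      (fun a b c W h h' h'' => D.hom_comp (homOfLE (h.trans (leOfHom a.obj.hom)))
        (homOfLE h) (homOfLE h') (homOfLE h'') rfl rfl rfl)
    refine ⟨Q, ⟨Pseudofunctor.DescentData.isoMk e ?_⟩⟩
    intro Y q a b f₁ f₂ hf₁ hf₂
    refine (he a b Y (leOfHom f₁) (leOfHom f₂)).trans ?_
    exact (Category.assoc _ _ _).symm

end LinearPrestack

end

/-! ### Sections of algebras, and restriction of stacks -/

section

variable {X : TopCat.{u}} {R : TopCat.Sheaf CommRingCat.{u} X}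

namespace AlgebraOn
variable {U : Opens X}

theorem isOpenSheaf (A : AlgebraOn R U) :
    IsOpenSheaf (U := U) (fun W h => A.sections W h) (fun h k => A.res h k) :=
  IsOpenSheaf.of_isSheaf ((Presheaf.isSheaf_iff_isSheaf_forget _ _ (forget RingCat)).1
    A.toSheaf.property)

variable {U' O : Opens X} (A : AlgebraOn R U)

@[simp]
lemma res_refl {V : Opens X} (h : V ≤ U) (x : A.sections V h) : A.res h le_rfl x = x :=
  A.isOpenSheaf.res_refl h x

@[simp]
lemma res_res {V W W' : Opens X} (h : V ≤ U) (k : W ≤ V) (k' : W' ≤ W) (x : A.sections V h) :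
    A.res (k.trans h) k' (A.res h k x) = A.res h (k'.trans k) x :=
  A.isOpenSheaf.res_res h k k' x

/-- The image of a section of `R` in the algebra `A`. -/
def scalar {V : Opens X} (h : V ≤ U) : R.obj.obj (op V) →+* A.sections V h :=
  (A.structureMap.app (op (Over.mk (homOfLE h)))).hom

lemma scalar_comm {V : Opens X} (h : V ≤ U) (r : R.obj.obj (op V)) (x : A.sections V h) :
    A.scalar h r * x = x * A.scalar h r :=
  A.central (op (Over.mk (homOfLE h))) r x

lemma res_scalar {V W : Opens X} (h : V ≤ U) (k : W ≤ V) (r : R.obj.obj (op V)) :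
    A.res h k (A.scalar h r) = A.scalar (k.trans h) ((R.obj.map (homOfLE k).op).hom r) := by
  let f : Over.mk (homOfLE (k.trans h)) ⟶ Over.mk (homOfLE h) := Over.homMk (homOfLE k)
  exact (ConcreteCategory.congr_hom (A.structureMap.naturality f.op) r).symm

variable {A} {B : AlgebraOn R U'} {h : O ≤ U} {h' : O ≤ U'}
  (f : (A.restrict (homOfLE h)).Iso (B.restrict (homOfLE h')))

lemma isoApp_res {V W : Opens X} (k : V ≤ O) (l : W ≤ V) (x : A.sections V (k.trans h)) :
    isoApp f W (l.trans k) (A.res (k.trans h) l x) = B.res (k.trans h') l (isoApp f V k x) := by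
  let g : Over.mk (homOfLE (l.trans k)) ⟶ Over.mk (homOfLE k) := Over.homMk (homOfLE l)
  exact ConcreteCategory.congr_hom (f.toIso.hom.hom.naturality g.op) x

lemma isoApp_scalar {V : Opens X} (k : V ≤ O) (r : R.obj.obj (op V)) :
    isoApp f V k (A.scalar _ r) = B.scalar _ r :=
  congrArg (fun g : (Over.forget O).op ⋙ R.obj ⋙ forget₂ CommRingCat RingCat ⟶
    (B.restrict (homOfLE h')).toSheaf.obj => (g.app (op (Over.mk (homOfLE k)))).hom r)
      f.structureMap_comp

lemma isoApp_bijective {V : Opens X} (k : V ≤ O) : Function.Bijective (isoApp f V k) := by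
  let g := ((sheafToPresheaf _ _).mapIso f.toIso).app (op (Over.mk (homOfLE k)))
  exact ConcreteCategory.bijective_of_isIso g.hom

end AlgebraOn

section
variable {C : Type u₁} [Category.{v₁} C] {R : Cᵒᵖ ⥤ CommRingCat.{u}}
  (F : LinearPrestack.{u, v, w} R) (U : C)

lemma restrict_mapComp'_hom {S T Z : Over U} (f : T ⟶ S) (g : Z ⟶ T) (fg : Z ⟶ S) (h : g ≫ f = fg)
    (P : (F.restrict U).obj S) :
    ((F.restrict U).toPseudofunctor.mapComp' f.op.toLoc g.op.toLoc fg.op.toLoc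
      (by subst h; rfl)).hom.toNatTrans.app P =
    (F.toPseudofunctor.mapComp' f.left.op.toLoc g.left.op.toLoc fg.left.op.toLoc
      (by subst h; rfl)).hom.toNatTrans.app P := by
  subst h
  have e : (Over.forget U).op.toPseudofunctor.mapComp f.op.toLoc g.op.toLoc = Iso.refl _ := rfl
  erw [Pseudofunctor.mapComp'_eq_mapComp, Pseudofunctor.mapComp'_eq_mapComp]
  change ((F.toPseudofunctor.map₂
    ((Over.forget U).op.toPseudofunctor.mapComp f.op.toLoc g.op.toLoc).hom) ≫
      (F.toPseudofunctor.mapComp f.left.op.toLoc g.left.op.toLoc).hom).toNatTrans.app P = _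
  rw [e]
  change ((F.toPseudofunctor.map₂ (𝟙 _)) ≫
    (F.toPseudofunctor.mapComp f.left.op.toLoc g.left.op.toLoc).hom).toNatTrans.app P = _
  rw [F.toPseudofunctor.map₂_id, Category.id_comp]

lemma restrict_mapComp'_inv {S T Z : Over U} (f : T ⟶ S) (g : Z ⟶ T) (fg : Z ⟶ S) (h : g ≫ f = fg)
    (P : (F.restrict U).obj S) :
    ((F.restrict U).toPseudofunctor.mapComp' f.op.toLoc g.op.toLoc fg.op.toLoc
      (by subst h; rfl)).inv.toNatTrans.app P =
    (F.toPseudofunctor.mapComp' f.left.op.toLoc g.left.op.toLoc fg.left.op.toLoc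
      (by subst h; rfl)).inv.toNatTrans.app P := by
  have e : (Cat.Hom.toNatIso ((F.restrict U).toPseudofunctor.mapComp' f.op.toLoc g.op.toLoc
      fg.op.toLoc (by subst h; rfl))).app P =
    (Cat.Hom.toNatIso (F.toPseudofunctor.mapComp' f.left.op.toLoc g.left.op.toLoc
      fg.left.op.toLoc (by subst h; rfl))).app P := Iso.ext (restrict_mapComp'_hom F U f g fg h P)
  exact congrArg Iso.inv e

open Pseudofunctor.LocallyDiscreteOpToCat in
lemma restrict_pullHom {S₁ S₂ Y Y' : Over U} {P : (F.restrict U).obj S₁}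
    {Q : (F.restrict U).obj S₂} (f₁ : Y ⟶ S₁) (f₂ : Y ⟶ S₂)
    (φ : ((F.restrict U).res f₁).obj P ⟶ ((F.restrict U).res f₂).obj Q) (g : Y' ⟶ Y)
    (gf₁ : Y' ⟶ S₁) (gf₂ : Y' ⟶ S₂) (h₁ : g ≫ f₁ = gf₁) (h₂ : g ≫ f₂ = gf₂) :
    pullHom (F := (F.restrict U).toPseudofunctor) φ g gf₁ gf₂ h₁ h₂ =
      pullHom (F := F.toPseudofunctor) (M₁ := P) (M₂ := Q) (f₁ := f₁.left) (f₂ := f₂.left)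
        φ g.left gf₁.left gf₂.left (by subst h₁; rfl) (by subst h₂; rfl) := by
  delta pullHom
  rw [restrict_mapComp'_hom F U f₁ g gf₁ h₁ P, restrict_mapComp'_inv F U f₂ g gf₂ h₂ Q]
  rfl

variable {F} {J : GrothendieckTopology C}
/-- The restriction of a stack to an object `U` of the site is a stack: a covering sieve of an
object of `Over U` is a covering sieve of the underlying object, and the descent data agree. -/
theorem isStack_restrict (hF : F.IsStack J) :
    (F.restrict U).IsStack (J.over U) := by
  have : F.toPseudofunctor.IsStack J := hF
  let G := (F.restrict U).toPseudofunctor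
  refine Pseudofunctor.IsStack.of_isStackFor fun S T hT => ⟨?_⟩
  let B : T.arrows.category → C := fun a => a.obj.left.left
  let f : ∀ a, B a ⟶ S.left := fun a => a.obj.hom.left
  have := Pseudofunctor.isEquivalence_toDescentData F.toPseudofunctor
    (J := J) f (by
      rw [GrothendieckTopology.mem_over_iff] at hT
      convert hT
      rw [← Sieve.overEquiv_ofArrows (Y := S) (fun a : T.arrows.category => a.obj.left)
        (fun a => a.obj.hom), Sieve.ofArrows_category', Sieve.generate_sieve])
  -- morphisms over `S.left` lift to `Over U`
  have w : ∀ {Y : C} {a : T.arrows.category} (q : Y ⟶ S.left) (f₁ : Y ⟶ B a),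
      f₁ ≫ f a = q → f₁ ≫ a.obj.left.hom = q ≫ S.hom := by
    intro Y a q f₁ h
    rw [← h, Category.assoc, ← Over.w a.obj.hom]
  have ofObj_hom : ∀ (P : F.obj S.left) {Y : C} (q : Y ⟶ S.left) (a b : T.arrows.category)
      (f₁ : Y ⟶ B a) (f₂ : Y ⟶ B b) (h₁ : f₁ ≫ f a = q) (h₂ : f₂ ≫ f b = q),
      ((F.toPseudofunctor.toDescentData f).obj P).hom q f₁ f₂ h₁ h₂ =
        ((G.toDescentData (fun a : T.arrows.category => a.obj.hom)).obj P).hom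
          (Y := Over.mk (q ≫ S.hom)) (Over.homMk q)
            (Over.homMk f₁ (w q f₁ h₁)) (Over.homMk f₂ (w q f₂ h₂))
            (by ext; exact h₁) (by ext; exact h₂) := by
    intro P Y q a b f₁ f₂ h₁ h₂
    let q' : Over.mk (q ≫ S.hom) ⟶ S := Over.homMk q
    let f₁' : Over.mk (q ≫ S.hom) ⟶ a.obj.left := Over.homMk f₁ (w q f₁ h₁)
    let f₂' : Over.mk (q ≫ S.hom) ⟶ b.obj.left := Over.homMk f₂ (w q f₂ h₂)
    exact congrArg₂ (· ≫ ·) (restrict_mapComp'_inv F U a.obj.hom f₁' q' (by ext; exact h₁) P).symm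
      (restrict_mapComp'_hom F U b.obj.hom f₂' q' (by ext; exact h₂) P).symm
  refine { faithful := ⟨?_⟩, full := ⟨?_⟩, essSurj := ⟨?_⟩ }
  · intro P Q φ ψ hφ
    refine (F.toPseudofunctor.toDescentData f).map_injective ?_
    ext a
    exact congrArg (fun g => g.hom a) hφ
  · intro (P : F.obj S.left) (Q : F.obj S.left) φ
    let φ' : (F.toPseudofunctor.toDescentData f).obj P ⟶
      (F.toPseudofunctor.toDescentData f).obj Q :=
      { hom := fun a => φ.hom a
        comm := by
          intro Y q a b f₁ f₂ h₁ h₂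
          exact (congrArg (_ ≫ ·) (ofObj_hom Q q a b f₁ f₂ h₁ h₂)).trans
            ((φ.comm (Y := Over.mk (q ≫ S.hom)) (Over.homMk q)
            (Over.homMk f₁ (w q f₁ h₁)) (Over.homMk f₂ (w q f₂ h₂))
            (by ext; exact h₁) (by ext; exact h₂)).trans
            (congrArg (· ≫ _) (ofObj_hom P q a b f₁ f₂ h₁ h₂).symm)) }
    obtain ⟨ψ, hψ⟩ := (F.toPseudofunctor.toDescentData f).map_surjective φ'
    refine ⟨ψ, ?_⟩
    ext a
    exact congrArg (fun g => g.hom a) hψ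
  · intro D
    let D' : F.toPseudofunctor.DescentData f :=
      { obj := fun a => D.obj a
        hom := fun Y q a b f₁ f₂ h₁ h₂ => D.hom (Y := Over.mk (q ≫ S.hom)) (Over.homMk q)
            (Over.homMk f₁ (w q f₁ h₁)) (Over.homMk f₂ (w q f₂ h₂))
            (by ext; exact h₁) (by ext; exact h₂)
        pullHom_hom := by
          intro Y' Y g q q' hq a b f₁ f₂ h₁ h₂ gf₁ gf₂ hg₁ hg₂
          subst hq hg₁ hg₂
          let g' : Over.mk ((g ≫ q) ≫ S.hom) ⟶ Over.mk (q ≫ S.hom) :=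
            Over.homMk g (Category.assoc _ _ _).symm
          have := D.pullHom_hom g' (Over.homMk q) (Over.homMk (g ≫ q)) (by ext; rfl)
            (Over.homMk f₁ (w q f₁ h₁)) (Over.homMk f₂ (w q f₂ h₂))
            (by ext; exact h₁) (by ext; exact h₂)
            (Over.homMk (g ≫ f₁) (w (g ≫ q) _ (by rw [Category.assoc, h₁])))
            (Over.homMk (g ≫ f₂) (w (g ≫ q) _ (by rw [Category.assoc, h₂])))
            (by ext; rfl) (by ext; rfl)
          refine Eq.trans ?_ this
          exact (restrict_pullHom F U (Over.homMk f₁ (w q f₁ h₁) : Over.mk (q ≫ S.hom) ⟶ a.obj.left)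
            (Over.homMk f₂ (w q f₂ h₂) : Over.mk (q ≫ S.hom) ⟶ b.obj.left)
            (D.hom (Y := Over.mk (q ≫ S.hom)) (Over.homMk q)
            (Over.homMk f₁ (w q f₁ h₁)) (Over.homMk f₂ (w q f₂ h₂))
            (by ext; exact h₁) (by ext; exact h₂)) g'
            (Over.homMk (g ≫ f₁) (w (g ≫ q) _ (by rw [Category.assoc, h₁])))
            (Over.homMk (g ≫ f₂) (w (g ≫ q) _ (by rw [Category.assoc, h₂])))
            (by ext; rfl) (by ext; rfl)).symm
        hom_self := fun Y q a g h => D.hom_self _ _ (by ext; exact h)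
        hom_comp := fun Y q a b c f₁ f₂ f₃ h₁ h₂ h₃ => D.hom_comp _ _ _ _ _ _ _ }
    let Q := (F.toPseudofunctor.toDescentData f).objPreimage D'
    let i := (F.toPseudofunctor.toDescentData f).objObjPreimageIso D'
    refine ⟨Q, ⟨Pseudofunctor.DescentData.isoMk (fun a => ⟨i.hom.hom a, i.inv.hom a,
      congrArg (fun g => g.hom a) i.hom_inv_id, congrArg (fun g => g.hom a) i.inv_hom_id⟩) ?_⟩⟩
    intro Y q a b f₁ f₂ h₁ h₂
    obtain ⟨Y, p, rfl⟩ := Over.mk_surjective Y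
    obtain ⟨q, rfl, rfl⟩ : ∃ (q' : Y ⟶ S.left) (h : q' ≫ S.hom = p), q = Over.homMk q' h :=
      ⟨q.left, Over.w q, rfl⟩
    have h₁' : f₁.left ≫ f a = q := congrArg (fun g => g.left) h₁
    have h₂' : f₂.left ≫ f b = q := congrArg (fun g => g.left) h₂
    have := i.hom.comm q f₁.left f₂.left h₁' h₂'
    rw [ofObj_hom] at this
    exact this
end

end

/-! ### Gluing data on sections -/

section

variable {X : TopCat.{u}} {R : TopCat.Sheaf CommRingCat.{u} X}

namespace Covering

lemma exists_mem_U (𝒰 : Covering X) (x : X) : ∃ i, x ∈ 𝒰.U i := by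
  have : x ∈ ⨆ i, 𝒰.U i := by rw [𝒰.iSup_U]; trivial
  simpa using this

lemma exists_mem_O (𝒰 : Covering X) {i j : 𝒰.ι} {x : X} (hi : x ∈ 𝒰.U i) (hj : x ∈ 𝒰.U j) :
    ∃ α, x ∈ 𝒰.O i j α := by
  have : x ∈ ⨆ α, 𝒰.O i j α := by rw [𝒰.iSup_O]; exact ⟨hi, hj⟩
  simpa using this

end Covering

namespace GluingData

variable (D : GluingData R) {i j k l : D.cov.ι} {V W : Opens X}

/-- The ring of sections of `A i` over `V`. -/
abbrev S (i : D.cov.ι) (V : Opens X) (h : V ≤ D.cov.U i) : Type u := (D.A i).sections V h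

variable (α : D.cov.κ i j) (β : D.cov.κ i k) (γ : D.cov.κ j k)

/-- The action of `f α` on sections over `V`. -/
def fs (hα : V ≤ D.cov.O i j α) : D.S j V (hα.trans (D.cov.O_le_right α)) →+*
    D.S i V (hα.trans (D.cov.O_le_left α)) :=
  AlgebraOn.isoApp (D.f α) V hα

/-- The restriction of `a α β γ` to `V`. -/
def as (hα : V ≤ D.cov.O i j α) (hβ : V ≤ D.cov.O i k β) (hγ : V ≤ D.cov.O j k γ) :
    (D.S i V (hα.trans (D.cov.O_le_left α)))ˣ :=
  Units.map ((D.A i).res (D.cov.T_le α β γ) (le_inf (le_inf hα hβ) hγ)).toMonoidHom (D.a α β γ)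

variable {α β γ}

lemma fs_res (hα : V ≤ D.cov.O i j α) (k : W ≤ V) (x) :
    D.fs α (k.trans hα) ((D.A j).res _ k x) = (D.A i).res _ k (D.fs α hα x) :=
  AlgebraOn.isoApp_res (D.f α) hα k x

lemma res_fs (hα : V ≤ D.cov.O i j α) (k : W ≤ V) (x) :
    (D.A i).res (hα.trans (D.cov.O_le_left α)) k (D.fs α hα x) =
      D.fs α (k.trans hα) ((D.A j).res (hα.trans (D.cov.O_le_right α)) k x) :=
  (D.fs_res hα k x).symm

lemma fs_bijective (hα : V ≤ D.cov.O i j α) : Function.Bijective (D.fs α hα) :=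
  AlgebraOn.isoApp_bijective (D.f α) hα

lemma fs_scalar (hα : V ≤ D.cov.O i j α) (r : R.obj.obj (op V)) :
    D.fs α hα ((D.A j).scalar _ r) = (D.A i).scalar _ r :=
  AlgebraOn.isoApp_scalar (D.f α) hα r

lemma res_as (hα : V ≤ D.cov.O i j α) (hβ : V ≤ D.cov.O i k β) (hγ : V ≤ D.cov.O j k γ)
    (l : W ≤ V) : (D.A i).res (hα.trans (D.cov.O_le_left α)) l (D.as α β γ hα hβ hγ : D.S i V _) =
      (D.as α β γ (l.trans hα) (l.trans hβ) (l.trans hγ) : D.S i W _) :=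
  (D.A i).res_res _ _ _ _

lemma fs_fs (hα : V ≤ D.cov.O i j α) (hβ : V ≤ D.cov.O i k β) (hγ : V ≤ D.cov.O j k γ) (x) :
    D.fs α hα (D.fs γ hγ x) * D.as α β γ hα hβ hγ = D.as α β γ hα hβ hγ * D.fs β hβ x := by
  have := D.f_f α β γ V (le_inf (le_inf hα hβ) hγ) x
  have e : D.fs α hα (D.fs γ hγ x) = D.as α β γ hα hβ hγ * D.fs β hβ x *
    ((D.as α β γ hα hβ hγ)⁻¹ : (D.S i V _)ˣ) := this
  rw [e, Units.inv_mul_cancel_right]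

variable {δ : D.cov.κ i l} {ε : D.cov.κ j l} {φ : D.cov.κ k l}

lemma as_mul_as (hα : V ≤ D.cov.O i j α) (hβ : V ≤ D.cov.O i k β) (hγ : V ≤ D.cov.O j k γ)
    (hδ : V ≤ D.cov.O i l δ) (hε : V ≤ D.cov.O j l ε) (hφ : V ≤ D.cov.O k l φ) :
    (D.as α β γ hα hβ hγ : D.S i V _) * D.as β δ φ hβ hδ hφ =
      D.fs α hα (D.as γ ε φ hγ hε hφ : D.S j V _) * D.as α δ ε hα hδ hε := by
  have := D.cocycle α β γ δ ε φ V (le_inf (le_inf hα hβ) hγ) (le_inf (le_inf hα hδ) hε)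
    (le_inf (le_inf hβ hδ) hφ) (le_inf (le_inf hγ hε) hφ)
  exact this

/-- The multipliers `a α β γ` and `a α' β γ` with the same `β` and `γ` compare the isomorphisms with
indices `α` and `α'` from `j` to `i`; this comparison does not depend on `β` and `γ`. -/
lemma mul_as_eq_of (α' : D.cov.κ i j) (hα : V ≤ D.cov.O i j α) (hα' : V ≤ D.cov.O i j α')
    (hβ : V ≤ D.cov.O i k β) (hγ : V ≤ D.cov.O j k γ)
    (hδ : V ≤ D.cov.O i l δ) (hε : V ≤ D.cov.O j l ε)
    (s s' : D.S i V (hα.trans (D.cov.O_le_left α)))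
    (h : s * D.as α β γ hα hβ hγ = s' * D.as α' β γ hα' hβ hγ) :
    s * D.as α δ ε hα hδ hε = s' * D.as α' δ ε hα' hδ hε := by
  refine (D.A i).isOpenSheaf.ext _ _ _ fun x hx => ?_
  obtain ⟨φ, hφ⟩ := D.cov.exists_mem_O (D.cov.O_le_right _ (hβ hx)) (D.cov.O_le_right _ (hδ hx))
  let W := V ⊓ D.cov.O k l φ
  have l₁ : W ≤ V := inf_le_left
  have l₂ : W ≤ D.cov.O k l φ := inf_le_right
  refine ⟨W, l₁, ⟨hx, hφ⟩, ?_⟩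
  have h := congrArg ((D.A i).res (hα.trans (D.cov.O_le_left α)) l₁) h
  simp only [map_mul, res_as] at h ⊢
  generalize (D.A i).res (hα.trans (D.cov.O_le_left α)) l₁ s = s at h ⊢
  generalize (D.A i).res (hα.trans (D.cov.O_le_left α)) l₁ s' = s' at h ⊢
  replace hα := l₁.trans hα
  replace hα' := l₁.trans hα'
  replace hβ := l₁.trans hβ
  replace hγ := l₁.trans hγ
  replace hδ := l₁.trans hδ
  replace hε := l₁.trans hε
  have e₁ := D.as_mul_as hα hβ hγ hδ hε l₂
  have e₂ := D.as_mul_as hα' hβ hγ hδ hε l₂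
  obtain ⟨z, hz⟩ := (D.fs_bijective hε).2 (D.as γ ε φ hγ hε l₂ : D.S j W _)
  have e₃ := D.fs_fs hα hδ hε z
  have e₄ := D.fs_fs hα' hδ hε z
  rw [hz] at e₃ e₄
  rw [e₃] at e₁
  rw [e₄] at e₂
  have u : IsUnit (D.fs δ hδ z) := by
    have : IsUnit z := by
      refine (MulEquiv.isUnit_map (RingEquiv.ofBijective _ (D.fs_bijective hε))).1 ?_
      change IsUnit (D.fs ε hε z)
      rw [hz]
      exact Units.isUnit _
    exact this.map _
  rw [← u.mul_left_inj, mul_assoc, mul_assoc, ← e₁, ← e₂, ← mul_assoc, h, mul_assoc]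

end GluingData

end

/-! ### Twisted modules -/

section

variable {X : TopCat.{u}} {R : TopCat.Sheaf CommRingCat.{u} X}

variable (D : GluingData R)

/-- A twisted module over `V`, for the gluing data `D`: a sheaf of right `A i`-modules on `V ∩ U i`
for each `i`, with bijections `tr α` over `V ∩ O i j α` from the module at `i` to the module at `j`,
semilinear with respect to `f α`, such that `tr γ ∘ tr α` and `tr β` differ by the action of
`a α β γ`. It is required to be locally free of rank one.

The restrictions, the actions and the bijections `tr α` are given on all open subsets `W` of the
domains on which they make sense. -/
structure TwistedModule (V : Opens X) : Type (u + 1) where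
  carrier (i : D.cov.ι) (W : Opens X) (hV : W ≤ V) (hU : W ≤ D.cov.U i) : Type u
  [grp (i W hV hU) : AddCommGroup (carrier i W hV hU)]
  res {i W W'} (hV : W ≤ V) (hU : W ≤ D.cov.U i) (k : W' ≤ W) :
    carrier i W hV hU →+ carrier i W' (k.trans hV) (k.trans hU)
  act {i W} (hV : W ≤ V) (hU : W ≤ D.cov.U i) :
    carrier i W hV hU →+ D.S i W hU →+ carrier i W hV hU
  tr {i j W} (hV : W ≤ V) (α : D.cov.κ i j) (hα : W ≤ D.cov.O i j α) :
    carrier i W hV (hα.trans (D.cov.O_le_left α)) →+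
      carrier j W hV (hα.trans (D.cov.O_le_right α))
  isOpenSheaf (i) : IsOpenSheaf (U := V ⊓ D.cov.U i)
    (fun W h => carrier i W (h.trans inf_le_left) (h.trans inf_le_right)) (fun _ k m => res _ _ k m)
  act_one {i W} (hV : W ≤ V) (hU : W ≤ D.cov.U i) (m) : act hV hU m 1 = m
  act_mul {i W} (hV : W ≤ V) (hU : W ≤ D.cov.U i) (m x y) :
    act hV hU m (x * y) = act hV hU (act hV hU m x) y
  res_act {i W W'} (hV : W ≤ V) (hU : W ≤ D.cov.U i) (k : W' ≤ W) (m x) :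
    res hV hU k (act hV hU m x) = act _ _ (res hV hU k m) ((D.A i).res hU k x)
  res_tr {i j W W'} (hV : W ≤ V) (α : D.cov.κ i j) (hα : W ≤ D.cov.O i j α) (k : W' ≤ W) (m) :
    res _ _ k (tr hV α hα m) = tr (k.trans hV) α (k.trans hα) (res _ _ k m)
  tr_act {i j W} (hV : W ≤ V) (α : D.cov.κ i j) (hα : W ≤ D.cov.O i j α) (m) (x) :
    tr hV α hα (act _ _ m (D.fs α hα x)) = act _ _ (tr hV α hα m) x
  tr_tr {i j k W} (hV : W ≤ V) (α : D.cov.κ i j) (β : D.cov.κ i k) (γ : D.cov.κ j k)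
    (hα : W ≤ D.cov.O i j α) (hβ : W ≤ D.cov.O i k β) (hγ : W ≤ D.cov.O j k γ) (m) :
    tr hV γ hγ (tr hV α hα m) = tr hV β hβ (act _ _ m (D.as α β γ hα hβ hγ : D.S i W _))
  tr_bijective {i j W} (hV : W ≤ V) (α : D.cov.κ i j) (hα : W ≤ D.cov.O i j α) :
    Function.Bijective (tr hV α hα)
  locally_free (x : X) (hx : x ∈ V) : ∃ (i : D.cov.ι) (W : Opens X) (hV : W ≤ V)
    (hU : W ≤ D.cov.U i) (m : carrier i W hV hU), x ∈ W ∧ ∀ (W' : Opens X) (k : W' ≤ W),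
      Function.Bijective (fun a => act (k.trans hV) (k.trans hU) (res hV hU k m) a)

namespace TwistedModule

variable {D} {V V' V'' : Opens X}

instance (M : TwistedModule D V) (i W hV hU) : AddCommGroup (M.carrier i W hV hU) := M.grp i W hV hU

@[simp]
lemma res_refl (M : TwistedModule D V) {i W} (hV : W ≤ V) (hU : W ≤ D.cov.U i)
    (m : M.carrier i W hV hU) : M.res hV hU le_rfl m = m :=
  (M.isOpenSheaf i).res_refl (le_inf hV hU) m

@[simp]
lemma res_res (M : TwistedModule D V) {i} {W W' W'' : Opens X} (hV : W ≤ V) (hU : W ≤ D.cov.U i)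
    (k : W' ≤ W) (k' : W'' ≤ W') (m : M.carrier i W hV hU) :
    M.res (k.trans hV) (k.trans hU) k' (M.res hV hU k m) = M.res hV hU (k'.trans k) m :=
  (M.isOpenSheaf i).res_res (le_inf hV hU) k k' m

lemma ext_local (M : TwistedModule D V) {i} {W : Opens X} (hV : W ≤ V) (hU : W ≤ D.cov.U i)
    (m m' : M.carrier i W hV hU) (hl : ∀ x ∈ W, ∃ (W' : Opens X) (k : W' ≤ W), x ∈ W' ∧
      M.res hV hU k m = M.res hV hU k m') : m = m' :=
  (M.isOpenSheaf i).ext (le_inf hV hU) m m' hl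

theorem exists_of_description (M : TwistedModule D V) {i} {W : Opens X}
    (hV : W ≤ V) (hU : W ≤ D.cov.U i)
    (P : ∀ (W' : Opens X) (k : W' ≤ W), M.carrier i W' (k.trans hV) (k.trans hU) → Prop)
    (hu : ∀ W' k s s', P W' k s → P W' k s' → s = s')
    (hr : ∀ W' k s W'' (k' : W'' ≤ W'), P W' k s → P W'' (k'.trans k) (M.res _ _ k' s))
    (hl : ∀ x ∈ W, ∃ W' k s, x ∈ W' ∧ P W' k s) :
    ∃ t, ∀ W' k s, P W' k s → M.res hV hU k t = s :=
  (M.isOpenSheaf i).exists_of_description (le_inf hV hU) P hu hr hl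

/-- A morphism of twisted modules. -/
@[ext]
structure Hom (M N : TwistedModule D V) : Type u where
  app (i : D.cov.ι) (W : Opens X) (hV : W ≤ V) (hU : W ≤ D.cov.U i) :
    M.carrier i W hV hU →+ N.carrier i W hV hU
  app_res {i W W'} (hV : W ≤ V) (hU : W ≤ D.cov.U i) (k : W' ≤ W) (m) :
    app i W' _ _ (M.res hV hU k m) = N.res hV hU k (app i W hV hU m)
  app_act {i W} (hV : W ≤ V) (hU : W ≤ D.cov.U i) (m x) :
    app i W _ _ (M.act hV hU m x) = N.act hV hU (app i W hV hU m) x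
  app_tr {i j W} (hV : W ≤ V) (α : D.cov.κ i j) (hα : W ≤ D.cov.O i j α) (m) :
    app j W _ _ (M.tr hV α hα m) = N.tr hV α hα (app i W hV _ m)

instance : Category.{u} (TwistedModule D V) where
  Hom := Hom
  id M :=
    { app := fun _ _ _ _ => AddMonoidHom.id _
      app_res := fun _ _ _ _ => rfl
      app_act := fun _ _ _ _ => rfl
      app_tr := fun _ _ _ _ => rfl }
  comp f g :=
    { app := fun i W hV hU => (g.app i W hV hU).comp (f.app i W hV hU)
      app_res := fun hV hU k m => by simp [f.app_res, g.app_res]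
      app_act := fun hV hU k m => by simp [f.app_act, g.app_act]
      app_tr := fun hV hU k m => by simp [f.app_tr, g.app_tr] }

variable {M N L : TwistedModule D V}

@[ext]
lemma hom_ext {f g : M ⟶ N} (h : ∀ i W hV hU m, f.app i W hV hU m = g.app i W hV hU m) :
    f = g := by
  refine Hom.ext ?_
  funext i W hV hU
  ext m
  exact h i W hV hU m

@[simp] lemma id_app (i W hV hU) (m : M.carrier i W hV hU) : Hom.app (𝟙 M) i W hV hU m = m := rfl

@[simp] lemma comp_app (f : M ⟶ N) (g : N ⟶ L) (i W hV hU) (m : M.carrier i W hV hU) :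
  (f ≫ g).app i W hV hU m = g.app i W hV hU (f.app i W hV hU m) := rfl

instance : Add (M ⟶ N) where
  add f g :=
    { app := fun i W hV hU => f.app i W hV hU + g.app i W hV hU
      app_res := fun hV hU k m => by simp [f.app_res, g.app_res]
      app_act := fun hV hU k m => by simp [f.app_act, g.app_act]
      app_tr := fun hV hU k m => by simp [f.app_tr, g.app_tr] }

instance : Zero (M ⟶ N) where
  zero :=
    { app := fun i W hV hU => 0
      app_res := fun hV hU k m => by simp
      app_act := fun hV hU k m => by simp
      app_tr := fun hV hU k m => by simp }

instance : Neg (M ⟶ N) where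
  neg f :=
    { app := fun i W hV hU => - f.app i W hV hU
      app_res := fun hV hU k m => by simp [f.app_res]
      app_act := fun hV hU k m => by simp [f.app_act]
      app_tr := fun hV hU k m => by simp [f.app_tr] }

/-- Restriction of sections of `R`. -/
abbrev resR {V W : Opens X} (k : W ≤ V) : R.obj.obj (op V) →+* R.obj.obj (op W) :=
  (R.obj.map (homOfLE k).op).hom

lemma resR_resR {V W W' : Opens X} (k : W ≤ V) (k' : W' ≤ W) (r : R.obj.obj (op V)) :
    resR k' (resR k r) = resR (k'.trans k) r :=
  (ConcreteCategory.congr_hom (R.obj.map_comp (homOfLE k).op (homOfLE k').op) r).symm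

instance : SMul (R.obj.obj (op V)) (M ⟶ N) where
  smul r f :=
    { app := fun i W hV hU => ((N.act hV hU).flip ((D.A i).scalar hU (resR hV r))).comp
        (f.app i W hV hU)
      app_res := fun hV hU k m => by simp [f.app_res, N.res_act, AlgebraOn.res_scalar, resR_resR]
      app_act := fun {i W} hV hU m x => by
        simp [f.app_act, ← N.act_mul, AlgebraOn.scalar_comm]
      app_tr := fun hV α hα m => by
        simp [f.app_tr, ← N.tr_act, D.fs_scalar] }

@[simp] lemma add_app (f g : M ⟶ N) (i W hV hU) (m : M.carrier i W hV hU) :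
  (f + g).app i W hV hU m = f.app i W hV hU m + g.app i W hV hU m := rfl

@[simp] lemma zero_app (i W hV hU) (m : M.carrier i W hV hU) :
  Hom.app (0 : M ⟶ N) i W hV hU m = 0 := rfl

@[simp] lemma neg_app (f : M ⟶ N) (i W hV hU) (m : M.carrier i W hV hU) :
  (-f).app i W hV hU m = - f.app i W hV hU m := rfl

@[simp] lemma smul_app (r : R.obj.obj (op V)) (f : M ⟶ N) (i W hV hU)
    (m : M.carrier i W hV hU) :
  (r • f).app i W hV hU m =
    N.act hV hU (f.app i W hV hU m) ((D.A i).scalar hU (resR hV r)) := rfl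

instance : AddCommGroup (M ⟶ N) where
  add_assoc f g h := by ext; simp [add_assoc]
  zero_add f := by ext; simp
  add_zero f := by ext; simp
  add_comm f g := by ext; simp [add_comm]
  neg_add_cancel f := by ext; simp
  nsmul := nsmulRec
  zsmul := zsmulRec

instance : Module (R.obj.obj (op V)) (M ⟶ N) where
  one_smul f := by ext; simp [N.act_one]
  mul_smul r s f := by ext; simp [← N.act_mul, ← map_mul, mul_comm]
  smul_zero r := by ext; simp
  smul_add r f g := by ext; simp
  add_smul r s f := by ext; simp
  zero_smul f := by ext; simp

instance : Preadditive (TwistedModule D V) where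
  homGroup M N := inferInstance

instance : Linear (R.obj.obj (op V)) (TwistedModule D V) where
  homModule M N := inferInstance
  smul_comp M N L r f g := by ext; simp [Hom.app_act]

/-- Restriction of a twisted module to a smaller open subset. -/
def restr (M : TwistedModule D V) (h : V' ≤ V) : TwistedModule D V' where
  carrier i W hV hU := M.carrier i W (hV.trans h) hU
  res hV hU k := M.res (hV.trans h) hU k
  act hV hU := M.act (hV.trans h) hU
  tr hV α hα := M.tr (hV.trans h) α hα
  isOpenSheaf i :=
    { res_refl := fun h' => (M.isOpenSheaf i).res_refl (h'.trans (inf_le_inf_right _ h))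
      res_res := fun h' => (M.isOpenSheaf i).res_res (h'.trans (inf_le_inf_right _ h))
      ext := fun h' => (M.isOpenSheaf i).ext (h'.trans (inf_le_inf_right _ h))
      glue := fun h' => (M.isOpenSheaf i).glue (h'.trans (inf_le_inf_right _ h)) }
  act_one hV hU := M.act_one _ _
  act_mul hV hU := M.act_mul _ _
  res_act hV hU := M.res_act _ _
  res_tr hV := M.res_tr _
  tr_act hV := M.tr_act _
  tr_tr hV := M.tr_tr _
  tr_bijective hV := M.tr_bijective _
  locally_free x hx := by
    obtain ⟨i, W, hV, hU, m, hx', hm⟩ := M.locally_free x (h hx)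
    refine ⟨i, W ⊓ V', inf_le_right, inf_le_left.trans hU, M.res hV hU inf_le_left m,
      ⟨hx', hx⟩, fun W' k => ?_⟩
    have := hm W' (k.trans inf_le_left)
    simpa using this

/-- Restriction of a morphism of twisted modules to a smaller open subset. -/
@[simps]
def restrHom (f : M ⟶ N) (h : V' ≤ V) : M.restr h ⟶ N.restr h where
  app i W hV hU := f.app i W (hV.trans h) hU
  app_res _ _ _ _ := f.app_res _ _ _ _
  app_act _ _ _ _ := f.app_act _ _ _ _
  app_tr _ _ _ _ := f.app_tr _ _ _ _

end TwistedModule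

open TwistedModule

/-- The functor taking `V` to the category of twisted modules over `V`. Restriction is strictly
functorial. -/
def twistedFunctor : (Opens X)ᵒᵖ ⥤ Cat.{u, u + 1} where
  obj V := Cat.of (TwistedModule D V.unop)
  map f := Functor.toCatHom
    { obj := fun M => M.restr (leOfHom f.unop)
      map := fun φ => restrHom φ (leOfHom f.unop) }

/-- The prestack of twisted modules. The linear structure on morphisms over `V` is given by the
action of the sections of `R` on the modules at the various indices. -/
def twistedStack : Prestack R where
  toPseudofunctor := (twistedFunctor D).toPseudofunctor'
  preadditive V := (inferInstance : Preadditive (TwistedModule D V))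
  linear V := (inferInstance : Linear (R.obj.obj (op V)) (TwistedModule D V))
  map_add i _ _ s t := rfl
  map_smul {V W} i P Q r s := by
    refine TwistedModule.hom_ext fun i' W' hV hU m => ?_
    change Q.act _ _ _ _ = Q.act _ _ _ _
    congr 1
    change _ = (D.A i').scalar hU (resR hV (resR (leOfHom i) r))
    rw [resR_resR]

end

/-! ### Isomorphisms and gluing of morphisms of twisted modules -/

section

variable {X : TopCat.{u}} {R : TopCat.Sheaf CommRingCat.{u} X}

namespace TwistedModule
variable {D : GluingData R} {V V₁ V₂ V₃ W W' : Opens X}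

/-- A morphism all of whose components are bijective is an isomorphism. -/
noncomputable def isoOfBijective {M N : TwistedModule D V} (f : M ⟶ N)
    (hf : ∀ i W hV hU, Function.Bijective (f.app i W hV hU)) : M ≅ N :=
  let e (i W hV hU) : M.carrier i W hV hU ≃+ N.carrier i W hV hU :=
    AddEquiv.ofBijective (f.app i W hV hU) (hf i W hV hU)
  have he (i W hV hU m) : (e i W hV hU).symm (f.app i W hV hU m) = m :=
    (e i W hV hU).symm_apply_apply m
  have he' (i W hV hU m) : f.app i W hV hU ((e i W hV hU).symm m) = m :=
    (e i W hV hU).apply_symm_apply m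
  { hom := f
    inv :=
      { app := fun i W hV hU => (e i W hV hU).symm.toAddMonoidHom
        app_res := fun {i W W'} hV hU k m => by
          refine (hf i W' _ _).1 ((he' _ _ _ _ _).trans ?_)
          rw [f.app_res]
          exact congrArg _ (he' _ _ _ _ _).symm
        app_act := fun {i W} hV hU m x => by
          refine (hf i W _ _).1 ((he' _ _ _ _ _).trans ?_)
          rw [f.app_act]
          exact congrArg (fun m => N.act hV hU m x) (he' _ _ _ _ _).symm
        app_tr := fun {i j W} hV α hα m => by
          refine (hf j W _ _).1 ((he' _ _ _ _ _).trans ?_)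
          rw [f.app_tr]
          exact congrArg _ (he' _ _ _ _ _).symm }
    hom_inv_id := hom_ext he
    inv_hom_id := hom_ext he' }

lemma hom_ext_local {M N : TwistedModule D V} (f g : M ⟶ N)
    (h : ∀ x ∈ V, ∃ (W : Opens X) (k : W ≤ V), x ∈ W ∧ restrHom f k = restrHom g k) : f = g := by
  ext i W hV hU m
  refine N.ext_local _ _ _ _ fun x hx => ?_
  obtain ⟨W', k, hx', e⟩ := h x (hV hx)
  refine ⟨W ⊓ W', inf_le_left, ⟨hx, hx'⟩, ?_⟩
  rw [← f.app_res, ← g.app_res]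
  exact DFunLike.congr_fun (congrFun (congrFun (congrFun (congrFun (congrArg Hom.app e) i)
    (W ⊓ W')) inf_le_right) (inf_le_left.trans hU)) (M.res hV hU inf_le_left m)

/-- Morphisms of twisted modules over the members of a covering can be glued. -/
lemma exists_hom_glue {I : Type v} {M N : TwistedModule D V} (B : I → Opens X) (hB : ∀ a, B a ≤ V)
    (cov : ∀ x ∈ V, ∃ a, x ∈ B a) (f : ∀ a, M.restr (hB a) ⟶ N.restr (hB a))
    (compat : ∀ a b i W (h : W ≤ B a) (h' : W ≤ B b) (hU) (m : M.carrier i W (h.trans (hB a)) hU),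
      Eq (α := N.carrier i W (h.trans (hB a)) hU)
      ((f a).app i W h hU m) ((f b).app i W h' hU m)) :
    ∃ g : M ⟶ N, ∀ a, restrHom g (hB a) = f a := by
  have key : ∀ i W (hV : W ≤ V) (hU : W ≤ D.cov.U i) (m : M.carrier i W hV hU),
      ∃ n : N.carrier i W hV hU, ∀ W' (k : W' ≤ W) a (h : W' ≤ B a),
        N.res hV hU k n = (f a).app i W' h (k.trans hU) (M.res hV hU k m) := by
    intro i W hV hU m
    obtain ⟨n, hn⟩ := N.exists_of_description hV hU
      (fun W' k s => ∃ a, ∃ h : W' ≤ B a, s = (f a).app i W' h (k.trans hU) (M.res hV hU k m))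
      (by
        rintro W' k s s' ⟨a, h, rfl⟩ ⟨b, h', rfl⟩
        exact compat a b i W' h h' _ _)
      (by
        rintro W' k s W'' k' ⟨a, h, rfl⟩
        refine ⟨a, k'.trans h, ?_⟩
        rw [← M.res_res hV hU k k']
        exact ((f a).app_res h (k.trans hU) k' _).symm)
      (by
        intro x hx
        obtain ⟨a, ha⟩ := cov x (hV hx)
        exact ⟨W ⊓ B a, inf_le_left, _, ⟨hx, ha⟩, a, inf_le_right, rfl⟩)
    exact ⟨n, fun W' k a h => hn W' k _ ⟨a, h, rfl⟩⟩
  choose g hg using key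
  have ext' : ∀ i W (hV : W ≤ V) (hU : W ≤ D.cov.U i) (n n' : N.carrier i W hV hU),
      (∀ W' (k : W' ≤ W) a (_ : W' ≤ B a), N.res hV hU k n = N.res hV hU k n') → n = n' := by
    intro i W hV hU n n' h
    refine N.ext_local _ _ _ _ fun x hx => ?_
    obtain ⟨a, ha⟩ := cov x (hV hx)
    exact ⟨W ⊓ B a, inf_le_left, ⟨hx, ha⟩, h _ _ a inf_le_right⟩
  refine ⟨{ app := fun i W hV hU => AddMonoidHom.mk' (g i W hV hU) ?_
            app_res := ?_
            app_act := ?_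
            app_tr := ?_ }, ?_⟩
  · intro m m'
    refine ext' _ _ _ _ _ _ fun W' k a h => ?_
    rw [map_add, hg _ _ _ _ _ _ _ a h, hg _ _ _ _ _ _ _ a h, hg _ _ _ _ _ _ _ a h, map_add]
    exact map_add ((f a).app i W' h (k.trans hU)) _ _
  · intro i W W' hV hU k m
    refine ext' _ _ _ _ _ _ fun W'' k' a h => ?_
    change N.res _ _ k' (g _ _ _ _ _) = N.res _ _ k' (N.res _ _ k (g _ _ _ _ _))
    rw [N.res_res, hg _ _ _ _ _ _ _ a h, hg _ _ _ _ _ _ _ a h, M.res_res]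
  · intro i W hV hU m x
    refine ext' _ _ _ _ _ _ fun W'' k' a h => ?_
    change N.res _ _ k' (g _ _ _ _ _) = N.res _ _ k' (N.act _ _ (g _ _ _ _ _) x)
    rw [N.res_act, hg _ _ _ _ _ _ _ a h, hg _ _ _ _ _ _ _ a h, M.res_act]
    exact (f a).app_act _ _ _ _
  · intro i j W hV α hα m
    refine ext' _ _ _ _ _ _ fun W'' k' a h => ?_
    change N.res _ _ k' (g _ _ _ _ _) = N.res _ _ k' (N.tr _ _ _ (g _ _ _ _ _))
    rw [N.res_tr, hg _ _ _ _ _ _ _ a h, hg _ _ _ _ _ _ _ a h, M.res_tr]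
    exact (f a).app_tr _ _ _ _
  · intro a
    ext i W hV hU m
    change g _ _ _ _ _ = _
    have := hg _ _ (hV.trans (hB a)) hU m W le_rfl a hV
    rw [N.res_refl] at this
    exact this.trans (congrArg _ (M.res_refl _ _ m))

end TwistedModule

end

/-! ### Descent for twisted modules -/

section

variable {X : TopCat.{u}} {R : TopCat.Sheaf CommRingCat.{u} X}
open LinearPrestack (rmap rcomp rid)

namespace TwistedModule
variable {D : GluingData R} {V V₁ V₂ V₃ W W' : Opens X}

variable (D) in
/-- A descent datum of twisted modules on a family of open subsets `B a`. The bijections `Φ a b`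
between the modules on `B a` and `B b` are given on all open subsets of `B a ∩ B b`. -/
structure Datum {I : Type u} (B : I → Opens X) where
  M (a : I) : TwistedModule D (B a)
  Φ (a b : I) {i W} (h : W ≤ B a) (h' : W ≤ B b) (hU : W ≤ D.cov.U i) :
    (M a).carrier i W h hU →+ (M b).carrier i W h' hU
  Φ_res {a b i W W'} (h : W ≤ B a) (h' : W ≤ B b) (hU : W ≤ D.cov.U i) (k : W' ≤ W) (m) :
    (M b).res h' hU k (Φ a b h h' hU m) = Φ a b (k.trans h) (k.trans h') (k.trans hU)
      ((M a).res h hU k m)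
  Φ_act {a b i W} (h : W ≤ B a) (h' : W ≤ B b) (hU : W ≤ D.cov.U i) (m x) :
    Φ a b h h' hU ((M a).act h hU m x) = (M b).act h' hU (Φ a b h h' hU m) x
  Φ_tr {a b i j W} (h : W ≤ B a) (h' : W ≤ B b) (α : D.cov.κ i j) (hα : W ≤ D.cov.O i j α) (m) :
    Φ a b h h' _ ((M a).tr h α hα m) = (M b).tr h' α hα (Φ a b h h' _ m)
  Φ_self {a i W} (h : W ≤ B a) (hU : W ≤ D.cov.U i) (m) : Φ a a h h hU m = m
  Φ_comp {a b c i W} (h : W ≤ B a) (h' : W ≤ B b) (h'' : W ≤ B c) (hU : W ≤ D.cov.U i) (m) :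
    Φ b c h' h'' hU (Φ a b h h' hU m) = Φ a c h h'' hU m

namespace Datum
variable {I : Type u} {B : I → Opens X} (G : Datum D B)

/-- The sections over `W` at the index `i` of the glued twisted module: families of sections of the
modules `M a` on the open subsets of `W ∩ B a`, compatible with restrictions and with `Φ`. -/
def gluedSubgroup (i : D.cov.ι) (W : Opens X) (hU : W ≤ D.cov.U i) :
    AddSubgroup (∀ (a : I) (p : {W' : Opens X // W' ≤ W ∧ W' ≤ B a}),
      (G.M a).carrier i p.1 p.2.2 (p.2.1.trans hU)) where
  carrier := { m | (∀ a p W'' (k' : W'' ≤ p.1), (G.M a).res _ _ k' (m a p) =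
      m a ⟨W'', k'.trans p.2.1, k'.trans p.2.2⟩) ∧
    (∀ a b p (h' : p.1 ≤ B b), G.Φ a b p.2.2 h' (p.2.1.trans hU) (m a p) =
      m b ⟨p.1, p.2.1, h'⟩) }
  add_mem' := by
    rintro m m' ⟨h₁, h₂⟩ ⟨h₁', h₂'⟩
    constructor
    · intros
      simp only [Pi.add_apply, map_add]
      rw [h₁, h₁']
    · intros
      simp only [Pi.add_apply, map_add]
      rw [h₂, h₂']
  zero_mem' := by simp
  neg_mem' := by
    rintro m ⟨h₁, h₂⟩
    constructor
    · intros
      simp only [Pi.neg_apply, map_neg]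
      rw [h₁]
    · intros
      simp only [Pi.neg_apply, map_neg]
      rw [h₂]

lemma gluedSubgroup_ext {G : Datum D B} {i : D.cov.ι} {W : Opens X} {hU : W ≤ D.cov.U i}
    {m m' : G.gluedSubgroup i W hU} (h : ∀ a p, m.1 a p = m'.1 a p) : m = m' :=
  Subtype.ext (by funext a p; exact h a p)

/-- Evaluation of a family at the index `a` on the whole of `W`, if `W ⊆ B a`. -/
def ev {i : D.cov.ι} {W : Opens X} (a : I) (h : W ≤ B a) (hU : W ≤ D.cov.U i) :
    G.gluedSubgroup i W hU →+ (G.M a).carrier i W h hU where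
  toFun m := m.1 a ⟨W, le_rfl, h⟩
  map_zero' := rfl
  map_add' _ _ := rfl

lemma ev_bijective {i : D.cov.ι} {W : Opens X} (a : I) (h : W ≤ B a) (hU : W ≤ D.cov.U i) :
    Function.Bijective (G.ev a h hU) := by
  constructor
  · intro m m' e
    refine gluedSubgroup_ext fun b p => ?_
    have h₁ := m.2.2 a b ⟨p.1, p.2.1, p.2.1.trans h⟩ p.2.2
    have h₂ := m'.2.2 a b ⟨p.1, p.2.1, p.2.1.trans h⟩ p.2.2
    have h₃ := m.2.1 a ⟨W, le_rfl, h⟩ p.1 p.2.1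
    have h₄ := m'.2.1 a ⟨W, le_rfl, h⟩ p.1 p.2.1
    refine h₁.symm.trans (Eq.trans (congrArg _ ?_) h₂)
    exact h₃.symm.trans ((congrArg _ e).trans h₄)
  · intro m
    refine ⟨⟨fun b p => G.Φ a b (p.2.1.trans h) p.2.2 _ ((G.M a).res h hU p.2.1 m), ?_, ?_⟩, ?_⟩
    · intro b p W'' k'
      rw [G.Φ_res, TwistedModule.res_res]
    · intro b c p h'
      rw [G.Φ_comp]
    · change G.Φ a a _ _ _ _ = _
      rw [G.Φ_self, TwistedModule.res_refl]

/-- Restriction of families. -/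
@[simps]
def gluedRes {i : D.cov.ι} {W W' : Opens X} (hU : W ≤ D.cov.U i) (k : W' ≤ W) :
    G.gluedSubgroup i W hU →+ G.gluedSubgroup i W' (k.trans hU) where
  toFun m := ⟨fun a p => m.1 a ⟨p.1, p.2.1.trans k, p.2.2⟩,
    fun a p W'' k' => m.2.1 a ⟨p.1, p.2.1.trans k, p.2.2⟩ W'' k',
    fun a b p h' => m.2.2 a b ⟨p.1, p.2.1.trans k, p.2.2⟩ h'⟩
  map_zero' := rfl
  map_add' _ _ := rfl

/-- The action of a section of `A i` on a family, before additivity. -/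
@[simps]
def gluedActAux {i : D.cov.ι} {W : Opens X} (hU : W ≤ D.cov.U i) (m : G.gluedSubgroup i W hU)
    (x : D.S i W hU) : G.gluedSubgroup i W hU where
  val a p := (G.M a).act p.2.2 (p.2.1.trans hU) (m.1 a p) ((D.A i).res hU p.2.1 x)
  property := by
    constructor
    · intro a p W'' k'
      rw [(G.M a).res_act, m.2.1]
      simp
    · intro a b p h'
      rw [G.Φ_act, m.2.2]

/-- The action of `A i` on families. -/
def gluedAct {i : D.cov.ι} {W : Opens X} (hU : W ≤ D.cov.U i) :
    G.gluedSubgroup i W hU →+ D.S i W hU →+ G.gluedSubgroup i W hU :=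
  AddMonoidHom.mk' (fun m => AddMonoidHom.mk' (fun x => G.gluedActAux hU m x)
    (fun x y => gluedSubgroup_ext fun a p => by simp [gluedActAux]))
    (fun m m' => by
      ext x : 1
      exact gluedSubgroup_ext fun a p => by simp [gluedActAux])

@[simp]
lemma gluedAct_coe {i : D.cov.ι} {W : Opens X} (hU : W ≤ D.cov.U i) (m : G.gluedSubgroup i W hU)
    (x : D.S i W hU) (a : I) (p) : (G.gluedAct hU m x).1 a p =
      (G.M a).act p.2.2 (p.2.1.trans hU) (m.1 a p) ((D.A i).res hU p.2.1 x) := rfl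

/-- The bijection `tr α` on families. -/
@[simps]
def gluedTr {i j : D.cov.ι} {W : Opens X} (α : D.cov.κ i j) (hα : W ≤ D.cov.O i j α) :
    G.gluedSubgroup i W (hα.trans (D.cov.O_le_left α)) →+
      G.gluedSubgroup j W (hα.trans (D.cov.O_le_right α)) where
  toFun m := ⟨fun a p => (G.M a).tr p.2.2 α (p.2.1.trans hα) (m.1 a p), by
          intro a p W'' k'
          rw [(G.M a).res_tr, m.2.1], by
          intro a b p h'
          rw [G.Φ_tr, m.2.2]⟩
  map_zero' := gluedSubgroup_ext (by simp)
  map_add' := fun x y => gluedSubgroup_ext (by simp)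

lemma gluedSubgroup_isOpenSheaf (V : Opens X) (i : D.cov.ι) : IsOpenSheaf (U := V ⊓ D.cov.U i)
    (fun W h => G.gluedSubgroup i W (h.trans inf_le_right)) (fun _ k m => G.gluedRes _ k m) where
  res_refl := fun h t => rfl
  res_res := fun h k k' t => rfl
  ext := by
    intro W h t t' hl
    refine gluedSubgroup_ext fun a ⟨W', k, h'⟩ => (G.M a).ext_local _ _ _ _ fun x hx => ?_
    obtain ⟨W₁, l, hx', e⟩ := hl x (k hx)
    refine ⟨W' ⊓ W₁, inf_le_left, ⟨hx, hx'⟩, ?_⟩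
    rw [t.2.1 a ⟨W', k, h'⟩, t'.2.1 a ⟨W', k, h'⟩]
    exact congrArg (fun m => m.1 a ⟨W' ⊓ W₁, inf_le_right, inf_le_left.trans h'⟩) e
  glue := by
    intro W h Bo mem l s compat
    have key : ∀ a W' (k : W' ≤ W) (h' : W' ≤ B a), ∃ m : (G.M a).carrier i W' h'
        (k.trans (h.trans inf_le_right)), ∀ W'' (k' : W'' ≤ W') x (hx : W'' ≤ Bo x),
        (G.M a).res _ _ k' m = (s x).1 a ⟨W'', hx, k'.trans h'⟩ := by
      intro a W' k h'
      obtain ⟨m, hm⟩ := (G.M a).exists_of_description h' (k.trans (h.trans inf_le_right))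
        (fun W'' k' t => ∃ x, ∃ hx : W'' ≤ Bo x, t = (s x).1 a ⟨W'', hx, k'.trans h'⟩)
        (by
          rintro W'' k' t t' ⟨x, hx, rfl⟩ ⟨y, hy, rfl⟩
          exact congrArg (fun m => m.1 a ⟨W'', le_rfl, k'.trans h'⟩) (compat x y W'' hx hy))
        (by
          rintro W'' k' t W₃ k₃ ⟨x, hx, rfl⟩
          exact ⟨x, k₃.trans hx, (s x).2.1 a ⟨W'', hx, k'.trans h'⟩ W₃ k₃⟩)
        (by
          intro x hx
          exact ⟨W' ⊓ Bo ⟨x, k hx⟩, inf_le_left, _, ⟨hx, mem ⟨x, k hx⟩⟩, ⟨x, k hx⟩,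
            inf_le_right, rfl⟩)
      exact ⟨m, fun W'' k' x hx => hm W'' k' _ ⟨x, hx, rfl⟩⟩
    choose m hm using key
    refine ⟨⟨fun a p => m a p.1 p.2.1 p.2.2, ?_, ?_⟩, ?_⟩
    · rintro a ⟨W', k, h'⟩ W'' k'
      refine (G.M a).ext_local _ _ _ _ fun x hx => ?_
      refine ⟨W'' ⊓ Bo ⟨x, k (k' hx)⟩, inf_le_left, ⟨hx, mem _⟩, ?_⟩
      rw [(G.M a).res_res, hm _ _ _ _ _ _ _ inf_le_right, hm _ _ _ _ _ _ _ inf_le_right]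
    · rintro a b ⟨W', k, h₁⟩ h₂
      refine (G.M b).ext_local _ _ _ _ fun x hx => ?_
      refine ⟨W' ⊓ Bo ⟨x, k hx⟩, inf_le_left, ⟨hx, mem _⟩, ?_⟩
      rw [G.Φ_res, hm _ _ _ _ _ _ _ inf_le_right, hm _ _ _ _ _ _ _ inf_le_right]
      exact (s _).2.2 a b ⟨W' ⊓ Bo ⟨x, k hx⟩, inf_le_right, inf_le_left.trans h₁⟩ _
    · intro x
      refine gluedSubgroup_ext fun a ⟨W', k, h'⟩ => ?_
      have := hm a W' (k.trans (l x)) h' W' le_rfl x k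
      rw [(G.M a).res_refl] at this
      exact this

lemma gluedTr_bijective {i j : D.cov.ι} {W : Opens X} (α : D.cov.κ i j) (hα : W ≤ D.cov.O i j α) :
    Function.Bijective (G.gluedTr α hα) := by
  constructor
  · intro m m' e
    refine gluedSubgroup_ext fun a ⟨W', k, h'⟩ => ((G.M a).tr_bijective h' α (k.trans hα)).1 ?_
    exact congrArg (fun m => m.1 a ⟨W', k, h'⟩) e
  · intro n
    have key := fun a W' (k : W' ≤ W) h' =>
      ((G.M a).tr_bijective h' α (k.trans hα)).2 (n.1 a ⟨W', k, h'⟩)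
    choose m hm using key
    refine ⟨⟨fun a p => m a p.1 p.2.1 p.2.2, ?_, ?_⟩, ?_⟩
    · rintro a ⟨W', k, h'⟩ W'' k'
      refine ((G.M a).tr_bijective _ α ((k'.trans k).trans hα)).1 ?_
      rw [hm, ← (G.M a).res_tr h' α (k.trans hα), hm, n.2.1 a ⟨W', k, h'⟩]
    · rintro a b ⟨W', k, h₁⟩ h₂
      refine ((G.M b).tr_bijective _ α (k.trans hα)).1 ?_
      rw [hm, ← G.Φ_tr, hm, n.2.2 a b ⟨W', k, h₁⟩]
    · exact gluedSubgroup_ext fun a p => hm a p.1 p.2.1 p.2.2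

/-- The twisted module over `V` obtained by gluing, if the `B a` cover `V`. -/
def glued (G : Datum D B) {V : Opens X} (hB : ∀ a, B a ≤ V) (cov : ∀ x ∈ V, ∃ a, x ∈ B a) :
    TwistedModule D V where
  carrier i W _ hU := G.gluedSubgroup i W hU
  res _ hU k := G.gluedRes hU k
  act _ hU := G.gluedAct hU
  tr _ α hα := G.gluedTr α hα
  isOpenSheaf i := G.gluedSubgroup_isOpenSheaf V i
  act_one hV hU m := gluedSubgroup_ext fun a p => by
    rw [gluedAct_coe, map_one, TwistedModule.act_one]
  act_mul hV hU m x y := gluedSubgroup_ext fun a p => by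
    rw [gluedAct_coe, gluedAct_coe, gluedAct_coe, map_mul, TwistedModule.act_mul]
  res_act hV hU k m x := gluedSubgroup_ext fun a p => by
    rw [gluedAct_coe, AlgebraOn.res_res]
    rfl
  res_tr hV α hα k m := rfl
  tr_act hV α hα m x := gluedSubgroup_ext fun a p => by
    refine (congrArg _ (congrArg _ (D.res_fs hα p.2.1 x))).trans ?_
    exact (G.M a).tr_act _ _ _ _ _
  tr_tr hV α β γ hα hβ hγ m := gluedSubgroup_ext fun a p => by
    refine ((G.M a).tr_tr _ α β γ _ (p.2.1.trans hβ) _ _).trans ?_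
    exact congrArg _ (congrArg _ (D.res_as hα hβ hγ p.2.1).symm)
  tr_bijective _ α hα := G.gluedTr_bijective α hα
  locally_free x hx := by
    obtain ⟨a, ha⟩ := cov x hx
    obtain ⟨i, W, hV, hU, m, hxW, hm⟩ := (G.M a).locally_free x ha
    obtain ⟨m, rfl⟩ := (G.ev_bijective a hV hU).2 m
    refine ⟨i, W, hV.trans (hB a), hU, m, hxW, fun W' k => ?_⟩
    refine ((G.ev_bijective a (k.trans hV) (k.trans hU)).of_comp_iff' _).1 ?_
    convert hm W' k using 2 with x
    refine congrArg₂ (fun m x => (G.M a).act _ _ m x) ?_ ?_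
    · exact (m.2.1 a ⟨W, le_rfl, hV⟩ W' k).symm
    · exact (D.A i).res_refl _ x

variable {V : Opens X} (hB : ∀ a, B a ≤ V) (cov : ∀ x ∈ V, ∃ a, x ∈ B a)

/-- Evaluation at `a`, as a morphism of twisted modules over `B a`. -/
def evHom (a : I) : (G.glued hB cov).restr (hB a) ⟶ G.M a where
  app _ _ hV hU := G.ev a hV hU
  app_res hV _ k m := (m.2.1 a ⟨_, le_rfl, hV⟩ _ k).symm
  app_act {i W} hV hU m x := congrArg (fun x => (G.M a).act hV hU (m.1 a ⟨W, le_rfl, hV⟩) x)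
    ((D.A i).res_refl _ x)
  app_tr _ _ _ _ := rfl

/-- The glued twisted module restricts to `M a`. -/
noncomputable def evIso (a : I) : (G.glued hB cov).restr (hB a) ≅ G.M a :=
  isoOfBijective (G.evHom hB cov a) fun _ _ _ _ => G.ev_bijective a _ _

end Datum

end TwistedModule

open TwistedModule

theorem isStack_twistedStack (D : GluingData R) :
    (twistedStack D).IsStack (Opens.grothendieckTopology X) := by
  refine LinearPrestack.isStack_of (F := twistedStack D) ?_ ?_ ?_
  · intro V P Q φ ψ h
    exact TwistedModule.hom_ext_local φ ψ h
  · intro I V P Q B hB cov φ compat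
    refine TwistedModule.exists_hom_glue (M := P) (N := Q) B hB cov φ fun a b i W h h' hU m => ?_
    exact DFunLike.congr_fun (congrFun (congrFun (congrFun (congrFun (congrArg Hom.app
      (compat a b W h h')) i) W) le_rfl) hU) m
  · intro I V B hB cov P φ φ_res φ_self φ_comp
    -- the value of `φ a b W` on `W' ⊆ W` is the value of `φ a b W'`
    have nat : ∀ a b i W (h : W ≤ B a) (h' : W ≤ B b) W' (k : W' ≤ W) (hU : W' ≤ D.cov.U i) m,
        Hom.app (M := (P a : TwistedModule D (B a)).restr h)
          (N := (P b : TwistedModule D (B b)).restr h') (φ a b W h h') i W' k hU m =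
        Hom.app (M := (P a : TwistedModule D (B a)).restr (k.trans h))
          (N := (P b : TwistedModule D (B b)).restr (k.trans h'))
          (φ a b W' (k.trans h) (k.trans h')) i W' le_rfl hU m := by
      intro a b i W h h' W' k hU m
      exact DFunLike.congr_fun (congrFun (congrFun (congrFun (congrFun (congrArg Hom.app
        (φ_res a b W h h' W' k)) i) W') le_rfl) hU) m
    let G : Datum D B :=
      { M := P
        Φ := fun a b {i W} h h' hU => Hom.app (M := (P a : TwistedModule D (B a)).restr h)
          (N := (P b : TwistedModule D (B b)).restr h') (φ a b W h h') i W le_rfl hU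
        Φ_res := fun {a b i W W'} h h' hU k m =>
          (Hom.app_res (M := (P a : TwistedModule D (B a)).restr h)
            (N := (P b : TwistedModule D (B b)).restr h') (φ a b W h h') _ _ k m).symm.trans
            (nat a b i W h h' W' k _ _)
        Φ_act := fun {a b i W} h h' hU m x =>
          Hom.app_act (M := (P a : TwistedModule D (B a)).restr h)
            (N := (P b : TwistedModule D (B b)).restr h') (φ a b W h h') _ _ _ _
        Φ_tr := fun {a b i j W} h h' α hα m =>
          Hom.app_tr (M := (P a : TwistedModule D (B a)).restr h)
            (N := (P b : TwistedModule D (B b)).restr h') (φ a b W h h') _ _ _ _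
        Φ_self := fun {a i W} h hU m =>
          DFunLike.congr_fun (congrFun (congrFun (congrFun (congrFun (congrArg Hom.app
            (φ_self a W h)) i) W) le_rfl) hU) m
        Φ_comp := fun {a b c i W} h h' h'' hU m =>
          DFunLike.congr_fun (congrFun (congrFun (congrFun (congrFun (congrArg Hom.app
            (φ_comp a b c W h h' h'')) i) W) le_rfl) hU) m }
    refine ⟨G.glued hB cov, fun a => G.evIso hB cov a, fun a b W h h' => ?_⟩
    refine TwistedModule.hom_ext (M := ((G.glued hB cov).restr (hB a)).restr h)
      (N := (P b : TwistedModule D (B b)).restr h') fun i W' hV hU m => ?_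
    refine (nat a b i W h h' W' hV hU _).trans ?_
    exact m.2.2 a b ⟨W', le_rfl, hV.trans h⟩ (hV.trans h')

end

/-! ### Generators of twisted modules -/

section

variable {X : TopCat.{u}} {R : TopCat.Sheaf CommRingCat.{u} X}

namespace TwistedModule
variable {D : GluingData R} {V W W' : Opens X} {i j k : D.cov.ι} {M N : TwistedModule D V}

/-- If `tr α m = tr α' m'`, then `m` and `m'` are related by the multipliers which compare the
isomorphisms with indices `α` and `α'`. The converse is `tr_eq_of_act_as_eq`. -/
lemma act_as_eq_of_tr_eq {α α' : D.cov.κ i j} (hV : W ≤ V) (hα : W ≤ D.cov.O i j α)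
    (hα' : W ≤ D.cov.O i j α') {m m' : M.carrier i W hV (hα.trans (D.cov.O_le_left α))}
    (h : M.tr hV α hα m = M.tr hV α' hα' m') {γ : D.cov.κ j k} {δ : D.cov.κ i k}
    (hγ : W ≤ D.cov.O j k γ) (hδ : W ≤ D.cov.O i k δ) :
    M.act hV _ m (D.as α δ γ hα hδ hγ : D.S i W _) =
      M.act hV _ m' (D.as α' δ γ hα' hδ hγ : D.S i W _) := by
  refine (M.tr_bijective hV δ hδ).1 ?_
  rw [← M.tr_tr, h]
  exact M.tr_tr hV α' δ γ hα' hδ hγ m'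

lemma tr_eq_of_act_as_eq {α α' : D.cov.κ i j} (hV : W ≤ V) (hα : W ≤ D.cov.O i j α)
    (hα' : W ≤ D.cov.O i j α') {m m' : M.carrier i W hV (hα.trans (D.cov.O_le_left α))}
    {γ : D.cov.κ j k} {δ : D.cov.κ i k} (hγ : W ≤ D.cov.O j k γ) (hδ : W ≤ D.cov.O i k δ)
    (h : M.act hV _ m (D.as α δ γ hα hδ hγ : D.S i W _) =
      M.act hV _ m' (D.as α' δ γ hα' hδ hγ : D.S i W _)) :
    M.tr hV α hα m = M.tr hV α' hα' m' := by
  refine (M.tr_bijective hV γ hγ).1 ?_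
  rw [M.tr_tr hV α δ γ hα hδ hγ, h]
  exact (M.tr_tr hV α' δ γ hα' hδ hγ m').symm

lemma tr_self (hV : W ≤ V) (α : D.cov.κ i i) (hα : W ≤ D.cov.O i i α)
    (m : M.carrier i W hV (hα.trans (D.cov.O_le_left α))) :
    M.tr hV α hα m = M.act hV _ m (D.as α α α hα hα hα : D.S i W _) :=
  (M.tr_bijective hV α hα).1 (M.tr_tr hV α α α hα hα hα m)

/-- Over `V ⊆ U i`, a morphism of twisted modules is determined by its component at the index `i`,
because every section at another index is locally in the image of some `tr α`. -/
lemma hom_ext_at (hi : V ≤ D.cov.U i) (f g : M ⟶ N)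
    (h : ∀ W hV m, f.app i W hV (hV.trans hi) m = g.app i W hV (hV.trans hi) m) : f = g := by
  ext j W hV hU m
  refine N.ext_local _ _ _ _ fun x hx => ?_
  obtain ⟨α, hα⟩ := D.cov.exists_mem_O (hi (hV hx)) (hU hx)
  refine ⟨W ⊓ D.cov.O i j α, inf_le_left, ⟨hx, hα⟩, ?_⟩
  rw [← f.app_res, ← g.app_res]
  obtain ⟨m', hm'⟩ := (M.tr_bijective (inf_le_left.trans hV) α inf_le_right).2
    (M.res hV hU (inf_le_left : W ⊓ D.cov.O i j α ≤ W) m)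
  rw [← hm', f.app_tr _ α inf_le_right, g.app_tr _ α inf_le_right]
  exact congrArg _ (h _ _ m')

/-- Over `V ⊆ U i`, a morphism of the `A i`-modules at the index `i` extends to a morphism of
twisted modules: on `tr α m` it is `tr α (φ m)`, which does not depend on `α` by the cocycle condition. -/
theorem exists_hom_extend (hi : V ≤ D.cov.U i)
    (φ : ∀ W (hV : W ≤ V), M.carrier i W hV (hV.trans hi) →+ N.carrier i W hV (hV.trans hi))
    (φ_res : ∀ W hV W' (k : W' ≤ W) m, φ W' (k.trans hV) (M.res hV _ k m) = N.res hV _ k (φ W hV m))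
    (φ_act : ∀ W hV m x, φ W hV (M.act hV _ m x) = N.act hV _ (φ W hV m) x) :
    ∃ f : M ⟶ N, ∀ W hV m, f.app i W hV (hV.trans hi) m = φ W hV m := by
  -- the value `tr α (φ m)` depends only on `tr α m`
  have indep : ∀ j W hV (α α' : D.cov.κ i j) (hα : W ≤ D.cov.O i j α) (hα' : W ≤ D.cov.O i j α')
      m m', M.tr hV α hα m = M.tr hV α' hα' m' →
      N.tr hV α hα (φ W hV m) = N.tr hV α' hα' (φ W hV m') := by
    intro j W hV α α' hα hα' m m' h
    refine N.ext_local _ _ _ _ fun x hx => ?_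
    obtain ⟨γ, hγ⟩ := D.cov.exists_mem_O (D.cov.O_le_right α (hα hx)) (D.cov.O_le_right α (hα hx))
    refine ⟨W ⊓ D.cov.O j j γ, inf_le_left, ⟨hx, hγ⟩, ?_⟩
    have hl : W ⊓ D.cov.O j j γ ≤ W := inf_le_left
    rw [N.res_tr, N.res_tr]
    have h' := congrArg (M.res hV (hα.trans (D.cov.O_le_right α)) hl) h
    rw [M.res_tr, M.res_tr] at h'
    have h₂ := act_as_eq_of_tr_eq _ _ _ h' (γ := γ) (δ := α) inf_le_right (hl.trans hα)
    refine tr_eq_of_act_as_eq _ _ _ (γ := γ) (δ := α) inf_le_right (hl.trans hα) ?_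
    rw [← φ_res, ← φ_res, ← φ_act, ← φ_act, h₂]
  have key : ∀ j W hV hU (m : M.carrier j W hV hU), ∃ n : N.carrier j W hV hU,
      ∀ W' (l : W' ≤ W) (α : D.cov.κ i j) (hα : W' ≤ D.cov.O i j α) m',
        M.tr (l.trans hV) α hα m' = M.res hV hU l m →
        N.res hV hU l n = N.tr (l.trans hV) α hα (φ W' (l.trans hV) m') := by
    intro j W hV hU m
    obtain ⟨n, hn⟩ := N.exists_of_description hV hU
      (fun W' l s => ∃ (α : D.cov.κ i j) (hα : W' ≤ D.cov.O i j α), ∃ m',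
        M.tr (l.trans hV) α hα m' = M.res hV hU l m ∧ s = N.tr (l.trans hV) α hα (φ W' _ m'))
      (by
        rintro W' l s s' ⟨α, hα, m₁, e₁, rfl⟩ ⟨α', hα', m₂, e₂, rfl⟩
        exact indep _ _ _ _ _ _ _ _ _ (e₁.trans e₂.symm))
      (by
        rintro W' l s W'' l' ⟨α, hα, m₁, e₁, rfl⟩
        refine ⟨α, l'.trans hα, M.res _ _ l' m₁, ?_, ?_⟩
        · rw [← M.res_tr _ _ hα, e₁, M.res_res]
        · rw [φ_res, N.res_tr])
      (by
        intro x hx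
        obtain ⟨α, hα⟩ := D.cov.exists_mem_O (hi (hV hx)) (hU hx)
        obtain ⟨m', hm'⟩ := (M.tr_bijective (inf_le_left.trans hV) α inf_le_right).2
          (M.res hV hU (inf_le_left : W ⊓ D.cov.O i j α ≤ W) m)
        exact ⟨W ⊓ D.cov.O i j α, inf_le_left, _, ⟨hx, hα⟩, α, inf_le_right, m', hm', rfl⟩)
    exact ⟨n, fun W' l α hα m' h => hn W' l _ ⟨α, hα, m', h, rfl⟩⟩
  choose g hg using key
  -- two sections of `N j` agree as soon as they agree where sections come from `i`
  have loc : ∀ j W hV hU (m : M.carrier j W hV hU) (n n' : N.carrier j W hV hU),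
      (∀ W' (l : W' ≤ W) (α : D.cov.κ i j) (hα : W' ≤ D.cov.O i j α) m',
        M.tr (l.trans hV) α hα m' = M.res hV hU l m → N.res hV hU l n = N.res hV hU l n') →
      n = n' := by
    intro j W hV hU m n n' h
    refine N.ext_local _ _ _ _ fun x hx => ?_
    obtain ⟨α, hα⟩ := D.cov.exists_mem_O (hi (hV hx)) (hU hx)
    obtain ⟨m', hm'⟩ := (M.tr_bijective (inf_le_left.trans hV) α inf_le_right).2
      (M.res hV hU (inf_le_left : W ⊓ D.cov.O i j α ≤ W) m)
    exact ⟨W ⊓ D.cov.O i j α, inf_le_left, ⟨hx, hα⟩, h _ _ α inf_le_right m' hm'⟩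
  refine ⟨{ app := fun j W hV hU => AddMonoidHom.mk' (g j W hV hU) ?_
            app_res := ?_
            app_act := ?_
            app_tr := ?_ }, ?_⟩
  · intro m₁ m₂
    refine loc _ _ _ _ m₁ _ _ fun W' l α hα m' e => ?_
    obtain ⟨m'', e'⟩ := (M.tr_bijective (l.trans hV) α hα).2 (M.res hV hU l m₂)
    rw [map_add, hg _ _ _ _ _ _ _ _ _ _ e, hg _ _ _ _ _ _ _ _ _ _ e',
      hg _ _ _ _ _ _ l α hα (m' + m'') (by rw [map_add, map_add, e, e']), map_add, map_add]
  · intro j W W' hV hU l m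
    refine loc _ _ _ _ (M.res hV hU l m) _ _ fun W'' l' α hα m' e => ?_
    change N.res _ _ l' (g _ _ _ _ _) = N.res _ _ l' (N.res _ _ l (g _ _ _ _ _))
    rw [hg _ _ _ _ _ _ _ _ _ _ e, N.res_res]
    rw [M.res_res] at e
    rw [hg _ _ _ _ _ _ _ _ _ _ e]
  · intro j W hV hU m x
    refine loc _ _ _ _ m _ _ fun W' l α hα m' e => ?_
    change N.res _ _ l (g _ _ _ _ _) = N.res _ _ l (N.act _ _ (g _ _ _ _ _) x)
    rw [N.res_act, hg _ _ _ _ _ _ _ _ _ _ e, hg _ _ _ _ _ _ l α hα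
      (M.act _ _ m' (D.fs α hα ((D.A j).res hU l x))) (by rw [M.tr_act, e, M.res_act]), φ_act,
      N.tr_act]
  · intro j k W hV β hβ m
    refine loc _ _ _ _ (M.tr hV β hβ m) _ _ fun W' l δ hδ m' e => ?_
    change N.res _ _ l (g _ _ _ _ _) = N.res _ _ l (N.tr _ _ _ (g _ _ _ _ _))
    rw [hg _ _ _ _ _ _ _ _ _ _ e, N.res_tr]
    refine N.ext_local _ _ _ _ fun x hx => ?_
    obtain ⟨α, hα⟩ := D.cov.exists_mem_O (hi (hV (l hx))) (D.cov.O_le_left β (hβ (l hx)))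
    have hl : W' ⊓ D.cov.O i j α ≤ W' := inf_le_left
    refine ⟨W' ⊓ D.cov.O i j α, hl, ⟨hx, hα⟩, ?_⟩
    obtain ⟨m₀, e₀⟩ := (M.tr_bijective ((hl.trans l).trans hV) α inf_le_right).2
      (M.res hV (hβ.trans (D.cov.O_le_left β)) (hl.trans l) m)
    rw [N.res_tr, N.res_tr, N.res_res, hg _ _ _ _ _ _ _ _ _ _ e₀,
      N.tr_tr _ α δ β inf_le_right (hl.trans hδ) ((hl.trans l).trans hβ), ← φ_res, ← φ_act]
    congr 2
    refine (M.tr_bijective _ δ (hl.trans hδ)).1 ?_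
    have e' := congrArg (M.res (l.trans hV) (hδ.trans (D.cov.O_le_right δ)) hl) e
    rw [M.res_tr, M.res_res, M.res_tr] at e'
    rw [← M.tr_tr _ α δ β inf_le_right (hl.trans hδ) ((hl.trans l).trans hβ), e₀, e']
  · intro W hV m
    refine loc _ _ _ _ m _ _ fun W' l α hα m' e => ?_
    change N.res _ _ l (g _ _ _ _ _) = _
    rw [hg _ _ _ _ _ _ _ _ _ _ e, tr_self, ← φ_act, ← tr_self, e, φ_res]

/-- `e` is a basis of the component of `M` at the index `i`. -/
def IsGenerator (M : TwistedModule D V) (hi : V ≤ D.cov.U i) (e : M.carrier i V le_rfl hi) : Prop :=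
  ∀ W (k : W ≤ V), Function.Bijective fun a => M.act k (k.trans hi) (M.res le_rfl hi k e) a

lemma IsGenerator.restr {hi : V ≤ D.cov.U i} {e : M.carrier i V le_rfl hi} (h : M.IsGenerator hi e)
    (k : W ≤ V) : (M.restr k).IsGenerator (k.trans hi) (M.res le_rfl hi k e) := by
  intro W' k'
  have := h W' (k'.trans k)
  rw [← M.res_res le_rfl hi k k'] at this
  exact this

/-- A morphism out of a twisted module with a generator is determined by the image of the generator,
which can be any section. -/
theorem IsGenerator.bijective {hi : V ≤ D.cov.U i} {e : M.carrier i V le_rfl hi}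
    (h : M.IsGenerator hi e) (N : TwistedModule D V) :
    Function.Bijective fun f : M ⟶ N => f.app i V le_rfl hi e := by
  constructor
  · intro f g hfg
    refine hom_ext_at hi _ _ fun W hV m => ?_
    obtain ⟨x, rfl⟩ := (h W hV).2 m
    change f.app _ _ _ _ (M.act _ _ _ _) = g.app _ _ _ _ (M.act _ _ _ _)
    rw [f.app_act, g.app_act, f.app_res, g.app_res]
    exact congrArg (fun n => N.act _ _ (N.res _ _ _ n) x) hfg
  · intro n
    let c (W) (k : W ≤ V) : D.S i W (k.trans hi) ≃+ M.carrier i W k (k.trans hi) :=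
      AddEquiv.ofBijective (M.act k (k.trans hi) (M.res le_rfl hi k e)) (h W k)
    have hc (W k m) : M.act k (k.trans hi) (M.res le_rfl hi k e) ((c W k).symm m) = m :=
      (c W k).apply_symm_apply m
    obtain ⟨f, hf⟩ := exists_hom_extend (M := M) (N := N) hi
      (fun W k => (N.act k (k.trans hi) (N.res le_rfl hi k n)).comp (c W k).symm.toAddMonoidHom)
      (fun W k W' l m => by
        have : (c W' (l.trans k)).symm (M.res k _ l m) = (D.A i).res _ l ((c W k).symm m) := by
          refine (h W' (l.trans k)).1 ((hc _ _ _).trans ?_)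
          conv_lhs => rw [← hc W k m, M.res_act, M.res_res]
        refine (congrArg (fun x => N.act _ _ _ x) this).trans ?_
        refine Eq.trans ?_ (N.res_act _ _ l _ _).symm
        rw [N.res_res]
        rfl)
      (fun W k m x => by
        have : (c W k).symm (M.act k _ m x) = (c W k).symm m * x := by
          refine (h W k).1 ((hc _ _ _).trans ?_)
          change _ = M.act _ _ _ _
          rw [M.act_mul, hc]
        refine (congrArg (fun x => N.act _ _ _ x) this).trans (N.act_mul _ _ _ _ _))
    refine ⟨f, (hf _ _ _).trans ?_⟩
    have : (c V le_rfl).symm e = 1 := by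
      refine (h V le_rfl).1 ((hc _ _ _).trans ?_)
      change _ = M.act _ _ _ _
      rw [M.act_one, M.res_refl]
    refine (congrArg (fun x => N.act _ _ _ x) this).trans ?_
    rw [N.act_one, N.res_refl]

theorem IsGenerator.exists_iso {hi : V ≤ D.cov.U i} {e : M.carrier i V le_rfl hi}
    (h : M.IsGenerator hi e) {e' : N.carrier i V le_rfl hi} (h' : N.IsGenerator hi e') :
    ∃ f : M ≅ N, Hom.app f.hom i V le_rfl hi e = e' := by
  obtain ⟨f, hf⟩ := (h.bijective N).2 e'
  obtain ⟨g, hg⟩ := (h'.bijective M).2 e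
  refine ⟨⟨f, g, (h.bijective M).1 ?_, (h'.bijective N).1 ?_⟩, hf⟩
  · exact (congrArg _ hf).trans hg
  · exact (congrArg _ hg).trans hf

theorem IsGenerator.nonempty_iso {hi : V ≤ D.cov.U i} {e : M.carrier i V le_rfl hi}
    (h : M.IsGenerator hi e) {e' : N.carrier i V le_rfl hi} (h' : N.IsGenerator hi e') :
    Nonempty (M ≅ N) :=
  ⟨(h.exists_iso h').choose⟩

/-- The transport of a generator to another index is a generator. -/
lemma IsGenerator.tr {hi : V ≤ D.cov.U i} {e : M.carrier i V le_rfl hi} (h : M.IsGenerator hi e)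
    (α : D.cov.κ i j) (hα : V ≤ D.cov.O i j α) :
    M.IsGenerator (hα.trans (D.cov.O_le_right α)) (M.tr le_rfl α hα e) := by
  intro W k
  have : (fun a => M.act k _ (M.res le_rfl _ k (M.tr le_rfl α hα e)) a) ∘ id =
      M.tr k α (k.trans hα) ∘ (fun a => M.act k _ (M.res le_rfl hi k e) a) ∘
        D.fs α (k.trans hα) := by
    funext a
    simp only [Function.comp_apply]
    rw [M.tr_act, M.res_tr]
    rfl
  exact (congrArg Function.Bijective this).mpr
    ((M.tr_bijective _ _ _).comp ((h W k).comp (D.fs_bijective _)))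

/-- Near a point of `U i`, a twisted module has a generator at the index `i`: transport to the
index `i` a local basis at some other index. -/
lemma exists_isGenerator (M : TwistedModule D V) (x : X) (hx : x ∈ V) (hi : x ∈ D.cov.U i) :
    ∃ (W : Opens X) (k : W ≤ V) (hW : W ≤ D.cov.U i) (e : M.carrier i W k hW), x ∈ W ∧
      (M.restr k).IsGenerator hW e := by
  obtain ⟨j, W, hV, hU, m, hxW, hm⟩ := M.locally_free x hx
  obtain ⟨α, hα⟩ := D.cov.exists_mem_O (hU hxW) hi
  have h : (M.restr hV).IsGenerator hU m := hm
  exact ⟨W ⊓ D.cov.O j i α, inf_le_left.trans hV, inf_le_right.trans (D.cov.O_le_right α), _,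
    ⟨hxW, hα⟩, (h.restr (inf_le_left : W ⊓ D.cov.O j i α ≤ W)).tr α inf_le_right⟩

end TwistedModule

end

/-! ### Free twisted modules -/

section

variable {X : TopCat.{u}} {R : TopCat.Sheaf CommRingCat.{u} X}

namespace GluingData
variable (D : GluingData R) {i j k l : D.cov.ι} {V W W' : Opens X}

/-- The multiplier `a α δ δ` depends only on `α`. It describes the automorphism of an object at the
index `i` given by the isomorphism with index `α : κ i i`. -/
lemma as_self (α : D.cov.κ i i) (δ : D.cov.κ i k) (hα : V ≤ D.cov.O i i α)
    (hδ : V ≤ D.cov.O i k δ) : D.as α δ δ hα hδ hδ = D.as α α α hα hα hα := by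
  have key : ∀ {k} (δ : D.cov.κ i k) (hδ : V ≤ D.cov.O i k δ),
      D.fs α hα (D.as α δ δ hα hδ hδ : D.S i V _) = (D.as α α α hα hα hα : D.S i V _) := by
    intro k δ hδ
    have := D.as_mul_as hα hα hα hδ hδ hδ
    exact ((D.as α δ δ hα hδ hδ).isUnit.mul_left_inj.1 this).symm
  refine Units.ext ((D.fs_bijective hα).1 ((key δ hδ).trans (key α hα).symm))

lemma fs_mul_as_self (α : D.cov.κ i i) (hα : V ≤ D.cov.O i i α) (y : D.S i V _) :
    D.fs α hα y * D.as α α α hα hα hα = D.as α α α hα hα hα * y := by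
  obtain ⟨x, rfl⟩ := (D.fs_bijective hα).2 y
  exact D.fs_fs hα hα hα x

lemma fs_mul_as (α : D.cov.κ i j) (δ : D.cov.κ i k) (γ : D.cov.κ j k) (hα : V ≤ D.cov.O i j α)
    (hδ : V ≤ D.cov.O i k δ) (hγ : V ≤ D.cov.O j k γ) (s s' : D.S i V _) (α' : D.cov.κ i j)
    (hα' : V ≤ D.cov.O i j α') (x : D.S j V _)
    (h : s * D.as α δ γ hα hδ hγ = s' * D.as α' δ γ hα' hδ hγ) :
    s * D.fs α hα x * D.as α δ γ hα hδ hγ = s' * D.fs α' hα' x * D.as α' δ γ hα' hδ hγ := by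
  obtain ⟨z, rfl⟩ := (D.fs_bijective hγ).2 x
  rw [mul_assoc, D.fs_fs, ← mul_assoc, h, mul_assoc, ← D.fs_fs, mul_assoc]

end GluingData

namespace FreeModule
variable (D : GluingData R) (i : D.cov.ι) {j k l : D.cov.ι} {V W W' : Opens X}

/-- The sections over `W` at the index `j` of the free module with a generator `e` at the index `i`.
Such a section `m` is encoded by the family of the sections `s α` of `A i` with
`m = tr α (e * s α)`, on all open subsets of `W ∩ O i j α`. The elements `s α` and `s α'` describe
the same section if and only if `s α * a α δ γ = s α' * a α' δ γ` for all `γ` and `δ`. -/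
def comp (j : D.cov.ι) (W : Opens X) (hi : W ≤ D.cov.U i) : AddSubgroup
    (∀ (α : D.cov.κ i j) (p : {W' : Opens X // W' ≤ W ∧ W' ≤ D.cov.O i j α}),
      D.S i p.1 (p.2.1.trans hi)) where
  carrier := { s | (∀ α p W'' (k' : W'' ≤ p.1), (D.A i).res (p.2.1.trans hi) k' (s α p) =
      s α ⟨W'', k'.trans p.2.1, k'.trans p.2.2⟩) ∧
    (∀ α α' p (hα' : p.1 ≤ D.cov.O i j α') k (γ : D.cov.κ j k) (δ : D.cov.κ i k)
      (hγ : p.1 ≤ D.cov.O j k γ) (hδ : p.1 ≤ D.cov.O i k δ),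
      s α p * (D.as α δ γ p.2.2 hδ hγ).val =
        s α' ⟨p.1, p.2.1, hα'⟩ * (D.as α' δ γ hα' hδ hγ).val) }
  add_mem' := by
    rintro m m' ⟨h₁, h₂⟩ ⟨h₁', h₂'⟩
    constructor
    · intros
      simp only [Pi.add_apply, map_add]
      rw [h₁, h₁']
    · intro α α' p hα' k γ δ hγ hδ
      simp only [Pi.add_apply, add_mul]
      rw [h₂ α α' p hα', h₂' α α' p hα']
  zero_mem' := by simp
  neg_mem' := by
    rintro m ⟨h₁, h₂⟩
    constructor
    · intros
      simp only [Pi.neg_apply, map_neg]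
      rw [h₁]
    · intro α α' p hα' k γ δ hγ hδ
      simp only [Pi.neg_apply, neg_mul]
      rw [h₂ α α' p hα']

variable {D i}

/-- The member of the family `s` with index `α` over `W'`. -/
def sec {hi : W ≤ D.cov.U i} (s : comp D i j W hi) (α : D.cov.κ i j) (W' : Opens X) (l : W' ≤ W)
    (hα : W' ≤ D.cov.O i j α) : D.S i W' (l.trans hi) :=
  s.1 α ⟨W', l, hα⟩

lemma res_sec {hi : W ≤ D.cov.U i} (s : comp D i j W hi) {α : D.cov.κ i j} {W' W'' : Opens X}
    (l : W' ≤ W) (hα : W' ≤ D.cov.O i j α) (l' : W'' ≤ W') :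
    (D.A i).res (l.trans hi) l' (sec s α W' l hα) = sec s α W'' (l'.trans l) (l'.trans hα) :=
  s.2.1 α ⟨W', l, hα⟩ W'' l'

lemma sec_mul_as {hi : W ≤ D.cov.U i} (s : comp D i j W hi) {α : D.cov.κ i j} (α' : D.cov.κ i j)
    (l : W' ≤ W) (hα : W' ≤ D.cov.O i j α) (hα' : W' ≤ D.cov.O i j α') {γ : D.cov.κ j k}
    {δ : D.cov.κ i k} (hγ : W' ≤ D.cov.O j k γ) (hδ : W' ≤ D.cov.O i k δ) :
    sec s α W' l hα * (D.as α δ γ hα hδ hγ).val = sec s α' W' l hα' * (D.as α' δ γ hα' hδ hγ).val :=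
  s.2.2 α α' ⟨W', l, hα⟩ hα' k γ δ hγ hδ

/-- An element of `comp` from a family of sections. -/
def mk {hi : W ≤ D.cov.U i} (s : ∀ (α : D.cov.κ i j) (W' : Opens X) (l : W' ≤ W)
      (_ : W' ≤ D.cov.O i j α), D.S i W' (l.trans hi))
    (hs : ∀ α W' l hα W'' (l' : W'' ≤ W'), (D.A i).res (l.trans hi) l' (s α W' l hα) =
      s α W'' (l'.trans l) (l'.trans hα))
    (hs' : ∀ α α' W' l hα hα' k (γ : D.cov.κ j k) (δ : D.cov.κ i k) (hγ : W' ≤ D.cov.O j k γ)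
      (hδ : W' ≤ D.cov.O i k δ), s α W' l hα * (D.as α δ γ hα hδ hγ).val =
        s α' W' l hα' * (D.as α' δ γ hα' hδ hγ).val) : comp D i j W hi :=
  ⟨fun α p => s α p.1 p.2.1 p.2.2, fun α p => hs α p.1 p.2.1 p.2.2,
    fun α α' p => hs' α α' p.1 p.2.1 p.2.2⟩

lemma comp_ext {hi : W ≤ D.cov.U i} {s s' : comp D i j W hi}
    (h : ∀ α W' l hα, sec s α W' l hα = sec s' α W' l hα) : s = s' :=
  Subtype.ext (by funext α p; exact h α p.1 p.2.1 p.2.2)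

/-- Restriction of families. -/
def res (hi : W ≤ D.cov.U i) (k : W' ≤ W) : comp D i j W hi →+ comp D i j W' (k.trans hi) where
  toFun s := mk (fun α W' l hα => sec s α W' (l.trans k) hα) (fun _ _ _ _ _ _ => res_sec _ _ _ _)
    (fun _ _ _ _ _ _ _ _ _ _ _ => sec_mul_as _ _ _ _ _ _ _)
  map_zero' := rfl
  map_add' _ _ := rfl

lemma sec_res (hi : W ≤ D.cov.U i) (k : W' ≤ W) (s : comp D i j W hi) (α W'') (l : W'' ≤ W') (hα) :
    sec (res hi k s) α W'' l hα = sec s α W'' (l.trans k) hα := rfl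

/-- The action of a section of `A j`, from `tr α (e * s α) * x = tr α (e * s α * f α x)`. -/
def actAux (hi : W ≤ D.cov.U i) (hj : W ≤ D.cov.U j) (s : comp D i j W hi) (x : D.S j W hj) :
    comp D i j W hi :=
  mk (fun α W' l hα => sec s α W' l hα * D.fs α hα ((D.A j).res hj l x))
    (fun α W' l hα W'' l' => by rw [map_mul, res_sec, D.res_fs, AlgebraOn.res_res])
    (fun α α' W' l hα hα' k γ δ hγ hδ =>
      D.fs_mul_as _ _ _ _ _ _ _ _ _ _ _ (sec_mul_as s α' l hα hα' hγ hδ))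

/-- The action of `A j` on families. -/
def act (hi : W ≤ D.cov.U i) (hj : W ≤ D.cov.U j) :
    comp D i j W hi →+ D.S j W hj →+ comp D i j W hi :=
  AddMonoidHom.mk' (fun s => AddMonoidHom.mk' (fun x => actAux hi hj s x)
    (fun x y => comp_ext fun α W' l hα => by
      change sec s α W' l hα * _ = sec s α W' l hα * _ + sec s α W' l hα * _
      rw [map_add, map_add, mul_add]))
    (fun m m' => by
      ext x : 1
      exact comp_ext fun α W' l hα => add_mul _ _ _)

lemma sec_act (hi : W ≤ D.cov.U i) (hj : W ≤ D.cov.U j) (s : comp D i j W hi) (x : D.S j W hj)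
    (α W') (l : W' ≤ W) (hα) : sec (act hi hj s x) α W' l hα =
      sec s α W' l hα * D.fs α hα ((D.A j).res hj l x) := rfl

/-- Sections of `A i` over `W ⊆ U i ∩ U j` can be compared on the open subsets `O i j α`. -/
lemma ext_at (hi : W ≤ D.cov.U i) (hj : W ≤ D.cov.U j) (x y : D.S i W hi)
    (h : ∀ W' (l : W' ≤ W) (α : D.cov.κ i j) (_ : W' ≤ D.cov.O i j α),
      (D.A i).res hi l x = (D.A i).res hi l y) : x = y := by
  refine (D.A i).isOpenSheaf.ext _ _ _ fun z hz => ?_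
  obtain ⟨α, hα⟩ := D.cov.exists_mem_O (hi hz) (hj hz)
  exact ⟨W ⊓ D.cov.O i j α, inf_le_left, ⟨hz, hα⟩, h _ _ α inf_le_right⟩

/-- Sections of `A i` over `W ⊆ U i ∩ U j` can be glued from the open subsets `O i j α`. -/
lemma glue_at (hi : W ≤ D.cov.U i) (hj : W ≤ D.cov.U j)
    (P : ∀ (W' : Opens X) (l : W' ≤ W), D.S i W' (l.trans hi) → Prop)
    (hu : ∀ W' l s s', P W' l s → P W' l s' → s = s')
    (hr : ∀ W' l s W'' (l' : W'' ≤ W'), P W' l s → P W'' (l'.trans l) ((D.A i).res _ l' s))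
    (hl : ∀ W' (l : W' ≤ W) (α : D.cov.κ i j) (_ : W' ≤ D.cov.O i j α), ∃ s, P W' l s) :
    ∃ t, ∀ W' l s, P W' l s → (D.A i).res hi l t = s :=
  (D.A i).isOpenSheaf.exists_of_description hi P hu hr fun x hx => by
    obtain ⟨α, hα⟩ := D.cov.exists_mem_O (hi hx) (hj hx)
    obtain ⟨s, hs⟩ := hl (W ⊓ D.cov.O i j α) inf_le_left α inf_le_right
    exact ⟨_, _, s, ⟨hx, hα⟩, hs⟩

/-- The transport is given by `tr γ (tr α (e * s α)) = tr δ (e * s α * a α δ γ)`. -/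
lemma exists_tr (hi : W ≤ D.cov.U i) (γ : D.cov.κ j k) (hγ : W ≤ D.cov.O j k γ)
    (s : comp D i j W hi) : ∃ t : comp D i k W hi, ∀ δ W' l hδ α (hα : W' ≤ D.cov.O i j α),
      sec t δ W' l hδ = sec s α W' l hα * (D.as α δ γ hα hδ (l.trans hγ)).val := by
  have hj := hγ.trans (D.cov.O_le_left γ)
  have key : ∀ δ W₁ (l₁ : W₁ ≤ W) (hδ : W₁ ≤ D.cov.O i k δ), ∃ t : D.S i W₁ (l₁.trans hi),
      ∀ W' (l : W' ≤ W₁) α (hα : W' ≤ D.cov.O i j α), (D.A i).res (l₁.trans hi) l t =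
        sec s α W' (l.trans l₁) hα *
          (D.as α δ γ hα (l.trans hδ) ((l.trans l₁).trans hγ)).val := by
    intro δ W₁ l₁ hδ
    obtain ⟨t, ht⟩ := glue_at (l₁.trans hi) (l₁.trans hj)
      (fun W' l t => ∃ (α : D.cov.κ i j) (hα : W' ≤ D.cov.O i j α),
        t = sec s α W' (l.trans l₁) hα *
          (D.as α δ γ hα (l.trans hδ) ((l.trans l₁).trans hγ)).val)
      (by
        rintro W' l t t' ⟨α, hα, rfl⟩ ⟨α', hα', rfl⟩
        exact sec_mul_as s _ _ _ _ _ _)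
      (by
        rintro W' l t W'' l' ⟨α, hα, rfl⟩
        refine ⟨α, l'.trans hα, ?_⟩
        rw [map_mul, D.res_as, res_sec])
      (fun W' l α hα => ⟨_, α, hα, rfl⟩)
    exact ⟨t, fun W' l α hα => ht W' l _ ⟨α, hα, rfl⟩⟩
  choose t ht using key
  refine ⟨mk t ?_ ?_, ?_⟩
  · intro δ W₁ l₁ hδ W₂ l
    refine ext_at (j := j) _ ((l.trans l₁).trans hj) _ _ fun W' l' α hα => ?_
    rw [AlgebraOn.res_res, ht _ _ _ _ _ _ α hα, ht _ _ _ _ _ _ α hα]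
  · intro δ δ' W₁ l₁ hδ hδ' m ε φ hε hφ
    refine (D.A i).isOpenSheaf.ext _ _ _ fun x hx => ?_
    obtain ⟨α, hα⟩ := D.cov.exists_mem_O (hi (l₁ hx)) (hj (l₁ hx))
    obtain ⟨η, hη⟩ := D.cov.exists_mem_O (hj (l₁ hx)) (D.cov.O_le_right ε (hε hx))
    have l : W₁ ⊓ D.cov.O i j α ⊓ D.cov.O j m η ≤ W₁ := inf_le_left.trans inf_le_left
    have hα' : W₁ ⊓ D.cov.O i j α ⊓ D.cov.O j m η ≤ D.cov.O i j α :=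
      inf_le_left.trans inf_le_right
    have hη' : W₁ ⊓ D.cov.O i j α ⊓ D.cov.O j m η ≤ D.cov.O j m η := inf_le_right
    refine ⟨_, l, ⟨⟨hx, hα⟩, hη⟩, ?_⟩
    rw [map_mul, map_mul, ht δ _ _ hδ _ _ α hα', ht δ' _ _ hδ' _ _ α hα', D.res_as, D.res_as,
      mul_assoc, mul_assoc, D.as_mul_as hα' (l.trans hδ) ((l.trans l₁).trans hγ) (l.trans hφ) hη'
        (l.trans hε), D.as_mul_as hα' (l.trans hδ') ((l.trans l₁).trans hγ) (l.trans hφ) hη'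
        (l.trans hε)]
  · intro δ W' l hδ α hα
    have := ht δ W' l hδ W' le_rfl α hα
    rwa [AlgebraOn.res_refl] at this

/-- The members of a family at the index `k` can be compared on the open subsets `O i j α`. -/
lemma comp_ext_at {hi : W ≤ D.cov.U i} (hj : W ≤ D.cov.U j) {t t' : comp D i k W hi}
    (h : ∀ δ W' l hδ α (_ : W' ≤ D.cov.O i j α), sec t δ W' l hδ = sec t' δ W' l hδ) : t = t' := by
  refine comp_ext fun δ W₁ l₁ hδ => ext_at (j := j) _ (l₁.trans hj) _ _ fun W' l α hα => ?_
  rw [res_sec, res_sec]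
  exact h _ _ _ _ α hα

/-- The transport of families from the index `j` to the index `k`. -/
noncomputable def tr (hi : W ≤ D.cov.U i) (γ : D.cov.κ j k) (hγ : W ≤ D.cov.O j k γ) :
    comp D i j W hi →+ comp D i k W hi :=
  AddMonoidHom.mk' (fun s => (exists_tr hi γ hγ s).choose) fun s s' =>
    comp_ext_at (hγ.trans (D.cov.O_le_left γ)) fun δ W' l hδ α hα => by
      rw [(exists_tr hi γ hγ (s + s')).choose_spec δ W' l hδ α hα]
      change _ = sec (exists_tr hi γ hγ s).choose δ W' l hδ +
        sec (exists_tr hi γ hγ s').choose δ W' l hδ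
      rw [(exists_tr hi γ hγ s).choose_spec δ W' l hδ α hα,
        (exists_tr hi γ hγ s').choose_spec δ W' l hδ α hα]
      exact add_mul _ _ _

lemma sec_tr (hi : W ≤ D.cov.U i) (γ : D.cov.κ j k) (hγ : W ≤ D.cov.O j k γ) (s : comp D i j W hi)
    (δ W') (l : W' ≤ W) (hδ) (α) (hα : W' ≤ D.cov.O i j α) : sec (tr hi γ hγ s) δ W' l hδ =
      sec s α W' l hα * (D.as α δ γ hα hδ (l.trans hγ)).val :=
  (exists_tr hi γ hγ s).choose_spec δ W' l hδ α hα

lemma tr_bijective (hi : W ≤ D.cov.U i) (γ : D.cov.κ j k) (hγ : W ≤ D.cov.O j k γ) :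
    Function.Bijective (tr hi γ hγ) := by
  have hk := hγ.trans (D.cov.O_le_right γ)
  have hj := hγ.trans (D.cov.O_le_left γ)
  constructor
  · intro s s' h
    refine comp_ext_at hk fun α W' l hα δ hδ => ?_
    have e : sec (tr hi γ hγ s) δ W' l hδ = sec (tr hi γ hγ s') δ W' l hδ := by rw [h]
    rw [sec_tr _ _ _ _ _ _ _ _ α hα, sec_tr _ _ _ _ _ _ _ _ α hα] at e
    exact (Units.isUnit _).mul_left_inj.1 e
  · intro t
    have key : ∀ α W₁ (l₁ : W₁ ≤ W) (hα : W₁ ≤ D.cov.O i j α), ∃ s : D.S i W₁ (l₁.trans hi),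
        ∀ W' (l : W' ≤ W₁) δ (hδ : W' ≤ D.cov.O i k δ), (D.A i).res (l₁.trans hi) l s *
          (D.as α δ γ (l.trans hα) hδ ((l.trans l₁).trans hγ)).val =
          sec t δ W' (l.trans l₁) hδ := by
      intro α W₁ l₁ hα
      obtain ⟨s, hs⟩ := glue_at (l₁.trans hi) (l₁.trans hk)
        (fun W' l s => ∃ (δ : D.cov.κ i k) (hδ : W' ≤ D.cov.O i k δ),
          s * (D.as α δ γ (l.trans hα) hδ ((l.trans l₁).trans hγ)).val =
            sec t δ W' (l.trans l₁) hδ)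
        (by
          rintro W' l s s' ⟨δ, hδ, e⟩ ⟨δ', hδ', e'⟩
          refine (D.A i).isOpenSheaf.ext _ _ _ fun x hx => ?_
          obtain ⟨ε, hε⟩ := D.cov.exists_mem_O (hk (l₁ (l hx))) (hk (l₁ (l hx)))
          obtain ⟨η, hη⟩ := D.cov.exists_mem_O (hj (l₁ (l hx))) (hk (l₁ (l hx)))
          have l' : W' ⊓ D.cov.O k k ε ⊓ D.cov.O j k η ≤ W' := inf_le_left.trans inf_le_left
          have hε' : W' ⊓ D.cov.O k k ε ⊓ D.cov.O j k η ≤ D.cov.O k k ε :=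
            inf_le_left.trans inf_le_right
          have hη' : W' ⊓ D.cov.O k k ε ⊓ D.cov.O j k η ≤ D.cov.O j k η := inf_le_right
          refine ⟨_, l', ⟨⟨hx, hε⟩, hη⟩, ?_⟩
          have e₁ := congrArg ((D.A i).res ((l.trans l₁).trans hi) l') e
          have e₂ := congrArg ((D.A i).res ((l.trans l₁).trans hi) l') e'
          rw [map_mul, D.res_as, res_sec] at e₁ e₂
          have e₃ := sec_mul_as t δ' ((l'.trans l).trans l₁) (l'.trans hδ) (l'.trans hδ') hε'
            (l'.trans hδ)
          rw [← e₁, ← e₂, mul_assoc, mul_assoc,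
            D.as_mul_as ((l'.trans l).trans hα) (l'.trans hδ)
              (((l'.trans l).trans l₁).trans hγ) (l'.trans hδ) hη' hε',
            D.as_mul_as ((l'.trans l).trans hα) (l'.trans hδ')
              (((l'.trans l).trans l₁).trans hγ) (l'.trans hδ) hη' hε'] at e₃
          exact (((Units.isUnit _).map _).mul (Units.isUnit _)).mul_left_inj.1 e₃)
        (by
          rintro W' l s W'' l' ⟨δ, hδ, e⟩
          refine ⟨δ, l'.trans hδ, ?_⟩
          have e₁ := congrArg ((D.A i).res ((l.trans l₁).trans hi) l') e
          rwa [map_mul, D.res_as, res_sec] at e₁)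
        (fun W' l δ hδ => ⟨_, δ, hδ, Units.inv_mul_cancel_right _ _⟩)
      refine ⟨s, fun W' l δ hδ => ?_⟩
      rw [hs W' l _ ⟨δ, hδ, Units.inv_mul_cancel_right _ _⟩]
      exact Units.inv_mul_cancel_right _ _
    choose s hs using key
    refine ⟨mk s ?_ ?_, ?_⟩
    · intro α W₁ l₁ hα W'' l
      refine ext_at (j := k) _ ((l.trans l₁).trans hk) _ _ fun W' l' δ hδ => ?_
      rw [AlgebraOn.res_res]
      refine (D.as α δ γ ((l'.trans l).trans hα) hδ
        (((l'.trans l).trans l₁).trans hγ)).isUnit.mul_left_inj.1 ?_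
      exact (hs α _ l₁ hα W' (l'.trans l) δ hδ).trans
        (hs α W'' (l.trans l₁) (l.trans hα) W' l' δ hδ).symm
    · intro α α' W₁ l₁ hα hα' m ε φ hε hφ
      refine ext_at (j := k) _ (l₁.trans hk) _ _ fun W' l δ hδ => ?_
      rw [map_mul, map_mul, D.res_as, D.res_as]
      refine D.mul_as_eq_of α' (l.trans hα) (l.trans hα') hδ ((l.trans l₁).trans hγ)
        (l.trans hφ) (l.trans hε) _ _ ?_
      exact (hs α _ l₁ hα W' l δ hδ).trans (hs α' _ l₁ hα' W' l δ hδ).symm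
    · refine comp_ext_at hj fun δ W' l hδ α hα => ?_
      rw [sec_tr _ _ _ _ _ _ _ _ α hα]
      have := hs α W' l hα W' le_rfl δ hδ
      rwa [AlgebraOn.res_refl] at this

lemma isOpenSheaf (V : Opens X) (hV : V ≤ D.cov.U i) (j : D.cov.ι) :
    IsOpenSheaf (U := V ⊓ D.cov.U j)
      (fun W h => comp D i j W ((h.trans inf_le_left).trans hV)) (fun _ k m => res _ k m) where
  res_refl := fun h t => rfl
  res_res := fun h k k' t => rfl
  ext := by
    intro W h t t' hl
    refine comp_ext fun α W' l hα => (D.A i).isOpenSheaf.ext _ _ _ fun x hx => ?_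
    obtain ⟨W₁, l₁, hx', e⟩ := hl x (l hx)
    refine ⟨W' ⊓ W₁, inf_le_left, ⟨hx, hx'⟩, ?_⟩
    rw [res_sec, res_sec]
    exact congrArg (fun m => sec m α (W' ⊓ W₁) inf_le_right (inf_le_left.trans hα)) e
  glue := by
    intro W h B mem l s compat
    have hi := (h.trans inf_le_left).trans hV
    have key : ∀ α W' (k : W' ≤ W) (hα : W' ≤ D.cov.O i j α), ∃ m : D.S i W' (k.trans hi),
        ∀ W'' (k' : W'' ≤ W') x (hx : W'' ≤ B x),
        (D.A i).res _ k' m = sec (s x) α W'' hx (k'.trans hα) := by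
      intro α W' k hα
      obtain ⟨m, hm⟩ := (D.A i).isOpenSheaf.exists_of_description (k.trans hi)
        (fun W'' k' t => ∃ x, ∃ hx : W'' ≤ B x, t = sec (s x) α W'' hx (k'.trans hα))
        (by
          rintro W'' k' t t' ⟨x, hx, rfl⟩ ⟨y, hy, rfl⟩
          exact congrArg (fun m => sec m α W'' le_rfl (k'.trans hα)) (compat x y W'' hx hy))
        (by
          rintro W'' k' t W₃ k₃ ⟨x, hx, rfl⟩
          exact ⟨x, k₃.trans hx, res_sec _ _ _ _⟩)
        (by
          intro x hx
          exact ⟨W' ⊓ B ⟨x, k hx⟩, inf_le_left, _, ⟨hx, mem ⟨x, k hx⟩⟩, ⟨x, k hx⟩,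
            inf_le_right, rfl⟩)
      exact ⟨m, fun W'' k' x hx => hm W'' k' _ ⟨x, hx, rfl⟩⟩
    choose m hm using key
    refine ⟨mk m ?_ ?_, ?_⟩
    · intro α W' k hα W'' k'
      refine (D.A i).isOpenSheaf.ext _ _ _ fun x hx => ?_
      refine ⟨W'' ⊓ B ⟨x, k (k' hx)⟩, inf_le_left, ⟨hx, mem _⟩, ?_⟩
      rw [AlgebraOn.res_res, hm _ _ _ _ _ _ _ inf_le_right, hm _ _ _ _ _ _ _ inf_le_right]
    · intro α α' W' k hα hα' k' γ δ hγ hδ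
      refine (D.A i).isOpenSheaf.ext _ _ _ fun x hx => ?_
      refine ⟨W' ⊓ B ⟨x, k hx⟩, inf_le_left, ⟨hx, mem _⟩, ?_⟩
      rw [map_mul, map_mul, D.res_as, D.res_as, hm _ _ _ _ _ _ _ inf_le_right,
        hm _ _ _ _ _ _ _ inf_le_right]
      exact sec_mul_as _ _ _ _ _ _ _
    · intro x
      refine comp_ext fun α W' k hα => ?_
      have := hm α W' (k.trans (l x)) hα W' le_rfl x k
      rw [AlgebraOn.res_refl] at this
      exact this

/-- The generator `e`. It is represented by the inverses of the multipliers `a α α α`, since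
`tr α m = m * a α α α` for all sections `m` at the index `i`. -/
def gen (V : Opens X) (hV : V ≤ D.cov.U i) : comp D i i V hV :=
  mk (fun α W' l hα => ((D.as α α α hα hα hα)⁻¹).val)
    (fun α W' l hα W'' l' => by
      have : Units.map ((D.A i).res (l.trans hV) l').toMonoidHom (D.as α α α hα hα hα) =
        D.as α α α (l'.trans hα) (l'.trans hα) (l'.trans hα) := Units.ext (D.res_as _ _ _ _)
      rw [← this, ← map_inv]
      rfl)
    (fun α α' W' l hα hα' k γ δ hγ hδ => by
      refine D.mul_as_eq_of α' hα hα' hα hα hδ hγ _ _ ?_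
      rw [D.as_self α' α hα' hα, Units.inv_mul, Units.inv_mul])

lemma sec_gen (V : Opens X) (hV : V ≤ D.cov.U i) (α W' l hα) : sec (gen V hV) α W' l hα =
  ((D.as α α α hα hα hα)⁻¹).val := rfl

lemma sec_act_gen (V : Opens X) (hV : V ≤ D.cov.U i) (x : D.S i V hV) (α W') (l : W' ≤ V) (hα) :
    sec (act hV hV (gen V hV) x) α W' l hα =
      (D.A i).res hV l x * ((D.as α α α hα hα hα)⁻¹).val := by
  rw [sec_act, sec_gen, Units.inv_mul_eq_iff_eq_mul, ← mul_assoc, ← D.fs_mul_as_self,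
    Units.mul_inv_cancel_right]

lemma act_gen_bijective (V : Opens X) (hV : V ≤ D.cov.U i) :
    Function.Bijective fun x => act hV hV (gen V hV) x := by
  constructor
  · intro x y h
    refine ext_at (j := i) hV hV x y fun W' l α hα => ?_
    have := congrArg (fun s => sec s α W' l hα) h
    simp only [sec_act_gen] at this
    exact (Units.isUnit _).mul_left_inj.1 this
  · intro s
    obtain ⟨x, hx⟩ := glue_at (j := i) hV hV
      (fun W' l x => ∃ (α : D.cov.κ i i) (hα : W' ≤ D.cov.O i i α),
        x = sec s α W' l hα * (D.as α α α hα hα hα).val)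
      (by
        rintro W' l x x' ⟨α, hα, rfl⟩ ⟨α', hα', rfl⟩
        rw [← D.as_self α α' hα hα']
        exact sec_mul_as s _ _ _ _ _ _)
      (by
        rintro W' l x W'' l' ⟨α, hα, rfl⟩
        refine ⟨α, l'.trans hα, ?_⟩
        rw [map_mul, res_sec, D.res_as])
      (fun W' l α hα => ⟨_, α, hα, rfl⟩)
    refine ⟨x, comp_ext fun α W' l hα => ?_⟩
    simp only [sec_act_gen]
    rw [hx W' l _ ⟨α, hα, rfl⟩, Units.mul_inv_cancel_right]

end FreeModule

open FreeModule in
/-- The twisted module over `U i` which is free of rank one with a generator at the index `i`. -/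
noncomputable def freeModule (D : GluingData R) (i : D.cov.ι) : TwistedModule D (D.cov.U i) where
  carrier j W hi hj := comp D i j W hi
  res hi hj k := FreeModule.res hi k
  act hi hj := FreeModule.act hi hj
  tr hi γ hγ := FreeModule.tr hi γ hγ
  isOpenSheaf j := FreeModule.isOpenSheaf _ le_rfl j
  act_one hi hj m := comp_ext fun α W' l hα => by rw [sec_act, map_one, map_one, mul_one]
  act_mul hi hj m x y := comp_ext fun α W' l hα => by
    rw [sec_act, sec_act, sec_act, map_mul, map_mul, mul_assoc]
  res_act hi hj k m x := comp_ext fun α W' l hα => by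
    rw [sec_act, sec_res, sec_res, sec_act, AlgebraOn.res_res]
  res_tr hi γ hγ l m := comp_ext_at ((l.trans hγ).trans (D.cov.O_le_left γ))
    fun δ W' l' hδ α hα => by
    rw [sec_res, sec_tr _ _ _ _ _ _ _ _ α hα, sec_tr _ _ _ _ _ _ _ _ α hα, sec_res]
  tr_act hi γ hγ m x := comp_ext_at (hγ.trans (D.cov.O_le_left γ)) fun δ W' l hδ α hα => by
    rw [sec_act, sec_tr _ _ _ _ _ _ _ _ α hα, sec_tr _ _ _ _ _ _ _ _ α hα, sec_act, D.res_fs,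
      mul_assoc, mul_assoc, D.fs_fs]
  tr_tr {j k m W} hi α β γ hα hβ hγ s := by
    refine comp_ext fun δ W' l hδ => (D.A i).isOpenSheaf.ext _ _ _ fun x hx => ?_
    obtain ⟨φ, hφ⟩ := D.cov.exists_mem_O (hi (l hx)) (D.cov.O_le_left α (hα (l hx)))
    obtain ⟨ε, hε⟩ := D.cov.exists_mem_O (hi (l hx)) (D.cov.O_le_left γ (hγ (l hx)))
    have l' : W' ⊓ D.cov.O i j φ ⊓ D.cov.O i k ε ≤ W' := inf_le_left.trans inf_le_left
    have hφ' : W' ⊓ D.cov.O i j φ ⊓ D.cov.O i k ε ≤ D.cov.O i j φ :=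
      inf_le_left.trans inf_le_right
    have hε' : W' ⊓ D.cov.O i j φ ⊓ D.cov.O i k ε ≤ D.cov.O i k ε := inf_le_right
    refine ⟨_, l', ⟨⟨hx, hφ⟩, hε⟩, ?_⟩
    have h := l'.trans l
    rw [res_sec, res_sec, sec_tr _ _ _ _ _ _ _ _ ε hε', sec_tr _ _ _ _ _ _ _ _ φ hφ',
      sec_tr _ _ _ _ _ _ _ _ φ hφ', sec_act, D.res_as, mul_assoc, mul_assoc,
      D.as_mul_as hφ' hε' (h.trans hα) (l'.trans hδ) (h.trans hβ) (h.trans hγ)]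
  tr_bijective hi γ hγ := FreeModule.tr_bijective hi γ hγ
  locally_free x hx := ⟨i, D.cov.U i, le_rfl, le_rfl, gen _ le_rfl, hx, fun W k =>
    act_gen_bijective W k⟩

/-- The generator of `freeModule D i`. -/
noncomputable def freeGen (D : GluingData R) (i : D.cov.ι) :
    (freeModule D i).carrier i (D.cov.U i) le_rfl le_rfl := FreeModule.gen _ le_rfl

lemma isGenerator_freeGen (D : GluingData R) (i : D.cov.ι) :
    (freeModule D i).IsGenerator le_rfl (freeGen D i) :=
  fun W k => FreeModule.act_gen_bijective W k

end

/-! ### Construction of linear functors from components -/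

section
variable {C : Type u₁} [Category.{v₁} C] {R : Cᵒᵖ ⥤ CommRingCat.{u}}

/-- The components of an `R`-functor. Compatibility with identities is not required, because it
follows from `iso_comp`, see `LinearFunctor.Core.iso_id`. -/
structure LinearFunctor.Core (F G : LinearPrestack.{u, v, w} R) where
  app (V : C) : F.obj V ⥤ G.obj V
  iso {V W : C} (i : W ⟶ V) (P : F.obj V) :
    (app W).obj ((F.res i).obj P) ≅ (G.res i).obj ((app V).obj P)
  map_add {V : C} {P Q : F.obj V} (s t : P ⟶ Q) :
    (app V).map (s + t) = (app V).map s + (app V).map t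
  map_smul {V : C} {P Q : F.obj V} (r : R.obj (op V)) (s : P ⟶ Q) :
    (app V).map (r • s) = r • (app V).map s
  iso_naturality {V W : C} (i : W ⟶ V) {P Q : F.obj V} (φ : P ⟶ Q) :
    (app W).map ((F.res i).map φ) ≫ (iso i Q).hom = (iso i P).hom ≫ (G.res i).map ((app V).map φ)
  iso_comp {V W Z : C} (i : W ⟶ V) (j : Z ⟶ W) (ij : Z ⟶ V) (h : j ≫ i = ij) (P : F.obj V) :
    (iso ij P).hom ≫ (G.toPseudofunctor.mapComp' i.op.toLoc j.op.toLoc ij.op.toLoc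
        (by subst h; rfl)).hom.toNatTrans.app ((app V).obj P) =
      (app Z).map ((F.toPseudofunctor.mapComp' i.op.toLoc j.op.toLoc ij.op.toLoc
        (by subst h; rfl)).hom.toNatTrans.app P) ≫ (iso j ((F.res i).obj P)).hom ≫
          (G.res j).map (iso i P).hom

namespace LinearFunctor.Core
variable {F G : LinearPrestack.{u, v, w} R} (c : LinearFunctor.Core F G)

lemma iso_id {V : C} (P : F.obj V) :
    (c.iso (𝟙 V) P).hom ≫ (G.toPseudofunctor.mapId (.mk (op V))).hom.toNatTrans.app
        ((c.app V).obj P) =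
      (c.app V).map ((F.toPseudofunctor.mapId (.mk (op V))).hom.toNatTrans.app P) := by
  let εF (P : F.obj V) : (F.res (𝟙 V)).obj P ≅ P :=
    (Cat.Hom.toNatIso (F.toPseudofunctor.mapId (.mk (op V)))).app P
  let εG (P : G.obj V) : (G.res (𝟙 V)).obj P ≅ P :=
    (Cat.Hom.toNatIso (G.toPseudofunctor.mapId (.mk (op V)))).app P
  have h := c.iso_comp (𝟙 V) (𝟙 V) (𝟙 V) (by simp) P
  have h₁ : ((G.toPseudofunctor.mapComp' (𝟙 V).op.toLoc (𝟙 V).op.toLoc (𝟙 V).op.toLoc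
        (by simp)).hom.toNatTrans.app ((c.app V).obj P)) = (G.res (𝟙 V)).map (εG _).inv := by
    refine (G.toPseudofunctor.mapComp'_id_comp_hom_app (𝟙 V).op.toLoc _).trans ?_
    simp [εG]
    rfl
  have h₂ : ((F.toPseudofunctor.mapComp' (𝟙 V).op.toLoc (𝟙 V).op.toLoc (𝟙 V).op.toLoc
        (by simp)).hom.toNatTrans.app P) = (F.res (𝟙 V)).map (εF _).inv := by
    refine (F.toPseudofunctor.mapComp'_id_comp_hom_app (𝟙 V).op.toLoc _).trans ?_
    simp [εF]
    rfl
  rw [h₁, h₂, reassoc_of% (c.iso_naturality (𝟙 V) (εF P).inv), Iso.cancel_iso_hom_left,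
    ← Functor.map_comp] at h
  have h₃ : (εG _).inv = (c.app V).map (εF P).inv ≫ (c.iso (𝟙 V) P).hom := by
    have nat : ∀ {A B : G.obj V} (f : A ⟶ B), (G.res (𝟙 V)).map f ≫ (εG B).hom = (εG A).hom ≫ f :=
      fun f => (G.toPseudofunctor.mapId (.mk (op V))).hom.toNatTrans.naturality f
    rw [← cancel_epi (εG _).hom, ← nat, ← nat, h]
  change _ ≫ (εG _).hom = (c.app V).map (εF P).hom
  rw [← cancel_epi ((c.app V).map (εF P).inv), ← reassoc_of% h₃, ← Functor.map_comp]
  simp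

/-- The `R`-functor with given components. -/
def toLinearFunctor : LinearFunctor F G where
  toTrans :=
    { app := fun V => (c.app V.as.unop).toCatHom
      naturality := fun {V W} f => Cat.Hom.isoMk (NatIso.ofComponents (fun P => c.iso f.as.unop P)
        fun φ => c.iso_naturality _ φ)
      naturality_naturality := fun {V W f g} η => by
        obtain rfl : f = g := obj_ext_of_isDiscrete η
        obtain rfl : η = 𝟙 _ := Subsingleton.elim _ _
        rw [F.toPseudofunctor.map₂_id, G.toPseudofunctor.map₂_id]
        ext P
        change (c.app _).map (𝟙 _) ≫ (c.iso f.as.unop P).hom = (c.iso f.as.unop P).hom ≫ 𝟙 _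
        rw [CategoryTheory.Functor.map_id, Category.id_comp, Category.comp_id]
      naturality_id := fun V => by
        ext P
        change (c.iso (𝟙 V.as.unop) P).hom ≫ (G.toPseudofunctor.mapId
            (.mk (op V.as.unop))).hom.toNatTrans.app ((c.app V.as.unop).obj P) =
          (c.app V.as.unop).map ((F.toPseudofunctor.mapId
            (.mk (op V.as.unop))).hom.toNatTrans.app P) ≫ 𝟙 _ ≫ 𝟙 _
        rw [Category.comp_id, Category.comp_id]
        exact c.iso_id P
      naturality_comp := fun {U V W} f g => by
        ext P
        have := c.iso_comp f.as.unop g.as.unop _ rfl P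
        simp [Pseudofunctor.mapComp'_eq_mapComp] at this
        refine this.trans ?_
        change _ = (c.app W.as.unop).map ((F.toPseudofunctor.mapComp _ _).hom.toNatTrans.app P) ≫
          𝟙 _ ≫ (c.iso g.as.unop ((F.res f.as.unop).obj P)).hom ≫ 𝟙 _ ≫
            (G.res g.as.unop).map (c.iso f.as.unop P).hom ≫ 𝟙 _
        simp only [Category.comp_id, Category.id_comp]
        rfl }
  map_add := c.map_add
  map_smul := c.map_smul

lemma toLinearFunctor_resIso {V W : C} (i : W ⟶ V) (P : F.obj V) :
    c.toLinearFunctor.resIso i P = c.iso i P := by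
  ext; rfl

end LinearFunctor.Core
end

/-! ### Coherence of linear functors -/

section

section
variable {C : Type u₁} [Category.{v₁} C] {R : Cᵒᵖ ⥤ CommRingCat.{u}}

namespace LinearFunctor
variable {F G : LinearPrestack.{u, v, w} R} (η : LinearFunctor F G)

lemma resIso_naturality {V W : C} (i : W ⟶ V) {P Q : F.obj V} (φ : P ⟶ Q) :
    (η.app W).map ((F.res i).map φ) ≫ (η.resIso i Q).hom =
      (η.resIso i P).hom ≫ (G.res i).map ((η.app V).map φ) :=
  (η.toTrans.naturality i.op.toLoc).hom.toNatTrans.naturality φ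

lemma resIso_comp {V W Z : C} (i : W ⟶ V) (j : Z ⟶ W) (ij : Z ⟶ V) (h : j ≫ i = ij) (P : F.obj V) :
    (η.resIso ij P).hom ≫ (G.toPseudofunctor.mapComp' i.op.toLoc j.op.toLoc ij.op.toLoc
        (by subst h; rfl)).hom.toNatTrans.app ((η.app V).obj P) =
      (η.app Z).map ((F.toPseudofunctor.mapComp' i.op.toLoc j.op.toLoc ij.op.toLoc
        (by subst h; rfl)).hom.toNatTrans.app P) ≫ (η.resIso j ((F.res i).obj P)).hom ≫
          (G.res j).map (η.resIso i P).hom := by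
  subst h
  have := congrArg (fun f => f.toNatTrans.app P) (η.toTrans.naturality_comp i.op.toLoc j.op.toLoc)
  have e₁ := G.toPseudofunctor.mapComp'_eq_mapComp i.op.toLoc j.op.toLoc
  have e₂ := F.toPseudofunctor.mapComp'_eq_mapComp i.op.toLoc j.op.toLoc
  change _ ≫ (G.toPseudofunctor.mapComp' i.op.toLoc j.op.toLoc (i.op.toLoc ≫ j.op.toLoc)
    rfl).hom.toNatTrans.app _ = (η.app Z).map ((F.toPseudofunctor.mapComp' i.op.toLoc j.op.toLoc
      (i.op.toLoc ≫ j.op.toLoc) rfl).hom.toNatTrans.app P) ≫ _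
  rw [e₁, e₂]
  refine Eq.trans this ?_
  change (η.app Z).map ((F.toPseudofunctor.mapComp _ _).hom.toNatTrans.app P) ≫
          𝟙 _ ≫ (η.resIso j ((F.res i).obj P)).hom ≫ 𝟙 _ ≫
            (G.res j).map (η.resIso i P).hom ≫ 𝟙 _ = _
  simp only [Category.comp_id, Category.id_comp]

end LinearFunctor

lemma toPseudofunctor'_mapComp'_hom_app (H : Cᵒᵖ ⥤ Cat.{v, w}) {V W Z : Cᵒᵖ} (i : V ⟶ W)
    (j : W ⟶ Z) (ij : V ⟶ Z) (h : i ≫ j = ij) (P : H.obj V) :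
    (H.toPseudofunctor'.mapComp' i.toLoc j.toLoc ij.toLoc (by subst h; rfl)).hom.toNatTrans.app P
      = eqToHom (by subst h; exact congrArg (fun f => f.toFunctor.obj P) (H.map_comp i j)) := by
  subst h
  have e := H.toPseudofunctor'.mapComp'_eq_mapComp i.toLoc j.toLoc
  change (H.toPseudofunctor'.mapComp' i.toLoc j.toLoc (i.toLoc ≫ j.toLoc)
    rfl).hom.toNatTrans.app P = _
  rw [e]
  exact Cat.eqToHom_app _ _ (H.map_comp i j) P

lemma AlgebraSheaf.star_mapComp'_hom_app {J : GrothendieckTopology C} (A : AlgebraSheaf J R)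
    {V W Z : C} (i : W ⟶ V) (j : Z ⟶ W) (ij : Z ⟶ V) (h : j ≫ i = ij)
    (P : (A.star : LinearPrestack.{u, u, w} R).obj V) :
    ((A.star : LinearPrestack.{u, u, w} R).toPseudofunctor.mapComp' i.op.toLoc j.op.toLoc
      ij.op.toLoc
      (by subst h; rfl)).hom.toNatTrans.app P =
      𝟙 (Star.pt : Star.{u, w} (A.toSheaf.obj.obj (op Z))) :=
  toPseudofunctor'_mapComp'_hom_app A.starFunctor i.op j.op ij.op (by subst h; rfl) P
end

end

/-! ### Trivializations give presentations -/

section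

variable {X : TopCat.{u}} {R : TopCat.Sheaf CommRingCat.{u} X}
open LinearPrestack (rmap rcomp rid)

namespace LinearPrestack
variable {F : Prestack R} {V₁ V₂ W W' : Opens X}

lemma rcomp_assoc_inv (P : F.obj V₁) (h : V₂ ≤ V₁) (k : W ≤ V₂) (l : W' ≤ W) :
    (rcomp P h (l.trans k)).inv ≫ (rcomp (F.rs h P) k l).inv =
      (rcomp P (k.trans h) l).inv ≫ (F.res (homOfLE l)).map (rcomp P h k).inv := by
  have := rmap_rcomp_inv P h k l
  rw [rmap_eq] at this
  rw [← this]
  simp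

lemma rcomp_assoc_hom (P : F.obj V₁) (h : V₂ ≤ V₁) (k : W ≤ V₂) (l : W' ≤ W) :
    (rcomp (F.rs h P) k l).hom ≫ (rcomp P h (l.trans k)).hom =
      (F.res (homOfLE l)).map (rcomp P h k).hom ≫ (rcomp P (k.trans h) l).hom := by
  have := rmap_rcomp_hom P h k l
  rw [rmap_eq] at this
  rw [← this]
  simp

lemma inv_comp_res_map {P Q : F.obj V₁} {h₁ : W ≤ V₁} (φ : F.rs h₁ P ⟶ F.rs h₁ Q) (k : W' ≤ W) :
    (rcomp P h₁ k).inv ≫ (F.res (homOfLE k)).map φ = rmap k φ ≫ (rcomp Q h₁ k).inv := by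
  rw [rmap_eq]; simp

end LinearPrestack

/-- A presentation in terms of the objects `P i = Ψ i (pt)` over `U i` only: the endomorphisms of
`P i` over `W` are the sections of `A i`, acting by `ρ`, the `g α` are isomorphisms over `O i j α`
which are compatible with `f α` and `a α β γ`, and every object is locally isomorphic to `P i`. The
values over smaller open subsets are obtained by restriction. -/
structure GluingData.Trivialization (D : GluingData R) (F : Prestack R) where
  P (i : D.cov.ι) : F.obj (D.cov.U i)
  ρ (i : D.cov.ι) {W : Opens X} (hW : W ≤ D.cov.U i) :
    D.S i W hW →+ (F.rs hW (P i) ⟶ F.rs hW (P i))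
  ρ_one (i : D.cov.ι) {W : Opens X} (hW : W ≤ D.cov.U i) : ρ i hW 1 = 𝟙 _
  ρ_mul (i : D.cov.ι) {W : Opens X} (hW : W ≤ D.cov.U i) (x y) :
    ρ i hW (x * y) = ρ i hW y ≫ ρ i hW x
  ρ_bijective (i : D.cov.ι) {W : Opens X} (hW : W ≤ D.cov.U i) : Function.Bijective (ρ i hW)
  rmap_ρ (i : D.cov.ι) {W W' : Opens X} (hW : W ≤ D.cov.U i) (k : W' ≤ W) (x) :
    rmap k (ρ i hW x) = ρ i (k.trans hW) ((D.A i).res hW k x)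
  ρ_scalar (i : D.cov.ι) {W : Opens X} (hW : W ≤ D.cov.U i) (r) :
    ρ i hW ((D.A i).scalar hW r) = r • 𝟙 _
  g {i j : D.cov.ι} (α : D.cov.κ i j) :
    F.rs (D.cov.O_le_right α) (P j) ≅ F.rs (D.cov.O_le_left α) (P i)
  ρ_g {i j : D.cov.ι} (α : D.cov.κ i j) {W : Opens X} (hα : W ≤ D.cov.O i j α) (x) :
    ρ j _ x ≫ rmap hα (g α).hom = rmap hα (g α).hom ≫ ρ i _ (D.fs α hα x)
  g_comp {i j k : D.cov.ι} (α : D.cov.κ i j) (β : D.cov.κ i k) (γ : D.cov.κ j k) {W : Opens X}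
    (hα : W ≤ D.cov.O i j α) (hβ : W ≤ D.cov.O i k β) (hγ : W ≤ D.cov.O j k γ) :
    rmap hγ (g γ).hom ≫ rmap hα (g α).hom = rmap hβ (g β).hom ≫ ρ i _ (D.as α β γ hα hβ hγ).val
  locally_iso (i : D.cov.ι) {V : Opens X} (hV : V ≤ D.cov.U i) (Q : F.obj V) (x : X) (hx : x ∈ V) :
    ∃ (W : Opens X) (k : W ≤ V), x ∈ W ∧ Nonempty (F.rs (k.trans hV) (P i) ≅ F.rs k Q)

namespace GluingData.Trivialization
variable {D : GluingData R} {F : Prestack R} (T : D.Trivialization F)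

lemma ρ_smul (i : D.cov.ι) {W : Opens X} (hW : W ≤ D.cov.U i) (r : R.obj.obj (op W)) (x) :
    T.ρ i hW ((D.A i).scalar hW r * x) = r • T.ρ i hW x := by
  rw [T.ρ_mul, T.ρ_scalar, Linear.comp_smul, Category.comp_id]

/-- The components of the `R`-functor from `(D.A i).star` to `F|_{U i}` taking the object over `W` to
`P i|_W`. -/
def core (i : D.cov.ι) : LinearFunctor.Core (D.A i).star (F.restrict (D.cov.U i)) where
  app V :=
    { obj := fun _ => F.rs (leOfHom V.hom) (T.P i)
      map := fun x => T.ρ i (leOfHom V.hom) x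
      map_id := fun (_ : Star.{u, u + 1} _) => T.ρ_one i _
      map_comp := fun x y => T.ρ_mul i (leOfHom V.hom) y x }
  iso {V W} k _ := (rcomp (T.P i) (leOfHom V.hom) (leOfHom k.left)).symm
  map_add s t := map_add (T.ρ i _) s t
  map_smul r s := T.ρ_smul i _ r s
  iso_naturality {V W} k _ _ x :=
    (congrArg (· ≫ (rcomp (T.P i) (leOfHom V.hom) (leOfHom k.left)).inv)
      (T.rmap_ρ i (leOfHom V.hom) (leOfHom k.left) x).symm).trans
        (LinearPrestack.inv_comp_res_map (T.ρ i (leOfHom V.hom) x) (leOfHom k.left)).symm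
  iso_comp {V W Z} k l kl h P := by
    refine (congrArg (_ ≫ ·) (restrict_mapComp'_hom F _ k l kl h _)).trans ?_
    refine (LinearPrestack.rcomp_assoc_inv (T.P i) (leOfHom V.hom) (leOfHom k.left)
      (leOfHom l.left)).trans ?_
    refine (Category.id_comp _).symm.trans ?_
    refine congrArg (· ≫ ((rcomp (T.P i) ((leOfHom k.left).trans (leOfHom V.hom))
      (leOfHom l.left)).inv ≫ (F.res l.left).map (rcomp (T.P i) (leOfHom V.hom)
        (leOfHom k.left)).inv)) ?_
    refine (T.ρ_one i (leOfHom Z.hom)).symm.trans ?_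
    exact congrArg (T.ρ i (leOfHom Z.hom)) ((D.A i).star_mapComp'_hom_app k l kl h P).symm

/-- A trivialization of a stack gives a presentation. -/
def toPresentation (hF : F.IsStack (Opens.grothendieckTopology X)) : D.Presentation F where
  Ψ i := (T.core i).toLinearFunctor
  associated i :=
    { isStack := isStack_restrict _ hF
      full := fun V => ⟨fun {P Q} f => (T.ρ_bijective i _).2 f⟩
      faithful := fun V => ⟨fun {P Q} f g h => (T.ρ_bijective i _).1 h⟩
      locally_essSurj := fun V Q => by
        let S : Sieve V :=
          { arrows := fun W f => Nonempty (F.rs (leOfHom W.hom) (T.P i) ≅ F.rs (leOfHom f.left) Q)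
            downward_closed := fun {W Z} f hf g =>
              ⟨LinearPrestack.rmapIso (leOfHom g.left) hf.some⟩ }
        refine ⟨S, ?_, fun W f hf => ⟨Star.pt, hf⟩⟩
        rw [GrothendieckTopology.mem_over_iff]
        intro x hx
        obtain ⟨W, k, hxW, e⟩ := T.locally_iso i (leOfHom V.hom) Q x hx
        refine ⟨W, homOfLE k, ?_, hxW⟩
        rw [Sieve.overEquiv_iff]
        exact e }
  g α V h := LinearPrestack.rmapIso h (T.g α)
  g_naturality α V h x := T.ρ_g α h x
  g_res {i j} α V W h k := by
    have e (i) (hV : V ≤ D.cov.U i) : LinearFunctor.ptRes (T.core i).toLinearFunctor hV k =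
      (rcomp (T.P i) hV k).symm := (T.core i).toLinearFunctor_resIso _ _
    rw [e, e]
    have := LinearPrestack.rmap_rmap h k (T.g α).hom
    refine (congrArg (· ≫ (rcomp (T.P i) (h.trans (D.cov.O_le_left α)) k).inv) this.symm).trans ?_
    rw [LinearPrestack.rmap_eq k]
    simp
    rfl
  g_comp α β γ V h := T.g_comp α β γ _ _ _

end GluingData.Trivialization

end

/-! ### Presentations give trivializations -/

section

variable {X : TopCat.{u}} {R : TopCat.Sheaf CommRingCat.{u} X}
open LinearPrestack (rmap rcomp rid)

namespace LinearFunctor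
variable {U : Opens X} {A : AlgebraOn R U} {F : Prestack R}
  (Ψ : LinearFunctor A.star (F.restrict U)) {V W W' : Opens X} (h : V ≤ U)

lemma ptMap_one : Ψ.ptMap V h 1 = 𝟙 _ :=
  (Ψ.app (Over.mk (homOfLE h))).map_id (Star.pt : Star.{u, u + 1} _)

lemma ptMap_mul (x y : A.sections V h) : Ψ.ptMap V h (x * y) = Ψ.ptMap V h y ≫ Ψ.ptMap V h x :=
  (Ψ.app (Over.mk (homOfLE h))).map_comp (X := (Star.pt : Star.{u, u + 1} _))
    (Y := (Star.pt : Star.{u, u + 1} _)) (Z := (Star.pt : Star.{u, u + 1} _)) y x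

lemma ptMap_add (x y : A.sections V h) : Ψ.ptMap V h (x + y) = Ψ.ptMap V h x + Ψ.ptMap V h y :=
  Ψ.map_add (V := Over.mk (homOfLE h)) (P := (Star.pt : Star.{u, u + 1} _))
    (Q := (Star.pt : Star.{u, u + 1} _)) x y

lemma ptMap_scalar_mul (r : R.obj.obj (op V)) (x : A.sections V h) :
    Ψ.ptMap V h (A.scalar h r * x) = r • Ψ.ptMap V h x :=
  Ψ.map_smul (V := Over.mk (homOfLE h)) (P := (Star.pt : Star.{u, u + 1} _))
    (Q := (Star.pt : Star.{u, u + 1} _)) r x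

lemma ptMap_res (k : W ≤ V) (x : A.sections V h) :
    Ψ.ptMap W (k.trans h) (A.res h k x) ≫ (Ψ.ptRes h k).hom =
      (Ψ.ptRes h k).hom ≫ (F.res (homOfLE k)).map (Ψ.ptMap V h x) :=
  Ψ.resIso_naturality (Over.homMk (homOfLE k) : Over.mk (homOfLE (k.trans h)) ⟶
    Over.mk (homOfLE h)) (P := (Star.pt : Star.{u, u + 1} _)) (Q := (Star.pt : Star.{u, u + 1} _)) x

lemma ptRes_comp (k : W ≤ V) (l : W' ≤ W) :
    (Ψ.ptRes h (l.trans k)).hom ≫ (rcomp (Ψ.pt V h) k l).inv =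
      (Ψ.ptRes (k.trans h) l).hom ≫ (F.res (homOfLE l)).map (Ψ.ptRes h k).hom := by
  let k' : Over.mk (homOfLE (k.trans h)) ⟶ Over.mk (homOfLE h) := Over.homMk (homOfLE k)
  let l' : Over.mk (homOfLE (l.trans (k.trans h))) ⟶ Over.mk (homOfLE (k.trans h)) :=
    Over.homMk (homOfLE l)
  let kl' : Over.mk (homOfLE (l.trans (k.trans h))) ⟶ Over.mk (homOfLE h) :=
    Over.homMk (homOfLE (l.trans k))
  have := Ψ.resIso_comp k' l' kl' rfl (Star.pt : Star.{u, u + 1} _)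
  have e := restrict_mapComp'_hom F _ k' l' kl' rfl (Ψ.pt V h)
  refine (congrArg ((Ψ.ptRes h (l.trans k)).hom ≫ ·) e).symm.trans (this.trans ?_)
  refine Eq.trans ?_ (Category.id_comp _)
  refine congrArg (· ≫ _) ?_
  refine Eq.trans ?_ (Ψ.ptMap_one (l.trans (k.trans h)))
  exact congrArg (Ψ.app (Over.mk (homOfLE (l.trans (k.trans h))))).map
    (A.star_mapComp'_hom_app k' l' kl' rfl (Star.pt : Star.{u, u + 1} _))

/-- The isomorphism between the object `pt` over `V` and the restriction of the object over `U`. -/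
def ptIso : Ψ.pt V h ≅ F.rs h (Ψ.pt U le_rfl) := Ψ.ptRes le_rfl h

variable {U' : Opens X} {A' : AlgebraOn R U'} (Ψ' : LinearFunctor A'.star (F.restrict U'))

lemma rmap_conj (h' : V ≤ U') (φ : Ψ.pt V h ⟶ Ψ'.pt V h') (k : W ≤ V) :
    rmap k ((Ψ.ptIso h).inv ≫ φ ≫ (Ψ'.ptIso h').hom) = (Ψ.ptIso (k.trans h)).inv ≫
      ((Ψ.ptRes h k).hom ≫ (F.res (homOfLE k)).map φ ≫ (Ψ'.ptRes h' k).inv) ≫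
        (Ψ'.ptIso (k.trans h')).hom := by
  have e₁ := Ψ.ptRes_comp le_rfl h k
  have e₂ := Ψ'.ptRes_comp le_rfl h' k
  have e₁' : (rcomp (Ψ.pt U le_rfl) h k).inv = (Ψ.ptIso (k.trans h)).inv ≫ (Ψ.ptRes h k).hom ≫
    (F.res (homOfLE k)).map (Ψ.ptIso h).hom := (Iso.eq_inv_comp _).2 e₁
  have e₂' : (F.res (homOfLE k)).map (Ψ'.ptIso h').hom ≫ (rcomp (Ψ'.pt U' le_rfl) h' k).hom =
      (Ψ'.ptRes h' k).inv ≫ (Ψ'.ptIso (k.trans h')).hom := by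
    rw [Iso.eq_inv_comp, ← Category.assoc, ← Iso.eq_comp_inv]
    exact e₂.symm
  rw [LinearPrestack.rmap_eq, e₁', Functor.map_comp, Functor.map_comp]
  simp only [Category.assoc]
  rw [e₂', ← Functor.map_comp_assoc, Iso.hom_inv_id, CategoryTheory.Functor.map_id,
    Category.id_comp]

end LinearFunctor

namespace GluingData.Presentation
variable {D : GluingData R} {F : Prestack R} (p : D.Presentation F)

lemma ptMap_bijective (i : D.cov.ι) {W : Opens X} (hW : W ≤ D.cov.U i) :
    Function.Bijective ((p.Ψ i).ptMap W hW) := by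
  have := (p.associated i).full (Over.mk (homOfLE hW))
  have := (p.associated i).faithful (Over.mk (homOfLE hW))
  exact ((Functor.FullyFaithful.ofFullyFaithful ((p.Ψ i).app (Over.mk (homOfLE hW)))).homEquiv
    (X := (Star.pt : Star.{u, u + 1} _)) (Y := (Star.pt : Star.{u, u + 1} _))).bijective

lemma rmap_g {i j : D.cov.ι} (α : D.cov.κ i j) {W : Opens X} (hα : W ≤ D.cov.O i j α) :
    rmap hα (((p.Ψ j).ptIso (D.cov.O_le_right α)).inv ≫ (p.g α _ le_rfl).hom ≫
        ((p.Ψ i).ptIso (D.cov.O_le_left α)).hom) =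
      ((p.Ψ j).ptIso (hα.trans (D.cov.O_le_right α))).inv ≫ (p.g α W hα).hom ≫
        ((p.Ψ i).ptIso (hα.trans (D.cov.O_le_left α))).hom := by
  rw [LinearFunctor.rmap_conj]
  have := p.g_res α _ W le_rfl hα
  rw [(Iso.eq_comp_inv _).2 this]
  simp only [Category.assoc]

/-- A presentation gives a trivialization. -/
noncomputable def toTrivialization : D.Trivialization F where
  P i := (p.Ψ i).pt _ le_rfl
  ρ i W hW := AddMonoidHom.mk' (fun x => ((p.Ψ i).ptIso hW).inv ≫ (p.Ψ i).ptMap W hW x ≫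
    ((p.Ψ i).ptIso hW).hom) fun x y => by simp [LinearFunctor.ptMap_add]
  ρ_one i W hW := by simp [LinearFunctor.ptMap_one]
  ρ_mul i W hW x y := by simp [LinearFunctor.ptMap_mul]
  ρ_bijective i W hW := by
    have : Function.Bijective fun φ : (p.Ψ i).pt W hW ⟶ (p.Ψ i).pt W hW =>
        ((p.Ψ i).ptIso hW).inv ≫ φ ≫ ((p.Ψ i).ptIso hW).hom :=
      ((p.Ψ i).ptIso hW).conj.bijective
    exact this.comp (p.ptMap_bijective i hW)
  rmap_ρ i W W' hW k x := by
    refine ((p.Ψ i).rmap_conj hW (p.Ψ i) hW _ k).trans ?_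
    have := (p.Ψ i).ptMap_res hW k x
    rw [← Iso.eq_comp_inv, Category.assoc] at this
    rw [← this]
    rfl
  ρ_scalar i W hW r := by
    have := (p.Ψ i).ptMap_scalar_mul hW r 1
    rw [mul_one, (p.Ψ i).ptMap_one] at this
    simp [this]
  g α := ((p.Ψ _).ptIso _).symm ≪≫ p.g α _ le_rfl ≪≫ (p.Ψ _).ptIso _
  ρ_g {i j} α W hα x := by
    have := p.g_naturality α W hα x
    simp [rmap_g, reassoc_of% this]
    rfl
  g_comp {i j k} α β γ W hα hβ hγ := by
    have := p.g_comp α β γ W (le_inf (le_inf hα hβ) hγ)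
    simp [rmap_g, reassoc_of% this]
    rfl
  locally_iso i V hV Q x hx := by
    obtain ⟨S, hS, H⟩ := (p.associated i).locally_essSurj (Over.mk (homOfLE hV)) Q
    rw [GrothendieckTopology.mem_over_iff] at hS
    obtain ⟨W, f, hf, hxW⟩ := hS x hx
    rw [Sieve.overEquiv_iff] at hf
    obtain ⟨P, ⟨e⟩⟩ := H _ hf
    exact ⟨W, leOfHom f, hxW, ⟨((p.Ψ i).ptIso ((leOfHom f).trans hV)).symm ≪≫ e⟩⟩

end GluingData.Presentation

end

/-! ### Transport of trivializations along equivalences -/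

section

variable {X : TopCat.{u}} {R : TopCat.Sheaf CommRingCat.{u} X}
open LinearPrestack (rmap rcomp rid)

namespace LinearFunctor
variable {F G : Prestack R} (η : LinearFunctor F G) {V V₁ V₂ V₃ W W' : Opens X}
  {P : F.obj V₁} {Q : F.obj V₂} {S : F.obj V₃} {h₁ : W ≤ V₁} {h₂ : W ≤ V₂} {h₃ : W ≤ V₃}

/-- The isomorphism `η(P|_W) ≅ η(P)|_W`. -/
abbrev rsIso (h : W ≤ V₁) (P : F.obj V₁) : (η.app W).obj (F.rs h P) ≅ G.rs h ((η.app V₁).obj P) :=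
  η.resIso (homOfLE h) P

lemma rsIso_comp (h : W ≤ V₁) (k : W' ≤ W) (P : F.obj V₁) :
    (η.rsIso (k.trans h) P).hom ≫ (rcomp ((η.app V₁).obj P) h k).inv =
      (η.app W').map (rcomp P h k).inv ≫ (η.rsIso k (F.rs h P)).hom ≫
        (G.res (homOfLE k)).map (η.rsIso h P).hom :=
  η.resIso_comp (homOfLE h) (homOfLE k) _ rfl P

/-- The action of `η` on morphisms between restrictions. -/
def mapHom (φ : F.rs h₁ P ⟶ F.rs h₂ Q) :
    G.rs h₁ ((η.app V₁).obj P) ⟶ G.rs h₂ ((η.app V₂).obj Q) :=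
  (η.rsIso h₁ P).inv ≫ (η.app W).map φ ≫ (η.rsIso h₂ Q).hom

@[simp]
lemma mapHom_id (P : F.obj V₁) : η.mapHom (𝟙 (F.rs h₁ P)) = 𝟙 _ := by
  simp [mapHom]

@[simp]
lemma mapHom_comp (φ : F.rs h₁ P ⟶ F.rs h₂ Q) (ψ : F.rs h₂ Q ⟶ F.rs h₃ S) :
    η.mapHom (φ ≫ ψ) = η.mapHom φ ≫ η.mapHom ψ := by
  simp [mapHom]

lemma mapHom_add (φ ψ : F.rs h₁ P ⟶ F.rs h₂ Q) :
    η.mapHom (φ + ψ) = η.mapHom φ + η.mapHom ψ := by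
  simp [mapHom, η.map_add]

lemma mapHom_smul (r : R.obj.obj (op W)) (φ : F.rs h₁ P ⟶ F.rs h₂ Q) :
    η.mapHom (r • φ) = r • η.mapHom φ := by
  simp [mapHom, η.map_smul]

lemma rmap_mapHom (k : W' ≤ W) (φ : F.rs h₁ P ⟶ F.rs h₂ Q) :
    rmap k (η.mapHom φ) = η.mapHom (rmap k φ) := by
  have e₁ : (rcomp ((η.app V₁).obj P) h₁ k).inv = (η.rsIso (k.trans h₁) P).inv ≫
    (η.app W').map (rcomp P h₁ k).inv ≫ (η.rsIso k (F.rs h₁ P)).hom ≫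
        (G.res (homOfLE k)).map (η.rsIso h₁ P).hom := (Iso.eq_inv_comp _).2 (η.rsIso_comp h₁ k P)
  have e₂ : (G.res (homOfLE k)).map (η.rsIso h₂ Q).hom ≫ (rcomp ((η.app V₂).obj Q) h₂ k).hom =
      (η.rsIso k (F.rs h₂ Q)).inv ≫ (η.app W').map (rcomp Q h₂ k).hom ≫
        (η.rsIso (k.trans h₂) Q).hom := by
    have := η.rsIso_comp h₂ k Q
    rw [Iso.comp_inv_eq] at this
    rw [this]
    simp [← Functor.map_comp_assoc]
  have e₃ := η.resIso_naturality (homOfLE k) φ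
  rw [LinearPrestack.rmap_eq, e₁, mapHom, Functor.map_comp, Functor.map_comp]
  simp only [Category.assoc]
  rw [e₂, ← Functor.map_comp_assoc, Iso.hom_inv_id, CategoryTheory.Functor.map_id,
    Category.id_comp, ← reassoc_of% e₃, Iso.hom_inv_id_assoc, mapHom, LinearPrestack.rmap_eq]
  simp

/-- The action of `η` on isomorphisms between restrictions. -/
@[simps]
def mapHomIso (φ : F.rs h₁ P ≅ F.rs h₂ Q) :
    G.rs h₁ ((η.app V₁).obj P) ≅ G.rs h₂ ((η.app V₂).obj Q) where
  hom := η.mapHom φ.hom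
  inv := η.mapHom φ.inv
  hom_inv_id := by rw [← mapHom_comp, φ.hom_inv_id, mapHom_id]
  inv_hom_id := by rw [← mapHom_comp, φ.inv_hom_id, mapHom_id]

lemma mapHom_bijective_iff : Function.Bijective (η.mapHom : (F.rs h₁ P ⟶ F.rs h₂ Q) → _) ↔
    Function.Bijective ((η.app W).map : (F.rs h₁ P ⟶ F.rs h₂ Q) → _) :=
  Function.Bijective.of_comp_iff' (g := fun φ => (η.app W).map φ)
    (((η.rsIso h₁ P).homCongr (η.rsIso h₂ Q)).bijective)

lemma mapHom_bijective (hη : ∀ V, (η.app V).IsEquivalence) :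
    Function.Bijective (η.mapHom : (F.rs h₁ P ⟶ F.rs h₂ Q) → _) :=
  η.mapHom_bijective_iff.2 ⟨fun _ _ h => (η.app W).map_injective h, (η.app W).map_surjective⟩

end LinearFunctor

namespace GluingData.Trivialization
variable {D : GluingData R} {F G : Prestack R} (T : D.Trivialization F)

/-- Transport of a trivialization along an equivalence. -/
def map (η : LinearFunctor F G) (hη : ∀ V, (η.app V).IsEquivalence) : D.Trivialization G where
  P i := (η.app _).obj (T.P i)
  ρ i W hW := AddMonoidHom.mk' (fun x => η.mapHom (T.ρ i hW x)) fun x y => by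
    rw [_root_.map_add, η.mapHom_add]
  ρ_one i W hW := by simp [T.ρ_one]
  ρ_mul i W hW x y := by simp [T.ρ_mul]
  ρ_bijective i W hW := (η.mapHom_bijective hη).comp (T.ρ_bijective i hW)
  rmap_ρ i W W' hW k x := by simp [η.rmap_mapHom, T.rmap_ρ]
  ρ_scalar i W hW r := by simp [T.ρ_scalar, η.mapHom_smul]
  g α := η.mapHomIso (T.g α)
  ρ_g α W hα x := by
    simp only [LinearFunctor.mapHomIso_hom, η.rmap_mapHom, AddMonoidHom.mk'_apply,
      ← η.mapHom_comp, T.ρ_g]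
  g_comp α β γ W hα hβ hγ := by
    simp only [LinearFunctor.mapHomIso_hom, η.rmap_mapHom, AddMonoidHom.mk'_apply,
      ← η.mapHom_comp, T.g_comp α β γ hα hβ hγ]
  locally_iso i V hV Q x hx := by
    obtain ⟨W, k, hxW, ⟨e⟩⟩ := T.locally_iso i hV ((η.app V).objPreimage Q) x hx
    exact ⟨W, k, hxW, ⟨η.mapHomIso e ≪≫ (G.res (homOfLE k)).mapIso ((η.app V).objObjPreimageIso Q)⟩⟩

end GluingData.Trivialization

end

/-! ### The functor to the stack of twisted modules -/

section

variable {X : TopCat.{u}} {R : TopCat.Sheaf CommRingCat.{u} X}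
open LinearPrestack (rmap rcomp rid)

lemma bijective_comp_left {C : Type*} [Category C] {P Q : C} (e : P ≅ Q) (S : C) :
    Function.Bijective fun m : Q ⟶ S => e.hom ≫ m :=
  ⟨fun _ _ h => (cancel_epi e.hom).1 h, fun m => ⟨e.inv ≫ m, e.hom_inv_id_assoc m⟩⟩

lemma bijective_comp_right {C : Type*} [Category C] {P Q : C} (e : P ≅ Q) (S : C) :
    Function.Bijective fun m : S ⟶ P => m ≫ e.hom :=
  ⟨fun _ _ h => (cancel_mono e.hom).1 h, fun m => ⟨m ≫ e.inv, by simp⟩⟩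

lemma LinearPrestack.res_rcomp_inv_comp {F : Prestack R} {V₁ V₂ W W' : Opens X} (P : F.obj V₁)
    (h : V₂ ≤ V₁) (k : W ≤ V₂) (l : W' ≤ W) :
    (F.res (homOfLE l)).map (rcomp P h k).inv ≫ (rcomp (F.rs h P) k l).hom ≫
      (rcomp P h (l.trans k)).hom = (rcomp P (k.trans h) l).hom := by
  rw [rcomp_assoc_hom, ← Functor.map_comp_assoc, Iso.inv_hom_id, CategoryTheory.Functor.map_id,
    Category.id_comp]

namespace GluingData.Trivialization
variable {D : GluingData R} {F : Prestack R} (T : D.Trivialization F)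
  (hF : F.IsStack (Opens.grothendieckTopology X)) {V : Opens X}

/-- The twisted module of an object `Q`: its component at the index `i` is the sheaf of morphisms
from `P i` to `Q`, on which `A i` acts through the endomorphisms of `P i`. -/
def homModule (Q : F.obj V) : TwistedModule D V where
  carrier i W hV hU := F.rs hU (T.P i) ⟶ F.rs hV Q
  res _ _ k := AddMonoidHom.mk' (rmap k) (LinearPrestack.rmap_add k)
  act {i W} _ hU := AddMonoidHom.mk' (fun m => AddMonoidHom.mk' (fun x => T.ρ i hU x ≫ m)
    fun x y => by rw [_root_.map_add, Preadditive.add_comp])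
    fun m m' => by ext x; exact Preadditive.comp_add _ _ _ (T.ρ i hU x) m m'
  tr _ α hα := AddMonoidHom.mk' (fun m => rmap hα (T.g α).hom ≫ m)
    fun m m' => Preadditive.comp_add _ _ _ _ m m'
  isOpenSheaf i := LinearPrestack.isOpenSheaf_hom hF (inf_le_right : V ⊓ D.cov.U i ≤ _) inf_le_left
    (T.P i) Q
  act_one _ hU m := (congrArg (· ≫ m) (T.ρ_one _ hU)).trans (Category.id_comp m)
  act_mul _ hU m x y := (congrArg (· ≫ m) (T.ρ_mul _ hU x y)).trans (Category.assoc _ _ m)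
  res_act _ hU k m x := (LinearPrestack.rmap_comp k (T.ρ _ hU x) m).trans
    (congrArg (· ≫ rmap k m) (T.rmap_ρ _ hU k x))
  res_tr _ α hα k m := (LinearPrestack.rmap_comp k (rmap hα (T.g α).hom) m).trans
    (congrArg (· ≫ rmap k m) (LinearPrestack.rmap_rmap hα k _))
  tr_act _ α hα m x := (Category.assoc _ _ m).symm.trans
    ((congrArg (· ≫ m) (T.ρ_g α hα x).symm).trans (Category.assoc _ _ m))
  tr_tr _ α β γ hα hβ hγ m := (Category.assoc _ _ m).symm.trans
    ((congrArg (· ≫ m) (T.g_comp α β γ hα hβ hγ)).trans (Category.assoc _ _ m))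
  tr_bijective {i j W} hV α hα :=
    bijective_comp_left (LinearPrestack.rmapIso hα (T.g α)) (F.rs hV Q)
  locally_free x hx := by
    obtain ⟨i, hi⟩ := D.cov.exists_mem_U x
    obtain ⟨W, k, hxW, ⟨e⟩⟩ := T.locally_iso i (V := V ⊓ D.cov.U i) inf_le_right
      (F.rs inf_le_left Q) x ⟨hx, hi⟩
    let e' : F.rs (k.trans inf_le_right) (T.P i) ≅ F.rs (k.trans inf_le_left) Q :=
      e ≪≫ rcomp Q inf_le_left k
    refine ⟨i, W, k.trans inf_le_left, k.trans inf_le_right, e'.hom, hxW, fun W' k' => ?_⟩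
    exact (bijective_comp_right (LinearPrestack.rmapIso k' e') _).comp (T.ρ_bijective i _)

/-- The morphism of twisted modules induced by a morphism of objects. -/
def homModuleMap {Q Q' : F.obj V} (φ : Q ⟶ Q') : T.homModule hF Q ⟶ T.homModule hF Q' where
  app _ _ hV _ := AddMonoidHom.mk' (fun m => m ≫ (F.res (homOfLE hV)).map φ)
    fun m m' => Preadditive.add_comp _ _ _ m m' _
  app_res _ _ k m := ((LinearPrestack.rmap_comp k m _).trans
    (congrArg (rmap k m ≫ ·) (LinearPrestack.rmap_res_map φ _ k))).symm
  app_act _ _ m _ := Category.assoc _ m _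
  app_tr _ _ _ m := Category.assoc _ m _

/-- The compatibility of `homModule` with restriction. -/
def homModuleRes {W : Opens X} (k : W ≤ V) (Q : F.obj V) :
    T.homModule hF (F.rs k Q) ≅ (T.homModule hF Q).restr k where
  hom :=
    { app := fun _ _ hV _ => AddMonoidHom.mk' (fun m => m ≫ (rcomp Q k hV).hom)
        fun m m' => Preadditive.add_comp _ _ _ m m' _
      app_res := fun _ _ l m => ((LinearPrestack.rmap_comp l m _).trans
        (congrArg (rmap l m ≫ ·) (LinearPrestack.rmap_rcomp_hom Q k _ l))).symm
      app_act := fun _ _ m _ => Category.assoc _ m _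
      app_tr := fun _ _ _ m => Category.assoc _ m _ }
  inv :=
    { app := fun _ _ hV _ => AddMonoidHom.mk' (fun m => m ≫ (rcomp Q k hV).inv)
        fun m m' => Preadditive.add_comp _ _ _ m m' _
      app_res := fun _ _ l m => ((LinearPrestack.rmap_comp l m _).trans
        (congrArg (rmap l m ≫ ·) (LinearPrestack.rmap_rcomp_inv Q k _ l))).symm
      app_act := fun _ _ m _ => Category.assoc _ m _
      app_tr := fun _ _ _ m => Category.assoc _ m _ }
  hom_inv_id := TwistedModule.hom_ext fun _ _ hV _ m =>
    (Category.assoc m _ _).trans ((congrArg (m ≫ ·) (rcomp Q k hV).hom_inv_id).trans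
      (Category.comp_id m))
  inv_hom_id := TwistedModule.hom_ext fun _ _ hV _ m =>
    (Category.assoc m _ _).trans ((congrArg (m ≫ ·) (rcomp Q k hV).inv_hom_id).trans
      (Category.comp_id m))

/-- The components of `homFunctor`. -/
def homCore : LinearFunctor.Core F (twistedStack D) where
  app V :=
    { obj := fun Q => T.homModule hF Q
      map := fun φ => T.homModuleMap hF φ
      map_id := fun Q => TwistedModule.hom_ext fun _ _ hV _ m =>
        (congrArg (m ≫ ·) ((F.res (homOfLE hV)).map_id Q)).trans (Category.comp_id m)
      map_comp := fun φ ψ => TwistedModule.hom_ext fun _ _ hV _ m =>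
        (congrArg (m ≫ ·) ((F.res (homOfLE hV)).map_comp φ ψ)).trans (Category.assoc m _ _).symm }
  iso k Q := T.homModuleRes hF (leOfHom k) Q
  map_add s t := TwistedModule.hom_ext fun _ _ hV _ m =>
    (congrArg (m ≫ ·) (F.map_add (homOfLE hV) s t)).trans (Preadditive.comp_add _ _ _ m _ _)
  map_smul {V P Q} r s := TwistedModule.hom_ext fun i W hV hU m => by
    refine (congrArg (m ≫ ·) (F.map_smul (homOfLE hV) r s)).trans ?_
    refine (Linear.comp_smul _ _ _ m _ _).trans ?_
    change _ = T.ρ i hU ((D.A i).scalar hU (TwistedModule.resR hV r)) ≫ m ≫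
      (F.res (homOfLE hV)).map s
    rw [T.ρ_scalar, Linear.smul_comp, Category.id_comp]
  iso_naturality {V W} k P Q φ := TwistedModule.hom_ext fun _ _ hV _ m =>
    (Category.assoc m _ _).trans
      ((congrArg (m ≫ ·) (LinearPrestack.rcomp_naturality φ (leOfHom k) hV)).trans
        (Category.assoc m _ _).symm)
  iso_comp {V W Z} k l kl h Q := by
    subst h
    refine TwistedModule.hom_ext fun i W hV hU m => ?_
    exact (((Category.assoc _ _ _).trans (Category.assoc m _ _)).trans (congrArg (m ≫ ·)
      (LinearPrestack.res_rcomp_inv_comp Q (leOfHom k) (leOfHom l) hV))).symm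

/-- The `R`-functor from `F` to the stack of twisted modules which takes `Q` to the family of
sheaves of morphisms `P i ⟶ Q`. -/
abbrev homFunctor : LinearFunctor F (twistedStack D) := (T.homCore hF).toLinearFunctor

variable {V₁ V₂ W : Opens X} {P : F.obj V₁} {Q : F.obj V₂} {h₁ : W ≤ V₁} {h₂ : W ≤ V₂}

lemma homFunctor_mapHom_app (φ : F.rs h₁ P ⟶ F.rs h₂ Q) (i W' hV hU)
    (m : F.rs hU (T.P i) ⟶ F.rs (hV.trans h₁) P) :
    TwistedModule.Hom.app ((T.homFunctor hF).mapHom φ) i W' hV hU m = m ≫ rmap hV φ := by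
  rw [LinearPrestack.rmap_eq, ← Category.assoc, ← Category.assoc]
  have e : ∀ {V₁} (h : W ≤ V₁) (P : F.obj V₁),
      (T.homFunctor hF).rsIso h P = T.homModuleRes hF h P :=
    fun h P => (T.homCore hF).toLinearFunctor_resIso _ _
  rw [LinearFunctor.mapHom, e, e]
  rfl

/-- The twisted module of `P i` is generated by the identity, so that its morphisms are given by the
image of the identity. -/
lemma homFunctor_mapHom_bijective_of_P {i} (h₁ : W ≤ D.cov.U i) :
    Function.Bijective ((T.homFunctor hF).mapHom : (F.rs h₁ (T.P i) ⟶ F.rs h₂ Q) → _) := by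
  have gen : ((T.homModule hF (T.P i)).restr h₁).IsGenerator h₁ (𝟙 (F.rs h₁ (T.P i))) := by
    intro W' k
    refine Eq.mpr ?_ (T.ρ_bijective i (k.trans h₁))
    congr 1
    funext a
    refine Eq.trans ?_ (Category.comp_id (T.ρ i (k.trans h₁) a))
    exact congrArg (T.ρ i (k.trans h₁) a ≫ ·) (LinearPrestack.rmap_id k)
  refine (Function.Bijective.of_comp_iff' (gen.bijective ((T.homModule hF Q).restr h₂)) _).1 ?_
  refine (congrArg Function.Bijective (?_ : _ = id)).mpr Function.bijective_id
  funext φ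
  refine (T.homFunctor_mapHom_app hF φ i W le_rfl h₁ (𝟙 _)).trans ?_
  exact (Category.id_comp _).trans (LinearPrestack.rmap_refl φ)

end GluingData.Trivialization

end

/-! ### A trivialized stack is equivalent to the stack of twisted modules -/

section

variable {X : TopCat.{u}} {R : TopCat.Sheaf CommRingCat.{u} X}
open LinearPrestack (rmap rcomp rid)

/-- A morphism of sheaves which is locally bijective is bijective. -/
theorem IsOpenSheaf.bijective_of_local {U : Opens X} {T : ∀ W : Opens X, W ≤ U → Type v}
    {T' : ∀ W : Opens X, W ≤ U → Type w}
    {res : ∀ {W W' : Opens X} (h : W ≤ U) (k : W' ≤ W), T W h → T W' (k.trans h)}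
    {res' : ∀ {W W' : Opens X} (h : W ≤ U) (k : W' ≤ W), T' W h → T' W' (k.trans h)}
    (hT : IsOpenSheaf T res) (hT' : IsOpenSheaf T' res') (f : ∀ W h, T W h → T' W h)
    (hf : ∀ {W W'} (h : W ≤ U) (k : W' ≤ W) t, f _ _ (res h k t) = res' h k (f _ _ t))
    (loc : ∀ x ∈ U, ∃ V : Opens X, x ∈ V ∧ ∀ W (h : W ≤ U), W ≤ V → Function.Bijective (f W h))
    (W : Opens X) (h : W ≤ U) : Function.Bijective (f W h) := by
  have inj : ∀ W h, Function.Injective (f W h) := by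
    intro W h t t' e
    refine hT.ext h t t' fun x hx => ?_
    obtain ⟨V, hV, hb⟩ := loc x (h hx)
    refine ⟨W ⊓ V, inf_le_left, ⟨hx, hV⟩, (hb _ _ inf_le_right).1 ?_⟩
    rw [hf, hf, e]
  refine ⟨inj W h, fun t' => ?_⟩
  obtain ⟨t, ht⟩ := hT.exists_of_description h (fun W' k s => f W' (k.trans h) s = res' h k t')
    (fun W' k s s' e e' => inj _ _ (e.trans e'.symm))
    (fun W' k s W'' k' e => by rw [hf, e, hT'.res_res])
    (fun x hx => by
      obtain ⟨V, hV, hb⟩ := loc x (h hx)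
      obtain ⟨s, hs⟩ := (hb (W ⊓ V) (inf_le_left.trans h) inf_le_right).2 (res' h inf_le_left t')
      exact ⟨W ⊓ V, inf_le_left, s, ⟨hx, hV⟩, hs⟩)
  refine ⟨t, hT'.ext h _ _ fun x hx => ?_⟩
  obtain ⟨V, hV, hb⟩ := loc x (h hx)
  obtain ⟨s, hs⟩ := (hb (W ⊓ V) (inf_le_left.trans h) inf_le_right).2 (res' h inf_le_left t')
  refine ⟨W ⊓ V, inf_le_left, ⟨hx, hV⟩, ?_⟩
  rw [← hf, ht _ _ s hs, hs]

namespace LinearPrestack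
variable {F : Prestack R} {V : Opens X}

/-- Isomorphisms of objects of a stack can be glued. -/
theorem nonempty_iso_of_glue (hF : F.IsStack (Opens.grothendieckTopology X)) (P Q : F.obj V)
    (B : V → Opens X) (mem : ∀ x, ↑x ∈ B x) (k : ∀ x, B x ≤ V)
    (s : ∀ x, F.rs (k x) P ≅ F.rs (k x) Q)
    (compat : ∀ (x y) (W : Opens X) (l : W ≤ B x) (l' : W ≤ B y),
      rmapIso l (s x) = rmapIso l' (s y)) : Nonempty (P ≅ Q) := by
  have sh (P Q : F.obj V) := isOpenSheaf_hom hF le_rfl le_rfl P Q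
  obtain ⟨a, ha⟩ := (sh P Q).glue le_rfl B mem k (fun x => (s x).hom)
    (fun x y W l l' => congrArg Iso.hom (compat x y W l l'))
  obtain ⟨b, hb⟩ := (sh Q P).glue le_rfl B mem k (fun x => (s x).inv)
    (fun x y W l l' => congrArg Iso.inv (compat x y W l l'))
  have hab : a ≫ b = 𝟙 _ := (sh P P).ext le_rfl _ _ fun x hx =>
    ⟨B ⟨x, hx⟩, k _, mem ⟨x, hx⟩, by
      rw [rmap_id]
      refine (rmap_comp _ a b).trans ((congrArg₂ (· ≫ ·) (ha _) (hb _)).trans ?_)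
      exact (s _).hom_inv_id⟩
  have hba : b ≫ a = 𝟙 _ := (sh Q Q).ext le_rfl _ _ fun x hx =>
    ⟨B ⟨x, hx⟩, k _, mem ⟨x, hx⟩, by
      rw [rmap_id]
      refine (rmap_comp _ b a).trans ((congrArg₂ (· ≫ ·) (hb _) (ha _)).trans ?_)
      exact (s _).inv_hom_id⟩
  exact ⟨(rid P).symm ≪≫ ⟨a, b, hab, hba⟩ ≪≫ rid Q⟩

end LinearPrestack

namespace LinearFunctor
variable {F G : Prestack R} (η : LinearFunctor F G)

lemma fullyFaithful_of_mapHom_bijective (V : Opens X) (h : ∀ P Q : F.obj V,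
    Function.Bijective (η.mapHom : (F.rs le_rfl P ⟶ F.rs le_rfl Q) → _)) :
    (η.app V).Full ∧ (η.app V).Faithful := by
  have key (P Q : F.obj V) : Function.Bijective ((η.app V).map : (P ⟶ Q) → _) := by
    have h₁ := η.mapHom_bijective_iff.1 (h P Q)
    have h₂ := ((((η.app V).mapIso (rid P)).homCongr ((η.app V).mapIso (rid Q))).bijective.comp
      h₁).comp ((rid P).homCongr (rid Q)).symm.bijective
    convert h₂ using 1
    funext φ
    simp [← Functor.map_comp]
  exact ⟨⟨fun {P Q} => (key P Q).2⟩, ⟨fun {P Q} _ _ e => (key P Q).1 e⟩⟩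

/-- A fully faithful and locally essentially surjective functor of stacks is essentially surjective:
local preimages of an object are glued by descent, along the preimages of the transition
isomorphisms. -/
theorem essSurj_of_local (hF : F.IsStack (Opens.grothendieckTopology X))
    (hG : G.IsStack (Opens.grothendieckTopology X))
    (bij : ∀ {V₁ V₂ W : Opens X} (h₁ : W ≤ V₁) (h₂ : W ≤ V₂) (P : F.obj V₁) (Q : F.obj V₂),
      Function.Bijective (η.mapHom : (F.rs h₁ P ⟶ F.rs h₂ Q) → _))
    (loc : ∀ (V : Opens X) (M : G.obj V), ∀ x ∈ V, ∃ (W : Opens X) (k : W ≤ V), x ∈ W ∧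
      ∃ P : F.obj W, Nonempty ((η.app W).obj P ≅ G.rs k M))
    (V : Opens X) : (η.app V).EssSurj := by
  refine ⟨fun M => ?_⟩
  choose B k mem P e using fun x : V => loc V M x.1 x.2
  -- the restrictions of the isomorphisms `e x`
  let t (x) (W : Opens X) (h : W ≤ B x) : G.rs h ((η.app _).obj (P x)) ≅ G.rs (h.trans (k x)) M :=
    (G.res (homOfLE h)).mapIso (e x).some ≪≫ rcomp M (k x) h
  have rmap_t (x W h W') (l : W' ≤ W) :
      LinearPrestack.rmapIso l (t x W h) = t x W' (l.trans h) := by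
    ext
    simp [t, LinearPrestack.rmap_rcomp_hom]
  have rmap_t_hom (x W h W') (l : W' ≤ W) : rmap l (t x W h).hom = (t x W' (l.trans h)).hom :=
    congrArg Iso.hom (rmap_t x W h W' l)
  have rmap_t_inv (x W h W') (l : W' ≤ W) : rmap l (t x W h).inv = (t x W' (l.trans h)).inv :=
    congrArg Iso.inv (rmap_t x W h W' l)
  -- the transition morphisms between the local preimages
  choose φ hφ using fun x y (W : Opens X) (h : W ≤ B x) (h' : W ≤ B y) =>
    (bij h h' (P x) (P y)).2 ((t x W h).hom ≫ (t y W h').inv)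
  obtain ⟨Q, q, hq⟩ := LinearPrestack.exists_descent hF B k (fun x hx => ⟨⟨x, hx⟩, mem ⟨x, hx⟩⟩) P φ
    (fun x y W h h' W' l => by
      refine (bij _ _ _ _).1 ?_
      rw [← η.rmap_mapHom, hφ, hφ, LinearPrestack.rmap_comp, rmap_t_hom, rmap_t_inv])
    (fun x W h => by
      refine (bij _ _ _ _).1 ?_
      rw [hφ, η.mapHom_id, Iso.hom_inv_id])
    (fun x y z W h h' h'' => by
      refine (bij _ _ _ _).1 ?_
      rw [η.mapHom_comp, hφ, hφ, hφ, Category.assoc, Iso.inv_hom_id_assoc])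
  -- the glued object `Q` restricts to the local preimages
  let c (x) (W : Opens X) (h : W ≤ B x) : F.rs (h.trans (k x)) Q ≅ F.rs h (P x) :=
    (rcomp Q (k x) h).symm ≪≫ (F.res (homOfLE h)).mapIso (q x)
  have rmap_c (x W h W') (l : W' ≤ W) :
      LinearPrestack.rmapIso l (c x W h) = c x W' (l.trans h) := by
    ext
    simp [c, LinearPrestack.rmap_rcomp_inv]
  have c_φ (x y W h h') : (c x W h).hom ≫ φ x y W h h' = (c y W h').hom := by
    simp [c, hq]
  refine ⟨Q, LinearPrestack.nonempty_iso_of_glue hG _ _ B mem k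
    (fun x => η.mapHomIso (c x _ le_rfl) ≪≫ t x _ le_rfl) fun x y W l l' => ?_⟩
  ext
  have hx (x) (l : W ≤ B x) : rmap l (η.mapHom (c x _ le_rfl).hom) = η.mapHom (c x W l).hom :=
    (η.rmap_mapHom l _).trans (congrArg η.mapHom (congrArg Iso.hom (rmap_c x _ le_rfl _ l)))
  simp only [LinearPrestack.rmapIso_hom, Iso.trans_hom, mapHomIso_hom, LinearPrestack.rmap_comp, hx,
    rmap_t_hom]
  rw [← c_φ x y W l l', η.mapHom_comp, hφ]
  simp

end LinearFunctor

namespace GluingData.Trivialization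
variable {D : GluingData R} {F : Prestack R} (T : D.Trivialization F)
  (hF : F.IsStack (Opens.grothendieckTopology X))

theorem homFunctor_mapHom_bijective {V₁ V₂ W : Opens X} (h₁ : W ≤ V₁) (h₂ : W ≤ V₂) (P : F.obj V₁)
    (Q : F.obj V₂) :
    Function.Bijective ((T.homFunctor hF).mapHom : (F.rs h₁ P ⟶ F.rs h₂ Q) → _) := by
  refine (LinearPrestack.isOpenSheaf_hom hF h₁ h₂ P Q).bijective_of_local
    (LinearPrestack.isOpenSheaf_hom (isStack_twistedStack D) h₁ h₂ _ _)
    (fun W h φ => (T.homFunctor hF).mapHom φ)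
    (fun h k φ => ((T.homFunctor hF).rmap_mapHom k φ).symm)
    (fun x hx => ?_) W le_rfl
  -- `P` is locally isomorphic to some `T.P i`
  obtain ⟨i, hi⟩ := D.cov.exists_mem_U x
  obtain ⟨V, k, hxV, ⟨e⟩⟩ := T.locally_iso i (V := W ⊓ D.cov.U i) inf_le_right
      (F.rs (inf_le_left.trans h₁) P) x ⟨hx, hi⟩
  refine ⟨V, hxV, fun W' h' l => ?_⟩
  let e' : F.rs (l.trans (k.trans inf_le_right)) (T.P i) ≅ F.rs (h'.trans h₁) P :=
    LinearPrestack.rmapIso l (e ≪≫ rcomp P (inf_le_left.trans h₁) k)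
  have h := T.homFunctor_mapHom_bijective_of_P hF (Q := Q) (h₂ := h'.trans h₂)
    (l.trans (k.trans inf_le_right))
  have h₂ := (bijective_comp_left ((T.homFunctor hF).mapHomIso e'.symm) _).comp
    (h.comp (bijective_comp_left e' _))
  refine (congrArg Function.Bijective (funext fun φ => ?_)).mpr h₂
  refine ((T.homFunctor hF).mapHom_comp e'.inv (e'.hom ≫ φ) |>.symm.trans ?_).symm
  rw [Iso.inv_hom_id_assoc]

lemma isGenerator_homModule {i : D.cov.ι} {V : Opens X} (hi : V ≤ D.cov.U i) {Q : F.obj V}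
    (e : F.rs hi (T.P i) ≅ F.rs le_rfl Q) : (T.homModule hF Q).IsGenerator hi e.hom :=
  fun _ k => (bijective_comp_right (LinearPrestack.rmapIso k e) _).comp (T.ρ_bijective i _)

theorem homFunctor_isEquivalence (V : Opens X) : ((T.homFunctor hF).app V).IsEquivalence := by
  obtain ⟨h₁, h₂⟩ := (T.homFunctor hF).fullyFaithful_of_mapHom_bijective V
    fun P Q => T.homFunctor_mapHom_bijective hF _ _ P Q
  have h₃ := (T.homFunctor hF).essSurj_of_local hF (isStack_twistedStack D)
    (T.homFunctor_mapHom_bijective hF) (fun V M x hx => by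
      obtain ⟨i, hi⟩ := D.cov.exists_mem_U x
      obtain ⟨W, k, hW, e, hxW, he⟩ := TwistedModule.exists_isGenerator M x hx hi
      exact ⟨W, k, hxW, F.rs hW (T.P i),
        (T.isGenerator_homModule hF hW (rid _).symm).nonempty_iso he⟩) V
  exact {}

end GluingData.Trivialization

end

/-! ### Equivalences with the same target -/

section

section
variable {C : Type u₁} [Category.{v₁} C] {R : Cᵒᵖ ⥤ CommRingCat.{u}}

namespace LinearFunctor
variable {F G H : LinearPrestack.{u, v, w} R} (η : LinearFunctor F H) (θ : LinearFunctor G H)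

/-- A choice of functors `F(V) ⥤ G(V)` whose composition with a fully faithful and essentially
surjective `θ` is `η`. -/
noncomputable def liftApp (V : C) [(θ.app V).IsEquivalence] : F.obj V ⥤ G.obj V where
  obj P := (θ.app V).objPreimage ((η.app V).obj P)
  map φ := (θ.app V).preimage (((θ.app V).objObjPreimageIso _).hom ≫ (η.app V).map φ ≫
    ((θ.app V).objObjPreimageIso _).inv)
  map_id P := (θ.app V).map_injective (by simp)
  map_comp φ ψ := (θ.app V).map_injective (by simp)

/-- The isomorphism `θ ∘ liftApp ≅ η`. -/
noncomputable def liftIso (V : C) [(θ.app V).IsEquivalence] (P : F.obj V) :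
    (θ.app V).obj ((η.liftApp θ V).obj P) ≅ (η.app V).obj P :=
  (θ.app V).objObjPreimageIso _

lemma map_liftApp (V : C) [(θ.app V).IsEquivalence] {P Q : F.obj V} (φ : P ⟶ Q) :
    (θ.app V).map ((η.liftApp θ V).map φ) =
      (η.liftIso θ V P).hom ≫ (η.app V).map φ ≫ (η.liftIso θ V Q).inv :=
  (θ.app V).map_preimage _

lemma map_liftApp_comp (V : C) [(θ.app V).IsEquivalence] {P Q : F.obj V} (φ : P ⟶ Q) :
    (θ.app V).map ((η.liftApp θ V).map φ) ≫ (η.liftIso θ V Q).hom =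
      (η.liftIso θ V P).hom ≫ (η.app V).map φ := by
  rw [map_liftApp]; simp

/-- The compatibility of `liftApp` with restriction. -/
noncomputable def liftRes {V W : C} [(θ.app V).IsEquivalence] [(θ.app W).IsEquivalence] (i : W ⟶ V)
    (P : F.obj V) : (η.liftApp θ W).obj ((F.res i).obj P) ≅ (G.res i).obj ((η.liftApp θ V).obj P) :=
  (θ.app W).preimageIso
    (η.liftIso θ W ((F.res i).obj P) ≪≫ η.resIso i P ≪≫
      (H.res i).mapIso (η.liftIso θ V P).symm ≪≫ (θ.resIso i ((η.liftApp θ V).obj P)).symm)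

lemma map_liftRes {V W : C} [(θ.app V).IsEquivalence] [(θ.app W).IsEquivalence] (i : W ⟶ V)
    (P : F.obj V) : (θ.app W).map (η.liftRes θ i P).hom ≫ (θ.resIso i _).hom ≫
      (H.res i).map (η.liftIso θ V P).hom = (η.liftIso θ W _).hom ≫ (η.resIso i P).hom := by
  rw [liftRes, Functor.preimageIso_hom, Functor.map_preimage]
  simp only [Iso.trans_hom, Iso.symm_hom, Functor.mapIso_hom, Category.assoc,
    Iso.inv_hom_id_assoc]
  rw [← Functor.map_comp, Iso.inv_hom_id, CategoryTheory.Functor.map_id, Category.comp_id]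

/-- Given equivalences `η : F ⟶ H` and `θ : G ⟶ H`, the functor `θ⁻¹ ∘ η : F ⟶ G`. -/
noncomputable def liftCore (hθ : ∀ V, (θ.app V).IsEquivalence) : Core F G where
  app V := η.liftApp θ V
  iso i P := η.liftRes θ i P
  map_add {V P Q} s t := by
    refine (θ.app V).map_injective ?_
    rw [θ.map_add, map_liftApp, map_liftApp, map_liftApp, η.map_add, Preadditive.add_comp,
      Preadditive.comp_add]
  map_smul {V P Q} r s := by
    refine (θ.app V).map_injective ?_
    rw [θ.map_smul, map_liftApp, map_liftApp, η.map_smul, Linear.smul_comp, Linear.comp_smul]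
  iso_naturality {V W} i P Q φ := by
    refine (θ.app W).map_injective ?_
    -- both sides can be computed after composition with `θ.resIso` and `liftIso`
    rw [← cancel_mono (θ.resIso i ((η.liftApp θ V).obj Q)).hom,
      ← cancel_mono ((H.res i).map (η.liftIso θ V Q).hom), Functor.map_comp, Functor.map_comp]
    simp only [Category.assoc]
    rw [map_liftRes, reassoc_of% (η.map_liftApp_comp θ), η.resIso_naturality,
      reassoc_of% (θ.resIso_naturality i), ← Functor.map_comp, map_liftApp_comp, Functor.map_comp,
      reassoc_of% (η.map_liftRes θ)]
  iso_comp {V W Z} i j ij h P := by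
    refine (θ.app Z).map_injective ?_
    have nat := (H.toPseudofunctor.mapComp' i.op.toLoc j.op.toLoc ij.op.toLoc
        (by subst h; rfl)).hom.toNatTrans.naturality (η.liftIso θ V P).hom
    have hθ := θ.resIso_comp i j ij h ((η.liftApp θ V).obj P)
    have hη := η.resIso_comp i j ij h P
    rw [← cancel_mono (θ.resIso j _).hom, ← cancel_mono ((H.res j).map (θ.resIso i _).hom),
      ← cancel_mono ((H.res j).map ((H.res i).map (η.liftIso θ V P).hom))]
    simp only [Category.assoc, Functor.map_comp]
    rw [← reassoc_of% hθ]
    refine (congrArg (fun f => (θ.app Z).map (η.liftRes θ ij P).hom ≫ (θ.resIso ij _).hom ≫ f)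
      nat.symm).trans ?_
    refine Eq.trans ?_ ((congrArg ((η.liftIso θ Z _).hom ≫ ·) hη).trans ?_)
    · exact (reassoc_of% (η.map_liftRes θ ij P)) _
    · rw [← reassoc_of% (η.map_liftApp_comp θ), reassoc_of% (θ.resIso_naturality j),
        ← Functor.map_comp, ← Functor.map_comp, map_liftRes, Functor.map_comp, reassoc_of% (η.map_liftRes θ)]
      rfl

/-- Prestacks which are equivalent to a third one are equivalent. -/
theorem equivalent_of_equivalences (hη : ∀ V, (η.app V).IsEquivalence)
    (hθ : ∀ V, (θ.app V).IsEquivalence) : F.Equivalent G := by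
  refine ⟨(η.liftCore θ hθ).toLinearFunctor, fun V => ?_⟩
  change (η.liftApp θ V).IsEquivalence
  have : (η.liftApp θ V ⋙ θ.app V).IsEquivalence :=
    Functor.isEquivalence_of_iso (F := η.app V) (NatIso.ofComponents
      (fun P => (η.liftIso θ V P).symm) fun φ => by simp [map_liftApp])
  exact Functor.isEquivalence_of_comp_right _ (θ.app V)

end LinearFunctor
end

namespace GluingData
variable {X : TopCat.{u}} {R : TopCat.Sheaf CommRingCat.{u} X} {D : GluingData R}

/-- Stacks with the same gluing data are both equivalent to the stack of twisted modules. -/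
theorem Trivialization.equivalent {F G : Prestack R} (T : D.Trivialization F)
    (T' : D.Trivialization G) (hF : F.IsStack (Opens.grothendieckTopology X))
    (hG : G.IsStack (Opens.grothendieckTopology X)) : F.Equivalent G :=
  (T.homFunctor hF).equivalent_of_equivalences (T'.homFunctor hG) (T.homFunctor_isEquivalence hF)
    (T'.homFunctor_isEquivalence hG)

end GluingData

end

/-! ### The trivialization of the stack of twisted modules -/

section

variable {X : TopCat.{u}} {R : TopCat.Sheaf CommRingCat.{u} X}
open LinearPrestack (rmap rcomp rid)

theorem isAlgebroidStack_twistedStack (D : GluingData R) : IsAlgebroidStack (twistedStack D) where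
  isStack := isStack_twistedStack D
  locally_nonempty x := by
    obtain ⟨i, hi⟩ := D.cov.exists_mem_U x
    exact ⟨D.cov.U i, hi, ⟨freeModule D i⟩⟩
  locally_connected U M N x hx := by
    obtain ⟨i, hi⟩ := D.cov.exists_mem_U x
    obtain ⟨W, k, hW, e, hxW, he⟩ := TwistedModule.exists_isGenerator M x hx hi
    obtain ⟨W', k', hW', e', hxW', he'⟩ := TwistedModule.exists_isGenerator N x hx hi
    refine ⟨W ⊓ W', inf_le_left.trans k, ⟨hxW, hxW'⟩, ?_⟩
    exact (he.restr (inf_le_left : W ⊓ W' ≤ W)).nonempty_iso (he'.restr inf_le_right)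

namespace TwistedModule
variable {D : GluingData R} {i : D.cov.ι} {V : Opens X} {M N : TwistedModule D V}
  {hi : V ≤ D.cov.U i} {e : M.carrier i V le_rfl hi}

/-- Evaluation of endomorphisms at a generator. -/
noncomputable def IsGenerator.evalEquiv (h : M.IsGenerator hi e) :
    (M ⟶ M) ≃+ M.carrier i V le_rfl hi :=
  AddEquiv.ofBijective (AddMonoidHom.mk' (fun f : M ⟶ M => Hom.app f i V le_rfl hi e)
    fun _ _ => rfl) (h.bijective M)

/-- The endomorphism of a free module taking the generator `e` to `e * x`. -/
noncomputable def IsGenerator.endo (h : M.IsGenerator hi e) : D.S i V hi →+ (M ⟶ M) :=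
  h.evalEquiv.symm.toAddMonoidHom.comp (M.act le_rfl hi e)

lemma IsGenerator.endo_app (h : M.IsGenerator hi e) (x : D.S i V hi) :
    Hom.app (h.endo x) i V le_rfl hi e = M.act le_rfl hi e x :=
  h.evalEquiv.apply_symm_apply _

lemma IsGenerator.endo_bijective (h : M.IsGenerator hi e) : Function.Bijective h.endo := by
  have := h V le_rfl
  rw [M.res_refl] at this
  exact h.evalEquiv.symm.bijective.comp this

end TwistedModule

/-- The action of `A i` on the free module at the index `i`. -/
noncomputable def freeEndo (D : GluingData R) (i : D.cov.ι) {W : Opens X} (hW : W ≤ D.cov.U i) :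
    D.S i W hW →+ ((freeModule D i).restr hW ⟶ (freeModule D i).restr hW) :=
  ((isGenerator_freeGen D i).restr hW).endo

/-- The restriction to `W` of the generator of `freeModule D i`. -/
noncomputable def freeGenRes (D : GluingData R) (i : D.cov.ι) {W : Opens X} (hW : W ≤ D.cov.U i) :
    (freeModule D i).carrier i W hW hW :=
  (freeModule D i).res le_rfl le_rfl hW (freeGen D i)

namespace freeModule
variable {D : GluingData R} {i j : D.cov.ι} {W W' : Opens X}
open TwistedModule

lemma endo_app (hW : W ≤ D.cov.U i) (x) :
    Hom.app (freeEndo D i hW x) i W le_rfl hW (freeGenRes D i hW) =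
      (freeModule D i).act hW hW (freeGenRes D i hW) x :=
  ((isGenerator_freeGen D i).restr hW).endo_app x

lemma res_freeGenRes (hW : W ≤ D.cov.U i) (k : W' ≤ W) :
    (freeModule D i).res hW hW k (freeGenRes D i hW) = freeGenRes D i (k.trans hW) :=
  (freeModule D i).res_res _ _ _ _ _

lemma hom_ext {hW : W ≤ D.cov.U i} {N : TwistedModule D W} {f g : (freeModule D i).restr hW ⟶ N}
    (h : Hom.app f i W le_rfl hW (freeGenRes D i hW) =
      Hom.app g i W le_rfl hW (freeGenRes D i hW)) : f = g :=
  (((isGenerator_freeGen D i).restr hW).bijective N).1 h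

lemma exists_iso (α : D.cov.κ i j) :
    ∃ g : (freeModule D j).restr (D.cov.O_le_right α) ≅ (freeModule D i).restr (D.cov.O_le_left α),
      Hom.app g.hom j _ le_rfl (D.cov.O_le_right α) (freeGenRes D j (D.cov.O_le_right α)) =
        (freeModule D i).tr (D.cov.O_le_left α) α le_rfl (freeGenRes D i (D.cov.O_le_left α)) :=
  ((isGenerator_freeGen D j).restr (D.cov.O_le_right α)).exists_iso
    (((isGenerator_freeGen D i).restr (D.cov.O_le_left α)).tr α le_rfl)

/-- The isomorphism of the free modules at the indices `j` and `i` over `O i j α` which takes the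
generator of the first one to the transport of the generator of the second one. -/
noncomputable def isoOn (α : D.cov.κ i j) :
    (freeModule D j).restr (D.cov.O_le_right α) ≅ (freeModule D i).restr (D.cov.O_le_left α) :=
  (exists_iso α).choose

lemma isoOn_app (α : D.cov.κ i j) (hα : W ≤ D.cov.O i j α) :
    Hom.app (isoOn α).hom j W hα (hα.trans (D.cov.O_le_right α))
      (freeGenRes D j (hα.trans (D.cov.O_le_right α))) =
        (freeModule D i).tr (hα.trans (D.cov.O_le_left α)) α hα
          (freeGenRes D i (hα.trans (D.cov.O_le_left α))) := by
  have h := congrArg ((freeModule D i).res (D.cov.O_le_left α) (D.cov.O_le_right α) hα)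
    (exists_iso α).choose_spec
  have h' := (isoOn α).hom.app_res le_rfl (D.cov.O_le_right α) hα
    (freeGenRes D j (D.cov.O_le_right α))
  refine (congrArg _ (res_freeGenRes (D.cov.O_le_right α) hα).symm).trans (h'.trans (h.trans ?_))
  rw [(freeModule D i).res_tr]
  exact congrArg _ (res_freeGenRes (D.cov.O_le_left α) hα)

end freeModule

/-- The canonical trivialization of the stack of twisted modules. -/
noncomputable def twistedTrivialization (D : GluingData R) : D.Trivialization (twistedStack D) where
  P i := freeModule D i
  ρ i W hW := freeEndo D i hW
  ρ_one i W hW := freeModule.hom_ext ((freeModule.endo_app hW 1).trans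
    ((freeModule D i).act_one _ _ _))
  ρ_mul i W hW x y := freeModule.hom_ext (by
    refine (freeModule.endo_app hW _).trans ?_
    rw [(freeModule D i).act_mul, ← freeModule.endo_app]
    refine ((freeEndo D i hW x).app_act le_rfl hW _ y).symm.trans ?_
    exact congrArg (fun m => (freeEndo D i hW x).app i W le_rfl hW m)
      (freeModule.endo_app hW y).symm)
  ρ_bijective i W hW := ((isGenerator_freeGen D i).restr hW).endo_bijective
  rmap_ρ i W W' hW k x := freeModule.hom_ext (by
    refine Eq.trans ?_ (freeModule.endo_app (k.trans hW) _).symm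
    rw [← freeModule.res_freeGenRes hW k, ← (freeModule D i).res_act, ← freeModule.endo_app]
    exact (freeEndo D i hW x).app_res le_rfl hW k _)
  ρ_scalar i W hW r := freeModule.hom_ext ((freeModule.endo_app hW _).trans (by
    refine (congrArg (fun r => (freeModule D i).act hW hW (freeGenRes D i hW)
      ((D.A i).scalar hW r)) ?_)
    exact (ConcreteCategory.congr_hom (R.obj.map_id (op W)) r).symm))
  g α := freeModule.isoOn α
  ρ_g {i j} α W hα x := freeModule.hom_ext (by
    have h₁ := freeModule.endo_app (hα.trans (D.cov.O_le_right α)) x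
    refine (congrArg (fun m => (freeModule.isoOn α).hom.app j W hα _ m) h₁).trans ?_
    refine ((freeModule.isoOn α).hom.app_act hα _ _ x).trans ?_
    have h₂ := freeModule.isoOn_app (D := D) α hα
    refine (congrArg (fun m => (freeModule D i).act _ _ m x) h₂).trans ?_
    refine Eq.trans ?_ (congrArg (fun m => (freeEndo D i _ (D.fs α hα x)).app j W le_rfl
      (hα.trans (D.cov.O_le_right α)) m) h₂).symm
    refine ((freeModule D i).tr_act _ α hα _ x).symm.trans ?_
    rw [← freeModule.endo_app]
    exact ((freeEndo D i _ (D.fs α hα x)).app_tr le_rfl α hα _).symm)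
  g_comp {i j k} α β γ W hα hβ hγ := freeModule.hom_ext (by
    have e₁ := freeModule.isoOn_app (D := D) γ hγ
    have e₂ := freeModule.isoOn_app (D := D) α hα
    have e₃ := freeModule.isoOn_app (D := D) β hβ
    refine (congrArg (fun m => (freeModule.isoOn α).hom.app k W hα _ m) e₁).trans ?_
    refine ((freeModule.isoOn α).hom.app_tr hα γ hγ _).trans ?_
    refine (congrArg (fun m => (freeModule D i).tr _ γ hγ m) e₂).trans ?_
    refine ((freeModule D i).tr_tr _ α β γ hα hβ hγ _).trans ?_
    rw [← freeModule.endo_app]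
    refine ((freeEndo D i _ (D.as α β γ hα hβ hγ).val).app_tr le_rfl β hβ _).symm.trans ?_
    exact (congrArg (fun m => (freeEndo D i _ (D.as α β γ hα hβ hγ).val).app k W le_rfl
      (hγ.trans (D.cov.O_le_right γ)) m) e₃).symm)
  locally_iso i V hV Q x hx := by
    obtain ⟨W, k, hW, e, hxW, he⟩ := TwistedModule.exists_isGenerator Q x hx (hV hx)
    exact ⟨W, k, hxW, ((isGenerator_freeGen D i).restr hW).nonempty_iso he⟩

end

/-! ### Gluing data of a family of objects -/

section

variable {X : TopCat.{u}} {R : TopCat.Sheaf CommRingCat.{u} X}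
open LinearPrestack (rmap rcomp rid rmapIso)

namespace LinearPrestack
variable {F : Prestack R} {U U' O V W : Opens X}

/-- Restriction of endomorphisms, as a homomorphism of rings. -/
def endRes (P : F.obj U) (h : V ≤ U) (k : W ≤ V) : End (F.rs h P) →+* End (F.rs (k.trans h) P) where
  toFun x := rmap k x
  map_one' := rmap_id k
  map_mul' x y := rmap_comp k y x
  map_zero' := (AddMonoidHom.mk' (rmap k : (F.rs h P ⟶ F.rs h P) → _) (rmap_add k)).map_zero
  map_add' x y := rmap_add k x y

/-- The scalar endomorphisms. -/
def endScalar (P : F.obj V) : R.obj.obj (op V) →+* End P where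
  toFun r := r • 𝟙 P
  map_one' := one_smul _ _
  map_mul' r s := by
    change _ = (s • 𝟙 P) ≫ (r • 𝟙 P)
    rw [Linear.smul_comp, Category.id_comp, smul_smul, mul_comm]
  map_zero' := zero_smul _ _
  map_add' r s := add_smul r s _

lemma endScalar_comm (P : F.obj V) (r : R.obj.obj (op V)) (x : End P) :
    endScalar P r * x = x * endScalar P r := by
  change x ≫ (r • 𝟙 P) = (r • 𝟙 P) ≫ x
  rw [Linear.comp_smul, Linear.smul_comp, Category.comp_id, Category.id_comp]

/-- The presheaf of rings of endomorphisms of the restrictions of an object. -/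
def endPresheaf (P : F.obj U) : (Over U)ᵒᵖ ⥤ RingCat.{u} where
  obj V := RingCat.of (End (F.rs (leOfHom V.unop.hom) P))
  map {V W} k := RingCat.ofHom (endRes P (leOfHom V.unop.hom) (leOfHom k.unop.left))
  map_id V := by
    ext x
    exact rmap_refl (F := F) (P := P) (Q := P) x
  map_comp {V W Z} k l := by
    ext x
    exact (rmap_rmap (F := F) (P := P) (Q := P) (leOfHom k.unop.left) (leOfHom l.unop.left) x).symm

/-- The sheaf of algebras of endomorphisms of an object of a stack. -/
def endAlgebra (hF : F.IsStack (Opens.grothendieckTopology X)) (P : F.obj U) : AlgebraOn R U where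
  toSheaf :=
    { obj := endPresheaf P
      property := by
        rw [Presheaf.isSheaf_iff_isSheaf_forget _ _ (forget RingCat)]
        exact hF.toIsPrestack.isSheaf P P }
  structureMap :=
    { app := fun V => RingCat.ofHom (endScalar (F.rs (leOfHom V.unop.hom) P))
      naturality := fun V W k => by
        ext r
        refine Eq.symm
          ((rmap_smul (F := F) (P := P) (Q := P) (leOfHom k.unop.left) r (𝟙 _)).trans ?_)
        exact congrArg ((R.obj.map (homOfLE (leOfHom k.unop.left)).op).hom r • ·) (rmap_id _) }
  central V r x := endScalar_comm (F.rs (leOfHom V.unop.hom) P) r x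

/-- Conjugation by an isomorphism. -/
def endConj {P Q : F.obj V} (e : P ≅ Q) : End P ≃+* End Q :=
  { e.conj with
    map_add' := fun x y => by
      change e.inv ≫ (x + y) ≫ e.hom = e.inv ≫ x ≫ e.hom + e.inv ≫ y ≫ e.hom
      rw [Preadditive.add_comp, Preadditive.comp_add] }

lemma endConj_endScalar {P Q : F.obj V} (e : P ≅ Q) (r : R.obj.obj (op V)) :
    endConj e (endScalar P r) = endScalar Q r := by
  change e.inv ≫ (r • 𝟙 P) ≫ e.hom = r • 𝟙 Q
  rw [Linear.smul_comp, Linear.comp_smul, Category.id_comp, Iso.inv_hom_id]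

/-- Conjugation by an isomorphism over `O`, as an isomorphism of sheaves of algebras. -/
def endAlgebraIso (hF : F.IsStack (Opens.grothendieckTopology X)) {P : F.obj U} {Q : F.obj U'}
    {h : O ≤ U} {h' : O ≤ U'} (e : F.rs h P ≅ F.rs h' Q) :
    ((endAlgebra hF P).restrict (homOfLE h)).Iso ((endAlgebra hF Q).restrict (homOfLE h')) where
  toIso := ObjectProperty.isoMk _ (NatIso.ofComponents
    (fun V => (endConj (rmapIso (leOfHom V.unop.hom) e)).toRingCatIso) fun {V W} k => by
      ext x
      refine Eq.symm ((rmap_comp (leOfHom k.unop.left) (rmap (leOfHom V.unop.hom) e.inv)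
        ((show F.rs ((leOfHom V.unop.hom).trans h) P ⟶ _ from x) ≫
          rmap (leOfHom V.unop.hom) e.hom)).trans ?_)
      refine (congrArg (_ ≫ ·) (rmap_comp (leOfHom k.unop.left)
        (show F.rs ((leOfHom V.unop.hom).trans h) P ⟶ _ from x)
        (rmap (leOfHom V.unop.hom) e.hom))).trans ?_
      refine congrArg₂ (fun a b => a ≫ rmap (leOfHom k.unop.left)
        (show F.rs ((leOfHom V.unop.hom).trans h) P ⟶
          F.rs ((leOfHom V.unop.hom).trans h) P from x) ≫ b)
        (rmap_rmap _ _ e.inv) (rmap_rmap _ _ e.hom))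
  structureMap_comp := by
    ext V r
    exact endConj_endScalar (rmapIso (leOfHom V.unop.hom) e) r

end LinearPrestack

open LinearPrestack

/-- An open covering with an object over each member and isomorphisms over the open subsets
which cover the double intersections. -/
structure ObjectFamily (F : Prestack R) where
  cov : Covering X
  P (i : cov.ι) : F.obj (cov.U i)
  g {i j : cov.ι} (α : cov.κ i j) : F.rs (cov.O_le_right α) (P j) ≅ F.rs (cov.O_le_left α) (P i)

namespace ObjectFamily
variable {F : Prestack R} (c : ObjectFamily F) (hF : F.IsStack (Opens.grothendieckTopology X))

/-- The isomorphisms restricted to smaller open subsets. -/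
abbrev gs {i j : c.cov.ι} (α : c.cov.κ i j) {W : Opens X} (h : W ≤ c.cov.O i j α) :
    F.rs (h.trans (c.cov.O_le_right α)) (c.P j) ≅ F.rs (h.trans (c.cov.O_le_left α)) (c.P i) :=
  rmapIso h (c.g α)

/-- The automorphism comparing the composition of two of the isomorphisms with the third one. -/
def aut {i j k : c.cov.ι} (α : c.cov.κ i j) (β : c.cov.κ i k) (γ : c.cov.κ j k) {W : Opens X}
    (hα : W ≤ c.cov.O i j α) (hβ : W ≤ c.cov.O i k β) (hγ : W ≤ c.cov.O j k γ) :
    Aut (F.rs (hα.trans (c.cov.O_le_left α)) (c.P i)) :=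
  (c.gs β hβ).symm ≪≫ c.gs γ hγ ≪≫ c.gs α hα

variable {c} in
lemma rmapIso_aut {i j k : c.cov.ι} {α : c.cov.κ i j} {β : c.cov.κ i k} {γ : c.cov.κ j k}
    {W W' : Opens X} {hα : W ≤ c.cov.O i j α} {hβ : W ≤ c.cov.O i k β} {hγ : W ≤ c.cov.O j k γ}
    (l : W' ≤ W) : rmapIso l (c.aut α β γ hα hβ hγ) =
      c.aut α β γ (l.trans hα) (l.trans hβ) (l.trans hγ) := by
  ext
  simp [aut]

/-- The gluing data of a family of objects: the algebras are the endomorphisms of the objects, the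
isomorphisms of algebras are given by conjugation, and the multipliers by `aut`. -/
def gluingData : GluingData R where
  cov := c.cov
  A i := endAlgebra hF (c.P i)
  f α := endAlgebraIso hF (c.g α)
  a α β γ := (Aut.unitsEndEquivAut _).symm
    (c.aut α β γ (c.cov.T_le₁ α β γ) (c.cov.T_le₂ α β γ) (c.cov.T_le₃ α β γ))
  f_f {i j k} α β γ V h x := by
    have key {P Q S : F.obj V} (a : Q ≅ S) (b : P ≅ S) (c : P ≅ Q) (x : P ⟶ P) :
        a.inv ≫ (c.inv ≫ x ≫ c.hom) ≫ a.hom = (b.symm ≪≫ c ≪≫ a).inv ≫ (b.inv ≫ x ≫ b.hom) ≫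
          (b.symm ≪≫ c ≪≫ a).hom := by simp
    have e : rmapIso h (c.aut α β γ (c.cov.T_le₁ α β γ) (c.cov.T_le₂ α β γ) (c.cov.T_le₃ α β γ)) =
      c.aut α β γ _ _ _ := rmapIso_aut h
    refine (key (c.gs α (h.trans (c.cov.T_le₁ α β γ))) (c.gs β (h.trans (c.cov.T_le₂ α β γ)))
      (c.gs γ (h.trans (c.cov.T_le₃ α β γ))) x).trans ?_
    exact congrArg (fun a : F.rs _ (c.P i) ≅ F.rs _ (c.P i) => a.inv ≫
      ((c.gs β (h.trans (c.cov.T_le₂ α β γ))).inv ≫ x ≫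
        (c.gs β (h.trans (c.cov.T_le₂ α β γ))).hom) ≫ a.hom) e.symm
  cocycle {i j k l} α β γ δ ε φ V h₁ h₂ h₃ h₄ := by
    have key {P Q S Z : F.obj V} (α : Q ≅ P) (β : S ≅ P) (γ : S ≅ Q) (δ : Z ≅ P) (ε : Z ≅ Q)
        (φ : Z ≅ S) : (δ.symm ≪≫ φ ≪≫ β).hom ≫ (β.symm ≪≫ γ ≪≫ α).hom =
          (δ.symm ≪≫ ε ≪≫ α).hom ≫ α.inv ≫ (ε.symm ≪≫ φ ≪≫ γ).hom ≫ α.hom := by simp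
    have e {i j k} (α : c.cov.κ i j) (β : c.cov.κ i k) (γ : c.cov.κ j k) (h : V ≤ c.cov.T α β γ) :
      rmap h (c.aut α β γ (c.cov.T_le₁ α β γ) (c.cov.T_le₂ α β γ) (c.cov.T_le₃ α β γ)).hom =
        (c.aut α β γ _ _ _).hom := congrArg Iso.hom (rmapIso_aut h)
    refine (congrArg₂ (· ≫ ·) (e β δ φ h₃) (e α β γ h₁)).trans
      ((key (c.gs α _) (c.gs β _) (c.gs γ _)
      (c.gs δ _) (c.gs ε (h₂.trans (c.cov.T_le₃ α δ ε))) (c.gs φ _)).trans ?_)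
    exact congrArg₂ (fun a b => a ≫ (c.gs α (h₁.trans (c.cov.T_le₁ α β γ))).inv ≫ b ≫
      (c.gs α (h₁.trans (c.cov.T_le₁ α β γ))).hom) (e α δ ε h₂).symm (e γ ε φ h₄).symm

/-- A family of objects of an algebroid stack trivializes it. -/
def trivialization (hA : IsAlgebroidStack F) :
    (c.gluingData hA.isStack).Trivialization F where
  P := c.P
  ρ i W hW := AddMonoidHom.id (F.rs hW (c.P i) ⟶ F.rs hW (c.P i))
  ρ_one i W hW := rfl
  ρ_mul i W hW x y := rfl
  ρ_bijective i W hW := Function.bijective_id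
  rmap_ρ i W W' hW k x := rfl
  ρ_scalar i W hW r := rfl
  g α := c.g α
  ρ_g {i j} α W hα x := ((c.gs α hα).hom_inv_id_assoc (_ ≫ (c.gs α hα).hom)).symm
  g_comp {i j k} α β γ W hα hβ hγ := by
    have e : rmap (le_inf (le_inf hα hβ) hγ)
      (c.aut α β γ (c.cov.T_le₁ α β γ) (c.cov.T_le₂ α β γ) (c.cov.T_le₃ α β γ)).hom =
        (c.aut α β γ hα hβ hγ).hom := congrArg Iso.hom (rmapIso_aut _)
    refine ((c.gs β hβ).hom_inv_id_assoc ((c.gs γ hγ).hom ≫ (c.gs α hα).hom)).symm.trans ?_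
    exact congrArg ((c.gs β hβ).hom ≫ ·) e.symm
  locally_iso i V hV Q x hx := by
    obtain ⟨W, k, hxW, ⟨e⟩⟩ := hA.locally_connected V (F.rs hV (c.P i)) Q x hx
    exact ⟨W, k, hxW, ⟨(rcomp (c.P i) hV k).symm ≪≫ e⟩⟩

end ObjectFamily

end

/-! ### Families of objects in an algebroid stack -/

section

variable {X : TopCat.{u}} {R : TopCat.Sheaf CommRingCat.{u} X}
open LinearPrestack (rmap rcomp rid rmapIso)

namespace IsAlgebroidStack
variable {F : Prestack R}

lemma exists_iso_on (hF : IsAlgebroidStack F) {U V : Opens X} (P : F.obj U) (Q : F.obj V)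
    {x : X} (hU : x ∈ U) (hV : x ∈ V) :
    ∃ (W : Opens X) (h : W ≤ U) (k : W ≤ V), x ∈ W ∧ Nonempty (F.rs k Q ≅ F.rs h P) := by
  obtain ⟨W, h, hx, ⟨e⟩⟩ := hF.locally_connected (U ⊓ V) (F.rs inf_le_right Q) (F.rs inf_le_left P)
    x ⟨hU, hV⟩
  exact ⟨W, h.trans inf_le_left, h.trans inf_le_right, hx,
    ⟨(rcomp Q inf_le_right h).symm ≪≫ e ≪≫ rcomp P inf_le_left h⟩⟩

/-- Choose an object near each point, and an isomorphism near each point of a double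
intersection. -/
theorem nonempty_objectFamily (hF : IsAlgebroidStack F) : Nonempty (ObjectFamily F) := by
  choose U mem P using hF.locally_nonempty
  choose O h k memO e using fun (x y : X) (z : (U x ⊓ U y : Opens X)) =>
    hF.exists_iso_on (P x).some (P y).some z.2.1 z.2.2
  exact ⟨{
    cov :=
      { ι := X
        U := U
        iSup_U := top_le_iff.1 fun x _ => Opens.mem_iSup.2 ⟨x, mem x⟩
        κ := fun x y => (U x ⊓ U y : Opens X)
        O := O
        iSup_O := fun x y => le_antisymm (iSup_le fun z => le_inf (h x y z) (k x y z))
          fun z hz => Opens.mem_iSup.2 ⟨⟨z, hz⟩, memO x y ⟨z, hz⟩⟩ }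
    P := fun x => (P x).some
    g := fun {x y} z => (e x y z).some }⟩

/-- On a paracompact Hausdorff space the isomorphisms can be taken over whole double
intersections. -/
theorem exists_ordinary_objectFamily [T2Space X] [ParacompactSpace X]
    (hF : IsAlgebroidStack F) :
    ∃ c : ObjectFamily F, c.cov.IsOrdinary := by
  choose U mem P using hF.locally_nonempty
  obtain ⟨V₀, hV₀, cov₀, fin₀, hVU₀⟩ := precise_refinement (fun x => (U x : Set X))
    (fun x => (U x).isOpen) (Set.iUnion_eq_univ_iff.2 fun x => ⟨x, mem x⟩)
  obtain ⟨V, cov, hV, hVV₀⟩ := exists_subset_iUnion_closure_subset isClosed_univ hV₀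
    (fun x _ => fin₀.point_finite x) cov₀.ge
  have fin : LocallyFinite V := fin₀.subset fun x => subset_closure.trans (hVV₀ x)
  have hVU (x) : closure (V x) ⊆ U x := (hVV₀ x).trans (hVU₀ x)
  choose i hi using fun x : X => Set.mem_iUnion.1 (cov (Set.mem_univ x))
  have hiU (x : X) : x ∈ U (i x) := hVU _ (subset_closure (hi x))
  -- a neighbourhood `W` of `x` inside `V (i x)` which meets `V j` only if `x` lies in the closure
  -- of `V j`; for these finitely many `j` the object at `j` is isomorphic over `W` to that at `i x`
  have key (x : X) : ∃ W : Opens X, x ∈ W ∧ ((W : Set X) ⊆ V (i x)) ∧ ∀ j, (∃ z ∈ W, z ∈ V j) →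
      ∃ (h : W ≤ U (i x)) (k : W ≤ U j), Nonempty (F.rs k (P j).some ≅ F.rs h (P (i x)).some) := by
    choose N h k memN e using fun j (hj : x ∈ closure (V j)) =>
      hF.exists_iso_on (P (i x)).some (P j).some (hiU x) (hVU j hj)
    have h₁ : V (i x) ∈ nhds x := (hV _).mem_nhds (hi x)
    have h₂ := fin.closure.iInter_compl_mem_nhds (fun _ => isClosed_closure) x
    have h₃ : (⋂ (j) (hj : x ∈ closure (V j)), (N j hj : Set X)) ∈ nhds x := by
      have : Finite {j | x ∈ closure (V j)} := fin.closure.point_finite x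
      have := (Filter.iInter_mem (f := nhds x)
        (s := fun j : {j | x ∈ closure (V j)} => (N j.1 j.2 : Set X))).2
          fun j => (N j.1 j.2).isOpen.mem_nhds (memN j.1 j.2)
      rwa [Set.iInter_subtype] at this
    obtain ⟨W, hW, hWo, hxW⟩ := mem_nhds_iff.1 (Filter.inter_mem (Filter.inter_mem h₁ h₂) h₃)
    refine ⟨⟨W, hWo⟩, hxW, fun z hz => (hW hz).1.1, ?_⟩
    rintro j ⟨z, hz, hzj⟩
    have hj : x ∈ closure (V j) := by
      by_contra hj
      exact Set.mem_iInter₂.1 (hW hz).1.2 j hj (subset_closure hzj)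
    have l : (⟨W, hWo⟩ : Opens X) ≤ N j hj := fun z hz => Set.mem_iInter₂.1 (hW hz).2 j hj
    exact ⟨l.trans (h j hj), l.trans (k j hj), ⟨rmapIso l (e j hj).some⟩⟩
  choose W memW hWV e using key
  have hWU (x) : W x ≤ U (i x) := fun z hz => hVU _ (subset_closure (hWV x hz))
  let Q (x) : F.obj (W x) := F.rs (hWU x) (P (i x)).some
  have g (x y) : Nonempty (F.rs (inf_le_right : W x ⊓ W y ≤ _) (Q y) ≅
      F.rs (inf_le_left : W x ⊓ W y ≤ _) (Q x)) := by
    by_cases hxy : ∃ z, z ∈ W x ⊓ W y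
    · -- `W x` meets `V (i y)`, which contains `W y`
      obtain ⟨z, hzx, hzy⟩ := hxy
      obtain ⟨h, k, ⟨f⟩⟩ := e x (i y) ⟨z, hzx, hWV y hzy⟩
      exact ⟨rcomp _ (hWU y) inf_le_right ≪≫ rmapIso (inf_le_left : W x ⊓ W y ≤ _) f ≪≫
        (rcomp _ (hWU x) inf_le_left).symm⟩
    · -- over an empty intersection, all objects are isomorphic
      push Not at hxy
      exact LinearPrestack.nonempty_iso_of_glue hF.isStack _ _ (fun z => (hxy _ z.2).elim)
        (fun z => (hxy _ z.2).elim) (fun z => (hxy _ z.2).elim) (fun z => (hxy _ z.2).elim)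
        (fun z => (hxy _ z.2).elim)
  exact ⟨{
    cov :=
      { ι := X
        U := W
        iSup_U := top_le_iff.1 fun x _ => Opens.mem_iSup.2 ⟨x, memW x⟩
        κ := fun x y => PUnit
        O := fun x y _ => W x ⊓ W y
        iSup_O := fun x y => iSup_const }
    P := Q
    g := fun {x y} _ => (g x y).some }, fun x y => ⟨inferInstanceAs (Unique PUnit)⟩⟩

end IsAlgebroidStack

end

end Algebroid

open Algebroid in
theorem mainTheorem3 (X : TopCat.{u}) (R : TopCat.Sheaf CommRingCat.{u} X) :
    (∀ 𝔄 : Prestack R, IsAlgebroidStack 𝔄 → ∃ D : GluingData R, Nonempty (D.Presentation 𝔄)) ∧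
    (∀ D : GluingData R, ∃ 𝔄 : Prestack R, IsAlgebroidStack 𝔄 ∧ Nonempty (D.Presentation 𝔄)) ∧
    (∀ (D : GluingData R) (𝔄 𝔅 : Prestack R),
      𝔄.IsStack (Opens.grothendieckTopology X) → 𝔅.IsStack (Opens.grothendieckTopology X) →
      Nonempty (D.Presentation 𝔄) → (Nonempty (D.Presentation 𝔅) ↔ 𝔄.Equivalent 𝔅)) ∧
    (T2Space X → ParacompactSpace X → ∀ 𝔄 : Prestack R, IsAlgebroidStack 𝔄 →
      ∃ D : GluingData R, D.cov.IsOrdinary ∧ Nonempty (D.Presentation 𝔄)) := by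
  refine ⟨fun 𝔄 h𝔄 => ?_, fun D => ?_, fun D 𝔄 𝔅 h𝔄 h𝔅 ⟨p⟩ => ⟨fun ⟨q⟩ => ?_, fun ⟨η, hη⟩ => ?_⟩,
    fun _ _ 𝔄 h𝔄 => ?_⟩
  · obtain ⟨c⟩ := h𝔄.nonempty_objectFamily
    exact ⟨_, ⟨(c.trivialization h𝔄).toPresentation h𝔄.isStack⟩⟩
  · exact ⟨twistedStack D, isAlgebroidStack_twistedStack D,
      ⟨(twistedTrivialization D).toPresentation (isStack_twistedStack D)⟩⟩
  · exact p.toTrivialization.equivalent q.toTrivialization h𝔄 h𝔅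
  · exact ⟨(p.toTrivialization.map η hη).toPresentation h𝔅⟩
  · obtain ⟨c, hc⟩ := h𝔄.exists_ordinary_objectFamily
    exact ⟨_, hc, ⟨(c.trivialization h𝔄).toPresentation h𝔄.isStack⟩⟩
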